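/- Let $\Phi$ be a homogeneous Poisson point process on $\mathbb R^2$ with intensity $\lambda>0$. A user starts at the origin at time $0$ and moves along a straight line with constant speed $v>0$. Let $L(t)$ be the distance at time $t\ge 0$ from the user to the closest point of $\Phi$. Let $\mathrm{SNR}(t)=pL(t)^{-\beta}/w$ with $p,w>0$ and $\beta>2$. For $\gamma>0$ put $C^{(\gamma)}(t)=\mathbf 1(\mathrm{SNR}(t)\ge\gamma)$ and $r_\gamma=(p/(w\gamma))^{1/\beta}$. The process $C^{(\gamma)}$ is called on when it equals $1$ and off when it equals $0$. Let $T_1<T_2<\cdots$ be its successive up-crossing times in $(0,\infty)$, that is, the times at which it goes from off to on. Let $B_n$ be the length of the on interval that starts at $T_n$, and $I_n$ the length of the off interval that follows it, so that $T_{n+1}=T_n+B_n+I_n$. Consider an $M/GI/\infty$ queue that is empty at time $0$, with Poisson arrivals of rate $\lambda^{(\gamma)}=2r_\gamma v\lambda$ and i.i.d. service times, independent of the arrivals, with density $$f(s)=\frac{v^2s}{2r_\gamma\sqrt{4r_\gamma^2-v^2s^2}}\ \text{ for } 0\le s<2r_\gamma/v,\qquad f(s)=0\ \text{ otherwise.}$$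 **Theorem.** For every $\gamma>0$ the following hold. 1. $C^{(\gamma)}$ is an alternating renewal process: almost surely it alternates for ever between on and off intervals of positive finite length, finitely many in bounded time, and $(B_n)_{n\ge1}$ and $(I_n)_{n\ge1}$ are independent sequences of i.i.d. random variables. 2. The busy and idle periods of the queue also form an alternating renewal process. Every $B_n$ is distributed as a busy period of the queue, and every $I_n$ as an idle period. 3. In particular $I_n$ is exponentially distributed with rate $2\lambda vr_\gamma$. 4. The law of the on period is described as follows. For a nonnegative random variable $Y$ with $0<\mathbb E[Y]<\infty$ let $\hat Y$ be its forward recurrence time, $\mathbb P(\hat Y>x)=\frac1{\mathbb E[Y]}\int_x^\infty\mathbb P(Y>z)\,dz$ for $x\ge 0$. Let $W$ have density $f$. Put $\rho=\lambda^{(\gamma)}\mathbb E[W]$ and $\nu=1-e^{-\rho}$. Let $U_1,U_2,\dots$ be i.i.d. with $\mathbb P(U_i\le u)=\frac1\nu\bigl(1-e^{-\rho\,\mathbb P(\hat W\le u)}\bigr)$ for $u\ge0$, and let $M$ be independent of them with $\mathbb P(M=l)=(1-\nu)\nu^{l-1}$ for $l\ge1$. Then $0<\mathbb E[B_n]<\infty$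 and $\hat B_n$ has the same distribution as $\sum_{i=1}^M U_i$. 5. $C^{(\gamma)}$ is a stationary process on $[0,\infty)$, and $\mathbb P(C^{(\gamma)}(t)=1)=1-e^{-\lambda\pi r_\gamma^2}$ for every $t\ge0$. -/

import Mathlib

open MeasureTheory ProbabilityTheory Set Filter Topology

namespace SNRCrossing

noncomputable section

/-- The Euclidean plane. -/
abbrev Plane : Type := EuclideanSpace ℝ (Fin 2)

/-! ### The Poisson network and the SNR process -/

/-- `Φ` is a homogeneous Poisson point process on the plane with intensity `lam`: a random locally
finite set whose numbers of points in bounded Borel sets are Poisson distributed with mean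
`lam * area`, and independent over pairwise disjoint sets. -/
structure IsPoissonProcess {Ω : Type*} [MeasurableSpace Ω] (P : Measure Ω)
    (Φ : Ω → Set Plane) (lam : ℝ) : Prop where
  locallyFinite : ∀ᵐ ω ∂P, ∀ A : Set Plane, Bornology.IsBounded A → (Φ ω ∩ A).Finite
  law_count : ∀ A : Set Plane, MeasurableSet A → Bornology.IsBounded A →
    HasLaw (fun ω ↦ (Φ ω ∩ A).ncard) (poissonMeasure (lam * volume.real A).toNNReal) P
  indep_count : ∀ (k : ℕ) (A : Fin k → Set Plane), (∀ i, MeasurableSet (A i)) →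
    (∀ i, Bornology.IsBounded (A i)) → Pairwise (fun i j ↦ Disjoint (A i) (A j)) →
    iIndepFun (fun i ω ↦ (Φ ω ∩ A i).ncard) P

/-- Location at time `t` of a user that starts at the origin and moves with speed `v` in the
direction of the unit vector `e`. -/
def position (v : ℝ) (e : Plane) (t : ℝ) : Plane := (t * v) • e

/-- The signal-to-noise ratio `p * L ^ (-β) / w` at the location `x`, where `L` is the distance
from `x` to the closest node. It takes values in `[0, ∞]`; it is `∞` if `L = 0`,
and `0` if there is no node at all. -/
def snr (p w β : ℝ) (nodes : Set Plane) (x : Plane) : ENNReal :=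
  ENNReal.ofReal p * (Metric.infEDist x nodes) ^ (-β) / ENNReal.ofReal w

/-- The SNR level crossing process: the indicator of `SNR(t) ≥ γ`. -/
def levelCrossing {Ω : Type*} (Φ : Ω → Set Plane) (p w β v γ : ℝ) (e : Plane)
    (t : ℝ) (ω : Ω) : ℕ :=
  if ENNReal.ofReal γ ≤ snr p w β (Φ ω) (position v e t) then 1 else 0

/-- The times at which the SNR level crossing process is on. -/
def coveredTimes {Ω : Type*} (Φ : Ω → Set Plane) (p w β v γ : ℝ) (e : Plane) (ω : Ω) : Set ℝ :=
  {t | levelCrossing Φ p w β v γ e t ω = 1}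

/-- The radius of coverage. -/
def coverageRadius (p w β γ : ℝ) : ℝ := (p / (w * γ)) ^ (1 / β)

/-! ### On and off periods

Here `S` is the set of times at which an on/off path, observed from time `0`, is on. -/

/-- The first time after `t` at which the path is on. -/
def nextOn (S : Set ℝ) (t : ℝ) : ℝ := sInf {s | t < s ∧ s ∈ S}

/-- The first time after `t` at which the path is off. -/
def nextOff (S : Set ℝ) (t : ℝ) : ℝ := sInf {s | t < s ∧ s ∉ S}

/-- The up-crossing times, that is, the times in `(0, ∞)` at which the path goes from off to on,
in increasing order. An on interval that is already under way at time `0` is skipped: if the path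
is off just after time `0`, then `nextOff S 0 = 0`. -/
def upCrossing (S : Set ℝ) : ℕ → ℝ
  | 0 => nextOn S (nextOff S 0)
  | n + 1 => nextOn S (nextOff S (upCrossing S n))

/-- The end of the on interval that starts at the `n`-th up-crossing. -/
def downCrossing (S : Set ℝ) (n : ℕ) : ℝ := nextOff S (upCrossing S n)

/-- The length of the on interval that starts at the `n`-th up-crossing. -/
def onPeriod (S : Set ℝ) (n : ℕ) : ℝ := downCrossing S n - upCrossing S n

/-- The length of the off interval that follows the `n`-th on interval. -/
def offPeriod (S : Set ℝ) (n : ℕ) : ℝ := upCrossing S (n + 1) - downCrossing S n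

/-- The path alternates for ever between on and off intervals of positive finite length, finitely
many in bounded time; the first interval, observed from time `0`, may be on or off. -/
structure Alternates (S : Set ℝ) : Prop where
  initial_nonneg : 0 ≤ nextOff S 0
  initial_lt : nextOff S 0 < upCrossing S 0
  initial_on : Ioo 0 (nextOff S 0) ⊆ S
  initial_off : Ioo (nextOff S 0) (upCrossing S 0) ⊆ Sᶜ
  up_lt_down : ∀ n, upCrossing S n < downCrossing S n
  down_lt_up : ∀ n, downCrossing S n < upCrossing S (n + 1)
  on : ∀ n, Ioo (upCrossing S n) (downCrossing S n) ⊆ S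
  off : ∀ n, Ioo (downCrossing S n) (upCrossing S (n + 1)) ⊆ Sᶜ
  tendsto : Tendsto (upCrossing S) atTop atTop

/-- A random on/off path is an alternating renewal process: it alternates between on and off
intervals, and the sequences of on periods and of off periods from the first up-crossing onwards
are independent sequences of i.i.d. random variables. -/
structure IsAlternatingRenewal {Ω : Type*} [MeasurableSpace Ω] (P : Measure Ω)
    (S : Ω → Set ℝ) : Prop where
  alternates : ∀ᵐ ω ∂P, Alternates (S ω)
  on_ident : ∀ n, IdentDistrib (fun ω ↦ onPeriod (S ω) n) (fun ω ↦ onPeriod (S ω) 0) P P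
  off_ident : ∀ n, IdentDistrib (fun ω ↦ offPeriod (S ω) n) (fun ω ↦ offPeriod (S ω) 0) P P
  on_indep : iIndepFun (fun n ω ↦ onPeriod (S ω) n) P
  off_indep : iIndepFun (fun n ω ↦ offPeriod (S ω) n) P
  indep : IndepFun (fun ω n ↦ onPeriod (S ω) n) (fun ω n ↦ offPeriod (S ω) n) P

/-- Strict stationarity on `[0, ∞)`: finite-dimensional distributions are invariant under time
shifts. -/
def IsStationaryProcess {Ω : Type*} [MeasurableSpace Ω] (P : Measure Ω) (C : ℝ → Ω → ℕ) : Prop :=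
  ∀ (k : ℕ) (t : Fin k → ℝ) (h : ℝ), (∀ i, 0 ≤ t i) → 0 ≤ h →
    IdentDistrib (fun ω i ↦ C (t i + h) ω) (fun ω i ↦ C (t i) ω) P P

/-! ### The M/GI/∞ queue -/

/-- The data of an M/GI/∞ queue, empty at time `0`: inter-arrival times `X` that are i.i.d.
exponential with rate `a` (that is, Poisson arrivals with rate `a`), and service times `W` that
are i.i.d. with law `σ` and independent of the arrivals. -/
structure IsMGInfQueue {Ω : Type*} [MeasurableSpace Ω] (P : Measure Ω) (a : ℝ) (σ : Measure ℝ)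
    (X W : ℕ → Ω → ℝ) : Prop where
  law_arrival : ∀ n, HasLaw (X n) (expMeasure a) P
  law_service : ∀ n, HasLaw (W n) σ P
  indep : iIndepFun (fun i : ℕ ⊕ ℕ ↦ Sum.elim X W i) P

/-- The arrival time of the `n`-th customer. -/
def arrivalTime {Ω : Type*} (X : ℕ → Ω → ℝ) (n : ℕ) (ω : Ω) : ℝ :=
  ∑ i ∈ Finset.range (n + 1), X i ω

/-- The number of customers at time `t`: every customer is served at once, by a server of its own,
and leaves when its service is over. -/
def numCustomers {Ω : Type*} (X W : ℕ → Ω → ℝ) (t : ℝ) (ω : Ω) : ℕ∞ :=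
  {n : ℕ | arrivalTime X n ω ≤ t ∧ t < arrivalTime X n ω + W n ω}.encard

/-- The times at which the queue is not empty. Its on periods are the busy periods of the queue,
and its off periods are the idle periods. -/
def busyTimes {Ω : Type*} (X W : ℕ → Ω → ℝ) (ω : Ω) : Set ℝ :=
  {t | numCustomers X W t ω ≠ 0}

/-- The density of the chord-length service time. -/
def serviceDensity (r v s : ℝ) : ℝ :=
  if s ∈ Icc 0 (2 * r / v) then v ^ 2 * s / (2 * r * √(4 * r ^ 2 - v ^ 2 * s ^ 2)) else 0

/-- The law of the chord-length service time. -/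
def serviceLaw (r v : ℝ) : Measure ℝ :=
  volume.withDensity (fun s ↦ ENNReal.ofReal (serviceDensity r v s))

/-! ### Explicit description of the busy period -/

/-- The law of the forward recurrence time of a nonnegative random variable `Y` with law `μ`: it
has density `ℙ(Y > z) / 𝔼[Y]` on `[0, ∞)`. -/
def forwardRecurrence (μ : Measure ℝ) : Measure ℝ :=
  (∫⁻ y, ENNReal.ofReal y ∂μ)⁻¹ • (volume.restrict (Ici 0)).withDensity (fun z ↦ μ (Ioi z))

/-- The offered load `ρ`, that is, arrival rate times mean service time. -/
def load (a : ℝ) (σ : Measure ℝ) : ℝ := a * ∫ s, s ∂σ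

/-- The number `ν = 1 - exp (-ρ)`. -/
def busyProb (a : ℝ) (σ : Measure ℝ) : ℝ := 1 - Real.exp (-load a σ)

/-- `M` has the geometric law `ℙ(M = l) = (1 - ν) ν ^ (l - 1)`, `l = 1, 2, …`, and is independent
of the i.i.d. sequence `U` of nonnegative random variables with distribution function
`ℙ(U ≤ u) = (1 - exp (-ρ ℙ(Ŵ ≤ u))) / ν`, `u ≥ 0`, where `Ŵ` is the forward recurrence time of the
service time. -/
structure IsBusySummands {Ω : Type*} [MeasurableSpace Ω] (P : Measure Ω) (a : ℝ) (σ : Measure ℝ)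
    (M : Ω → ℕ) (U : ℕ → Ω → ℝ) : Prop where
  measurable_M : AEMeasurable M P
  law_M : ∀ l : ℕ, P.real {ω | M ω = l + 1} = (1 - busyProb a σ) * busyProb a σ ^ l
  measurable_U : ∀ n, AEMeasurable (U n) P
  law_U : ∀ n, ∀ u : ℝ, 0 ≤ u → P.real {ω | U n ω ≤ u} =
    1 / busyProb a σ * (1 - Real.exp (-(load a σ * (forwardRecurrence σ).real (Iic u))))
  indep_U : iIndepFun U P
  indep_M : IndepFun M (fun ω n ↦ U n ω) P

end

end SNRCrossing

open SNRCrossing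

/-! The on times of the network and the busy times of the queue are random sets of times with one
common property: given that the process is off at finitely many times, the last of which is `s`, it
is off at `s + g` as well with a probability `H g` that depends on `g` only. Moreover both have the
same `H g = exp (-a ∫₀^g ℙ(W > z) dz)`, with `a = 2 r v λ` (`offProb`).

For the network, being off at finitely many times means that a union of discs contains no node. A
point covered from times `f ≤ s` and `s + g` is covered from `s` too (`disc_inter_subset`), so the
time `s + g` adds just the crescent between two discs, whose area is `2 r v ∫₀^g ℙ(W > z) dz`
(`volume_crescent`); void probabilities of a Poisson process then factor. For the queue,
conditioning on the first customer gives renewal equations, and comparing their solutions gives the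
same factorisation and the same `H` (`idleProb_insert`, `idleProb_singleton`).

The rest depends on `H` alone. Off probabilities on finite sets determine the law of a binary path
(`ext_of_off`), so the two paths, conditioned to be off at `0`, have the same law
(`startOff_unique`). The Markov property at fixed off times extends, by dyadic approximation, to the
ends of on periods (`strongMarkov`). It follows that the cycles after the first up-crossing are
i.i.d., whatever the initial state (`map_cycle_eq`, `map_cycle`), and off periods are exponential
because `H` decays at rate `a` at `0` (`startOff_lt_up_zero`).

For the on period, let `b` be its Laplace transform at `θ` and let `J = ∫₀^∞ e^{-θt} H t dt`.
Summing over the off intervals of a path that starts off gives `J = (1 / (a + θ)) / (1 - b a / (a +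
θ))`, so the tail of the on period has transform `(1 - b) / θ = (1 - θ J) / (a θ J)`. On the other
hand `H t = 1 - ν ℙ(U ≤ t)`, so `U` has transform `(1 - θ J) / ν`; the geometric sum of copies of
`U` then has the transform above divided by `ν / (a (1 - ν))`, the mean on period. Uniqueness of
Laplace transforms (`ext_of_laplace`) concludes. Stationarity holds because void probabilities are
invariant under translation. -/

namespace SNRCrossing

/-! ### On/off paths at rational times and their switching times -/

noncomputable section

/-- On/off paths observed at nonnegative rational times; `true` means on. -/
abbrev Path : Type := ℚ≥0 → Bool

/-- Two finite laws of binary families agree if all probabilities of being off on finite sets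
agree. -/
theorem ext_of_off {ι : Type*} {μ ν : Measure (ι → Bool)} [IsFiniteMeasure μ]
    (h : ∀ F : Finset ι, μ {x | ∀ i ∈ F, x i = false} = ν {x | ∀ i ∈ F, x i = false}) : μ = ν := by
  classical
  let C : Set (Set (ι → Bool)) := range fun F : Finset ι ↦ {x | ∀ i ∈ F, x i = false}
  -- Off events form a π-system, as being off on `F` and on `G` is being off on `F ∪ G`. They
  -- generate because a Boolean coordinate is on exactly on the complement of an off event.
  refine ext_of_generate_finite C ?_ ?_ ?_ (by simpa using h ∅)
  · refine le_antisymm ?_ (MeasurableSpace.generateFrom_le ?_)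
    · refine iSup_le fun i ↦ ?_
      rw [← measurable_iff_comap_le]
      refine @measurable_to_bool _ (MeasurableSpace.generateFrom C) _ ?_
      have : (fun b : ι → Bool ↦ b i) ⁻¹' {true} = {x | ∀ j ∈ ({i} : Finset ι), x j = false}ᶜ := by
        ext x; simp
      rw [this]
      exact (MeasurableSpace.measurableSet_generateFrom (mem_range_self _)).compl
    · rintro _ ⟨F, rfl⟩
      have : {x : ι → Bool | ∀ i ∈ F, x i = false} = ⋂ i ∈ F, (fun x ↦ x i) ⁻¹' {false} := by
        ext x; simp
      simp only [this]
      exact F.measurableSet_biInter fun i _ ↦ measurable_pi_apply i (measurableSet_singleton _)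
  · rintro _ ⟨F, rfl⟩ _ ⟨G, rfl⟩ -
    refine ⟨F ∪ G, ?_⟩
    ext x
    simp only [Finset.mem_union, mem_ofPred_eq, mem_inter_iff]
    grind
  · rintro _ ⟨F, rfl⟩
    exact h F

/-- The first time after `t` at which the path takes the value `b`. -/
def next (b : Bool) (x : Path) (t : ℝ) : ℝ := sInf {s | t < s ∧ ∃ q : ℚ≥0, (q : ℝ) = s ∧ x q = b}

/-- The up-crossing times of a path. -/
def up (x : Path) : ℕ → ℝ
  | 0 => next true x (next false x 0)
  | n + 1 => next true x (next false x (up x n))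

/-- The down-crossing times of a path. -/
def down (x : Path) (n : ℕ) : ℝ := next false x (up x n)

/-- The `n`-th on period and the off period that follows it. -/
def cycle (x : Path) (n : ℕ) : ℝ × ℝ := (down x n - up x n, up x (n + 1) - down x n)

/-- The path from time `s` onwards. -/
def shift (s : ℚ≥0) (x : Path) : Path := fun q ↦ x (s + q)

/-- The path stopped at time `s`. -/
def stopAt (s : ℚ≥0) (x : Path) : Path := fun q ↦ x (min q s)

theorem measurable_shift (s : ℚ≥0) : Measurable (shift s) :=
  measurable_pi_lambda _ fun _ ↦ measurable_pi_apply _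

theorem measurable_stopAt (s : ℚ≥0) : Measurable (stopAt s) :=
  measurable_pi_lambda _ fun _ ↦ measurable_pi_apply _

theorem measurableSet_path_eq (q : ℚ≥0) (b : Bool) : MeasurableSet {x : Path | x q = b} :=
  (measurable_pi_apply (X := fun _ : ℚ≥0 ↦ Bool) q) (measurableSet_singleton b)

theorem measurable_next (b : Bool) : Measurable fun z : Path × ℝ ↦ next b z.1 z.2 := by
  have hq : ∀ q : ℚ≥0, MeasurableSet {z : Path × ℝ | z.2 < q ∧ z.1 q = b} := fun q ↦
    (measurableSet_lt measurable_snd measurable_const).inter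
      (measurable_fst (measurableSet_path_eq q b))
  refine measurable_of_Iio fun c ↦ ?_
  -- If the value `b` is never taken after time `z.2`, the infimum is over the empty set and equals
  -- `0`; the second set of the union accounts for this.
  have : (fun z : Path × ℝ ↦ next b z.1 z.2) ⁻¹' Iio c =
      (⋃ q : ℚ≥0, {z : Path × ℝ | (z.2 < q ∧ z.1 q = b) ∧ (q : ℝ) < c}) ∪
        ((⋃ q : ℚ≥0, {z : Path × ℝ | z.2 < q ∧ z.1 q = b})ᶜ ∩ {_z | 0 < c}) := by
    ext z
    simp only [mem_preimage, mem_Iio, mem_union, mem_iUnion, mem_ofPred_eq, mem_inter_iff,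
      mem_compl_iff, next]
    by_cases hne : ∃ q : ℚ≥0, z.2 < q ∧ z.1 q = b
    · have hne' : {s | z.2 < s ∧ ∃ q : ℚ≥0, (q : ℝ) = s ∧ z.1 q = b}.Nonempty := by
        obtain ⟨q, h1, h2⟩ := hne
        exact ⟨q, h1, q, rfl, h2⟩
      rw [csInf_lt_iff ⟨z.2, fun s hs ↦ hs.1.le⟩ hne']
      constructor
      · rintro ⟨_, ⟨h1, q, rfl, h2⟩, h3⟩
        exact Or.inl ⟨q, ⟨h1, h2⟩, h3⟩
      · rintro (⟨q, ⟨h1, h2⟩, h3⟩ | h)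
        · exact ⟨q, ⟨h1, q, rfl, h2⟩, h3⟩
        · exact absurd hne h.1
    · have : {s | z.2 < s ∧ ∃ q : ℚ≥0, (q : ℝ) = s ∧ z.1 q = b} = ∅ := by
        ext s
        simp only [mem_ofPred_eq, mem_empty_iff_false, iff_false]
        rintro ⟨h1, q, rfl, h2⟩
        exact hne ⟨q, h1, h2⟩
      rw [this, Real.sInf_empty]
      push Not at hne
      grind
  rw [this]
  refine MeasurableSet.union ?_ (MeasurableSet.inter ?_ (MeasurableSet.const _))
  · exact MeasurableSet.iUnion fun q ↦ (hq q).inter (MeasurableSet.const _)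
  · exact (MeasurableSet.iUnion hq).compl

theorem Measurable.next {b : Bool} {f : Path → ℝ} (hf : Measurable f) :
    Measurable fun x ↦ next b x (f x) :=
  (measurable_next b).comp (measurable_id.prodMk hf)

theorem measurable_up (n : ℕ) : Measurable fun x ↦ up x n := by
  induction n with
  | zero => exact Measurable.next (Measurable.next measurable_const)
  | succ n ih => exact Measurable.next (Measurable.next ih)

theorem measurable_down (n : ℕ) : Measurable fun x ↦ down x n := Measurable.next (measurable_up n)

theorem measurable_cycle : Measurable cycle :=
  measurable_pi_lambda _ fun n ↦ ((measurable_down n).sub (measurable_up n)).prodMk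
    ((measurable_up (n + 1)).sub (measurable_down n))

theorem exists_nnrat_btwn {a b : ℝ} (ha : 0 ≤ a) (hab : a < b) : ∃ q : ℚ≥0, a < q ∧ (q : ℝ) < b := by
  obtain ⟨q, h1, h2⟩ := exists_rat_btwn hab
  have hq : 0 ≤ q := by exact_mod_cast ha.trans h1.le
  lift q to ℚ≥0 using hq
  exact ⟨q, by exact_mod_cast h1, by exact_mod_cast h2⟩

/-- Only the open intervals `(t, c)` and `(c, c')` matter; the path may take either value at `c`
itself. -/
theorem next_eq {b : Bool} {x : Path} {t c c' : ℝ} (ht : 0 ≤ t) (htc : t ≤ c) (hc : c < c')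
    (h1 : ∀ q : ℚ≥0, t < q → (q : ℝ) < c → x q ≠ b)
    (h2 : ∀ q : ℚ≥0, c < q → (q : ℝ) < c' → x q = b) : next b x t = c := by
  have hbdd : BddBelow {s | t < s ∧ ∃ q : ℚ≥0, (q : ℝ) = s ∧ x q = b} := ⟨t, fun s hs ↦ hs.1.le⟩
  refine le_antisymm (le_of_forall_gt_imp_ge_of_dense fun a ha ↦ ?_) (le_csInf ?_ ?_)
  · obtain ⟨q, hq1, hq2⟩ := exists_nnrat_btwn (ht.trans htc) (lt_min ha hc)
    refine (csInf_le hbdd ⟨htc.trans_lt hq1, q, rfl, h2 q hq1 (hq2.trans_le (min_le_right _ _))⟩).trans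
      (hq2.le.trans (min_le_left _ _))
  · obtain ⟨q, hq1, hq2⟩ := exists_nnrat_btwn (ht.trans htc) hc
    exact ⟨q, htc.trans_lt hq1, q, rfl, h2 q hq1 hq2⟩
  · rintro _ ⟨hs, q, rfl, hq⟩
    by_contra! hlt
    exact h1 q hs hlt hq

theorem next_le {b : Bool} {x : Path} {t : ℝ} {q : ℚ≥0} (hq : t < q) (hx : x q = b) :
    next b x t ≤ q :=
  csInf_le ⟨t, fun _ hs ↦ hs.1.le⟩ ⟨hq, q, rfl, hx⟩

theorem stopAt_of_le {s q : ℚ≥0} (h : q ≤ s) (x : Path) : stopAt s x q = x q := by simp [stopAt, h]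

/-- A hitting time that has occurred by time `s` is a function of the path up to `s`. This is how
past events are read off the stopped path in the strong Markov property. -/
theorem next_stopAt {b : Bool} {x : Path} {t : ℝ} {s q : ℚ≥0} (hqs : q ≤ s) (hq : t < q)
    (hx : x q = b) : next b (stopAt s x) t = next b x t := by
  have key : ∀ y z : Path, (∀ p ≤ s, y p = z p) → z q = b → next b y t ≤ next b z t := by
    intro y z hyz hz
    refine le_csInf ⟨q, hq, q, rfl, hz⟩ ?_
    rintro _ ⟨h1, p, rfl, hp⟩
    rcases le_total p q with h | h
    · exact next_le h1 ((hyz p (h.trans hqs)).trans hp)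
    · exact (next_le hq ((hyz q hqs).trans hz)).trans (by exact_mod_cast h)
  refine le_antisymm (key _ _ (fun p hp ↦ stopAt_of_le hp x) hx)
    (key _ _ (fun p hp ↦ (stopAt_of_le hp x).symm) (by rw [stopAt_of_le hqs, hx]))

/-- `σ` and `a 0 < b 0 < a 1 < b 1 < …` are the switching times of the path `x`. -/
structure Switches (x : Path) (σ : ℝ) (a b : ℕ → ℝ) : Prop where
  nonneg : 0 ≤ σ
  lt_zero : σ < a 0
  lt_down : ∀ n, a n < b n
  lt_up : ∀ n, b n < a (n + 1)
  initial_on : ∀ q : ℚ≥0, (q : ℝ) < σ → x q = true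
  initial_off : ∀ q : ℚ≥0, σ < (q : ℝ) → (q : ℝ) < a 0 → x q = false
  on : ∀ n, ∀ q : ℚ≥0, a n ≤ (q : ℝ) → (q : ℝ) < b n → x q = true
  off : ∀ n, ∀ q : ℚ≥0, b n < (q : ℝ) → (q : ℝ) < a (n + 1) → x q = false
  unbounded : ∀ N : ℕ, ∃ n, (N : ℝ) < a n

namespace Switches

variable {x : Path} {σ : ℝ} {a b : ℕ → ℝ}

theorem up_pos (h : Switches x σ a b) (n : ℕ) : 0 < a n := by
  induction n with
  | zero => exact h.nonneg.trans_lt h.lt_zero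
  | succ n ih => exact ih.trans ((h.lt_down n).trans (h.lt_up n))

theorem next_false_zero (h : Switches x σ a b) : next false x 0 = σ :=
  next_eq le_rfl h.nonneg h.lt_zero (fun q _ h2 ↦ by simp [h.initial_on q h2]) h.initial_off

theorem next_false_up (h : Switches x σ a b) (n : ℕ) : next false x (a n) = b n :=
  next_eq (h.up_pos n).le (h.lt_down n).le (h.lt_up n)
    (fun q h1 h2 ↦ by simp [h.on n q h1.le h2]) (h.off n)

theorem next_true_down (h : Switches x σ a b) (n : ℕ) : next true x (b n) = a (n + 1) :=
  next_eq ((h.up_pos n).trans (h.lt_down n)).le (h.lt_up n).le (h.lt_down (n + 1))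
    (fun q h1 h2 ↦ by simp [h.off n q h1 h2]) (fun q h1 h2 ↦ h.on (n + 1) q h1.le h2)

theorem next_true_initial (h : Switches x σ a b) : next true x σ = a 0 :=
  next_eq h.nonneg h.lt_zero.le (h.lt_down 0)
    (fun q h1 h2 ↦ by simp [h.initial_off q h1 h2]) (fun q h1 h2 ↦ h.on 0 q h1.le h2)

theorem up_eq (h : Switches x σ a b) (n : ℕ) : up x n = a n := by
  induction n with
  | zero => rw [up, h.next_false_zero, h.next_true_initial]
  | succ n ih => rw [up, ih, h.next_false_up, h.next_true_down]

theorem down_eq (h : Switches x σ a b) (n : ℕ) : down x n = b n := by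
  rw [down, h.up_eq, h.next_false_up]

end Switches

/-- A path that alternates for ever between on and off intervals, and is on at its up-crossings. -/
def Good (x : Path) : Prop := Switches x (next false x 0) (up x) (down x)

/-- Switching times are determined by the path, so any admissible choice is the canonical one. -/
theorem Switches.good {x : Path} {σ : ℝ} {a b : ℕ → ℝ} (h : Switches x σ a b) : Good x := by
  rw [Good, h.next_false_zero, funext h.up_eq, funext h.down_eq]
  exact h

/-- Countably many conditions on measurable times. Measurability allows almost sure alternation to
be transported to the law of the path. -/
theorem measurableSet_good : MeasurableSet {x | Good x} := by
  have h0 : Measurable fun x ↦ next false x 0 := Measurable.next measurable_const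
  have hc : ∀ r : ℝ, Measurable fun _ : Path ↦ r := fun r ↦ measurable_const
  have hle : ∀ (f : Path → ℝ) (g : Path → ℝ) (_ : Measurable f) (_ : Measurable g),
    Measurable fun x ↦ f x ≤ g x := fun f g hf hg ↦ measurableSet_setOfPred.1 (measurableSet_le hf hg)
  have hlt : ∀ (f : Path → ℝ) (g : Path → ℝ) (_ : Measurable f) (_ : Measurable g),
    Measurable fun x ↦ f x < g x := fun f g hf hg ↦ measurableSet_setOfPred.1 (measurableSet_lt hf hg)
  have hx : ∀ q b, Measurable fun x : Path ↦ x q = b :=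
    fun q b ↦ measurableSet_setOfPred.1 (measurableSet_path_eq q b)
  have : {x | Good x} = {x | (0 ≤ next false x 0 ∧ next false x 0 < up x 0) ∧
      (∀ n, up x n < down x n) ∧ (∀ n, down x n < up x (n + 1)) ∧
      (∀ q : ℚ≥0, (q : ℝ) < next false x 0 → x q = true) ∧
      (∀ q : ℚ≥0, next false x 0 < (q : ℝ) → (q : ℝ) < up x 0 → x q = false) ∧
      (∀ n, ∀ q : ℚ≥0, up x n ≤ (q : ℝ) → (q : ℝ) < down x n → x q = true) ∧
      (∀ n, ∀ q : ℚ≥0, down x n < (q : ℝ) → (q : ℝ) < up x (n + 1) → x q = false) ∧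
      ∀ N : ℕ, ∃ n, (N : ℝ) < up x n} := by
    ext x
    constructor
    · rintro ⟨h1, h2, h3, h4, h5, h6, h7, h8, h9⟩
      exact ⟨⟨h1, h2⟩, h3, h4, h5, h6, h7, h8, h9⟩
    · rintro ⟨⟨h1, h2⟩, h3, h4, h5, h6, h7, h8, h9⟩
      exact ⟨h1, h2, h3, h4, h5, h6, h7, h8, h9⟩
  rw [this, measurableSet_setOfPred]
  refine .and (.and (hle _ _ (hc _) h0) (hlt _ _ h0 (measurable_up 0))) <|
    .and (.forall fun n ↦ hlt _ _ (measurable_up n) (measurable_down n)) <|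
    .and (.forall fun n ↦ hlt _ _ (measurable_down n) (measurable_up (n + 1))) <|
    .and (.forall fun q ↦ .imp (hlt _ _ (hc _) h0) (hx _ _)) <|
    .and (.forall fun q ↦ .imp (hlt _ _ h0 (hc _)) <|
      .imp (hlt _ _ (hc _) (measurable_up 0)) (hx _ _)) <|
    .and (.forall fun n ↦ .forall fun q ↦ .imp (hle _ _ (measurable_up n) (hc _)) <|
      .imp (hlt _ _ (hc _) (measurable_down n)) (hx _ _)) <|
    .and (.forall fun n ↦ .forall fun q ↦ .imp (hlt _ _ (measurable_down n) (hc _)) <|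
      .imp (hlt _ _ (hc _) (measurable_up (n + 1))) (hx _ _)) <|
    .forall fun N ↦ .exists fun n ↦ hlt _ _ (hc _) (measurable_up n)

/-- Shifting a path to a time in its first off interval. -/
theorem Good.shift_initial {x : Path} (h : Good x) {s : ℚ≥0} (h1 : next false x 0 < s)
    (h2 : (s : ℝ) < up x 0) : Switches (shift s x) 0 (fun n ↦ up x n - s) fun n ↦ down x n - s where
  nonneg := le_rfl
  lt_zero := by simpa
  lt_down n := by simpa using h.lt_down n
  lt_up n := by simpa using h.lt_up n
  initial_on q hq := absurd hq (not_lt.2 q.cast_nonneg)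
  initial_off q hq hq' := h.initial_off _ (by push_cast; linarith) (by push_cast; linarith)
  on n q hq hq' := h.on n _ (by push_cast; linarith) (by push_cast; linarith)
  off n q hq hq' := h.off n _ (by push_cast; linarith) (by push_cast; linarith)
  unbounded N := by
    obtain ⟨M, hM⟩ := exists_nat_gt (N + s : ℝ)
    obtain ⟨n, hn⟩ := h.unbounded M
    exact ⟨n, by linarith⟩

/-- Shifting a path to a time in the off interval that follows the first up-crossing. -/
theorem Good.shift_succ {x : Path} (h : Good x) {s : ℚ≥0} (h1 : down x 0 < s)
    (h2 : (s : ℝ) < up x 1) :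
    Switches (shift s x) 0 (fun n ↦ up x (n + 1) - s) fun n ↦ down x (n + 1) - s where
  nonneg := le_rfl
  lt_zero := by simpa using h2
  lt_down n := by simpa using h.lt_down (n + 1)
  lt_up n := by simpa using h.lt_up (n + 1)
  initial_on q hq := absurd hq (not_lt.2 q.cast_nonneg)
  initial_off q hq hq' := h.off 0 _ (by push_cast; linarith)
    (by have : (q : ℝ) < up x 1 - s := hq'
        push_cast; linarith)
  on n q hq hq' := h.on (n + 1) _ (by push_cast; linarith) (by push_cast; linarith)
  off n q hq hq' := h.off (n + 1) _ (by push_cast; linarith) (by push_cast; linarith)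
  unbounded N := by
    obtain ⟨M, hM⟩ := exists_nat_gt (N + s : ℝ)
    obtain ⟨n, hn⟩ := h.unbounded M
    exact ⟨n, by linarith [h.lt_down n, h.lt_up n]⟩

end

end SNRCrossing

/-! ### Regenerative laws: the Markov and strong Markov properties -/

namespace SNRCrossing

noncomputable section

/-- The paths that are off on `F`. -/
def offOn (F : Finset ℚ≥0) : Set Path := {x | ∀ q ∈ F, x q = false}

theorem measurableSet_offOn (F : Finset ℚ≥0) : MeasurableSet (offOn F) := by
  have : offOn F = ⋂ q ∈ F, {x | x q = false} := by ext x; simp [offOn]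
  rw [this]
  exact F.measurableSet_biInter fun q _ ↦ measurableSet_path_eq q false

theorem offOn_union (F G : Finset ℚ≥0) : offOn (F ∪ G) = offOn F ∩ offOn G := by
  ext x; simp only [offOn, mem_ofPred_eq, mem_inter_iff, Finset.mem_union]; grind

theorem offOn_insert (F : Finset ℚ≥0) (s : ℚ≥0) :
    offOn (insert s F) = {x | x s = false} ∩ offOn F := by
  ext x; simp [offOn]

/-- A law of on/off paths that starts afresh from every time at which the path is off: `h g` is the
probability of being off a time `g` later. -/
structure Regenerative (κ : Measure Path) (h : ℚ≥0 → ENNReal) : Prop where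
  pos : κ {x | x 0 = false} ≠ 0
  step : ∀ (F : Finset ℚ≥0) (s g : ℚ≥0), (∀ f ∈ F, f ≤ s) →
    κ (offOn (insert (s + g) (insert s F))) = κ (offOn (insert s F)) * h g
  good : ∀ᵐ x ∂κ, Good x

/-- The law of the path, given that it is off at time `0`. -/
def startOff (κ : Measure Path) : Measure Path := κ[|{x | x 0 = false}]

theorem startOff_apply {κ : Measure Path} (s : Set Path) :
    startOff κ s = (κ {x | x 0 = false})⁻¹ * κ ({x | x 0 = false} ∩ s) :=
  cond_apply (measurableSet_path_eq 0 false) κ s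

theorem ae_startOff {κ : Measure Path} {p : Path → Prop} (hp : ∀ᵐ x ∂κ, p x) : ∀ᵐ x ∂startOff κ, p x :=
  (cond_absolutelyContinuous (μ := κ)).ae_le hp

theorem ae_startOff_zero {κ : Measure Path} : ∀ᵐ x ∂startOff κ, x 0 = false :=
  ae_cond_mem (measurableSet_path_eq 0 false)

variable {κ : Measure Path} {h : ℚ≥0 → ENNReal}

namespace Regenerative

theorem isProbabilityMeasure_startOff [IsProbabilityMeasure κ] (hκ : Regenerative κ h) :
    IsProbabilityMeasure (startOff κ) := cond_isProbabilityMeasure hκ.pos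

/-- The points of `s + G` are added in increasing order; each multiplies the probability by `h` of
the gap to its predecessor. The gaps, and hence the factor, do not involve `F` or `s`. -/
theorem exists_offOn_factor (hκ : Regenerative κ h) (G : Finset ℚ≥0) : ∃ c : ENNReal,
    ∀ (F : Finset ℚ≥0) (s : ℚ≥0), (∀ f ∈ F, f ≤ s) →
      κ (offOn (insert s F ∪ G.image (s + ·))) = κ (offOn (insert s F)) * c := by
  induction G using Finset.induction_on_max with
  | empty => exact ⟨1, fun F s _ ↦ by simp⟩
  | insert g G hg ih =>
    obtain ⟨c, hc⟩ := ih
    rcases G.eq_empty_or_nonempty with rfl | hG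
    · refine ⟨h g, fun F s hF ↦ ?_⟩
      rw [← hκ.step F s g hF]
      congr 2
      ext; simp; tauto
    · refine ⟨c * h (g - G.max' hG), fun F s hF ↦ ?_⟩
      have hm := G.max'_mem hG
      have h1 : insert s F ∪ (insert g G).image (s + ·) = insert (s + G.max' hG + (g - G.max' hG))
          (insert (s + G.max' hG) (insert s F ∪ G.image (s + ·))) := by
        rw [add_assoc, add_tsub_cancel_of_le (hg _ hm).le]
        ext q
        simp only [Finset.mem_union, Finset.mem_insert, Finset.mem_image]
        constructor
        · rintro (hq | ⟨a, rfl | ha, rfl⟩)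
          exacts [Or.inr (Or.inr (Or.inl hq)), Or.inl rfl, Or.inr (Or.inr (Or.inr ⟨a, ha, rfl⟩))]
        · rintro (rfl | rfl | hq | ⟨a, ha, rfl⟩)
          exacts [Or.inr ⟨g, Or.inl rfl, rfl⟩, Or.inr ⟨_, Or.inr hm, rfl⟩, Or.inl hq,
            Or.inr ⟨a, Or.inr ha, rfl⟩]
      have h2 : insert (s + G.max' hG) (insert s F ∪ G.image (s + ·)) =
          insert s F ∪ G.image (s + ·) :=
        Finset.insert_eq_self.2 (Finset.mem_union_right _ (Finset.mem_image_of_mem _ hm))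
      rw [h1, hκ.step, h2, hc F s hF, mul_assoc]
      intro f hf
      simp only [Finset.mem_union, Finset.mem_insert, Finset.mem_image] at hf
      rcases hf with (rfl | hf) | ⟨a, ha, rfl⟩
      · exact le_self_add
      · exact (hF f hf).trans le_self_add
      · gcongr
        exact G.le_max' a ha

variable [IsProbabilityMeasure κ]

/-- The universal factor is identified by the special case `F = ∅`, `s = 0`. -/
theorem offOn_factor (hκ : Regenerative κ h) (G F : Finset ℚ≥0) (s : ℚ≥0) (hF : ∀ f ∈ F, f ≤ s) :
    κ (offOn (insert s F ∪ G.image (s + ·))) = κ (offOn (insert s F)) * startOff κ (offOn G) := by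
  obtain ⟨c, hc⟩ := hκ.exists_offOn_factor G
  have h0 : offOn (insert 0 ∅) = {x | x 0 = false} := by ext; simp [offOn]
  have : startOff κ (offOn G) = c := by
    have := hc ∅ 0 (by simp)
    simp only [zero_add, Finset.image_id'] at this
    rw [startOff_apply, ← h0, ← offOn_union, this, ← mul_assoc, ENNReal.inv_mul_cancel, one_mul]
    · rw [h0]; exact hκ.pos
    · exact measure_ne_top _ _
  rw [hc F s hF, this]

/-- The Markov property at a fixed time at which the path is off. -/
theorem markov (hκ : Regenerative κ h) (s : ℚ≥0) {A E : Set Path} (hA : MeasurableSet A)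
    (hE : MeasurableSet E) : κ (stopAt s ⁻¹' A ∩ {x | x s = false} ∩ shift s ⁻¹' E) =
      κ (stopAt s ⁻¹' A ∩ {x | x s = false}) * startOff κ E := by
  have := hκ.isProbabilityMeasure_startOff
  have hs := measurableSet_path_eq s false
  have h1 : ∀ F : Finset ℚ≥0, stopAt s ⁻¹' (offOn F) ∩ {x | x s = false} =
      offOn (insert s (F.image (min · s))) := by
    intro F; ext x; simp [offOn, stopAt, and_comm]
  -- Uniqueness from off events is used twice: here the past is an off event and the future becomes
  -- arbitrary; afterwards the future is fixed and the past becomes arbitrary.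
  have h2 : ∀ F : Finset ℚ≥0, κ (stopAt s ⁻¹' (offOn F) ∩ {x | x s = false} ∩ shift s ⁻¹' E) =
      κ (stopAt s ⁻¹' (offOn F) ∩ {x | x s = false}) * startOff κ E := by
    intro F
    have key : (κ.restrict (stopAt s ⁻¹' (offOn F) ∩ {x | x s = false})).map (shift s) =
        κ (stopAt s ⁻¹' (offOn F) ∩ {x | x s = false}) • startOff κ := by
      refine ext_of_off fun G ↦ ?_
      change Measure.map _ _ (offOn G) = (_ • startOff κ : Measure Path) (offOn G)
      rw [Measure.map_apply (measurable_shift s) (measurableSet_offOn G),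
        Measure.restrict_apply (measurable_shift s (measurableSet_offOn G)), Measure.smul_apply,
        smul_eq_mul, h1]
      have := hκ.offOn_factor G (F.image (min · s)) s (by simp)
      rw [offOn_union] at this
      refine Eq.trans ?_ this
      rw [inter_comm]
      congr 2
      ext x; simp [offOn, shift]
    have := congrArg (fun μ ↦ μ E) key
    rwa [Measure.map_apply (measurable_shift s) hE,
        Measure.restrict_apply (measurable_shift s hE), Measure.smul_apply,
        smul_eq_mul, inter_comm] at this
  have key : (κ.restrict ({x | x s = false} ∩ shift s ⁻¹' E)).map (stopAt s) =
      startOff κ E • (κ.restrict {x | x s = false}).map (stopAt s) := by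
    refine ext_of_off fun F ↦ ?_
    change Measure.map _ _ (offOn F) = (_ • Measure.map _ _ : Measure Path) (offOn F)
    rw [Measure.smul_apply, Measure.map_apply (measurable_stopAt s) (measurableSet_offOn F),
      Measure.map_apply (measurable_stopAt s) (measurableSet_offOn F),
      Measure.restrict_apply (measurable_stopAt s (measurableSet_offOn F)),
      Measure.restrict_apply (measurable_stopAt s (measurableSet_offOn F)), ← inter_assoc, h2,
      smul_eq_mul, mul_comm]
  have := congrArg (fun μ ↦ μ A) key
  rwa [Measure.smul_apply, Measure.map_apply (measurable_stopAt s) hA,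
    Measure.map_apply (measurable_stopAt s) hA, Measure.restrict_apply (measurable_stopAt s hA),
    Measure.restrict_apply (measurable_stopAt s hA), ← inter_assoc, smul_eq_mul, mul_comm] at this

/-- The strong Markov property at a random time `τ` that is followed by an off interval that lasts
until time `u`. The sets `B s d` describe a past event `A` together with `s - d ≤ τ < s < u` in terms
of the path up to time `s`. -/
theorem strongMarkov (hκ : Regenerative κ h) {τ u : Path → ℝ} {V : Path → ℕ → ℝ × ℝ}
    (hτ : Measurable τ) (hu : Measurable u) (hV : Measurable V) {A : Set Path}
    (hAm : MeasurableSet A) (h0 : ∀ᵐ x ∂κ, 0 ≤ τ x ∧ τ x < u x) {B : ℚ≥0 → ℚ≥0 → Set Path}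
    (hBm : ∀ s d, MeasurableSet (B s d))
    (hB : ∀ s d x, x s = false → (stopAt s x ∈ B s d ↔ x ∈ B s d))
    (hA : ∀ᵐ x ∂κ, ∀ s d : ℚ≥0, x s = false ∧ x ∈ B s d ↔
      x ∈ A ∧ (s : ℝ) - d ≤ τ x ∧ τ x < s ∧ (s : ℝ) < u x)
    (hshift : ∀ᵐ x ∂κ, ∀ s : ℚ≥0, τ x < s → (s : ℝ) < u x →
      up (shift s x) 0 = u x - s ∧ cycle (shift s x) = V x)
    {y : ℝ} (hy : 0 ≤ y) {Z : Set (ℕ → ℝ × ℝ)} (hZ : MeasurableSet Z) :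
    κ {x | x ∈ A ∧ y < u x - τ x ∧ V x ∈ Z} =
      κ A * startOff κ {x | y < up x 0 ∧ cycle x ∈ Z} := by
  -- The first point of the grid of mesh `2⁻ᵐ` strictly after `τ`. Strictness matters: the path need
  -- not be off at `τ` itself, but it is off at `σ m` once the mesh is fine.
  let σ : ℕ → Path → ℝ := fun m x ↦ (⌊τ x * 2 ^ m⌋₊ + 1) / 2 ^ m
  have hσm : ∀ m, Measurable (σ m) := fun m ↦ by
    have : Measurable fun x ↦ ⌊τ x * 2 ^ m⌋₊ := Nat.measurable_floor.comp (hτ.mul_const _)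
    exact ((measurable_from_nat (f := fun n : ℕ ↦ (n : ℝ))).comp this |>.add_const 1).div_const _
  let D : ℝ → Set (ℕ → ℝ × ℝ) → ℕ → Set Path := fun y Z m ↦ {x | x ∈ A ∧ σ m x + y < u x ∧ V x ∈ Z}
  have hDm : ∀ y Z m, MeasurableSet Z → MeasurableSet (D y Z m) := fun y Z m hZ ↦
    hAm.inter ((measurableSet_lt ((hσm m).add_const y) hu).inter (hV hZ))
  have hσ : ∀ x, 0 ≤ τ x → ∀ m, τ x < σ m x ∧ σ m x ≤ τ x + (1 / 2) ^ m := by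
    intro x hx m
    have h2 : (0 : ℝ) < 2 ^ m := by positivity
    constructor
    · rw [lt_div_iff₀ h2]; exact Nat.lt_floor_add_one _
    · rw [div_le_iff₀ h2, add_mul, one_div, inv_pow, inv_mul_cancel₀ h2.ne']
      gcongr
      exact Nat.floor_le (by positivity)
  have hlim : ∀ y Z, MeasurableSet Z → Tendsto (fun m ↦ κ (D y Z m)) atTop
      (𝓝 (κ {x | x ∈ A ∧ y < u x - τ x ∧ V x ∈ Z})) := by
    intro y Z hZ
    refine tendsto_measure_of_ae_tendsto_indicator_of_isFiniteMeasure _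
      (hAm.inter ((measurableSet_lt measurable_const (hu.sub hτ)).inter (hV hZ)))
      (fun m ↦ hDm y Z m hZ) ?_
    filter_upwards [h0] with x hx
    have hlim : Tendsto (fun m ↦ σ m x) atTop (𝓝 (τ x)) := by
      refine tendsto_of_tendsto_of_tendsto_of_le_of_le tendsto_const_nhds
        (g := fun _ ↦ τ x) (h := fun m ↦ τ x + (1 / 2) ^ m) ?_ (fun m ↦ (hσ x hx.1 m).1.le)
        (fun m ↦ (hσ x hx.1 m).2)
      simpa using (tendsto_pow_atTop_nhds_zero_of_lt_one (r := (1 / 2 : ℝ)) (by norm_num)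
        (by norm_num)).const_add (τ x)
    by_cases hlt : y < u x - τ x
    · filter_upwards [hlim.eventually_lt_const (show τ x < u x - y by linarith)] with m hm
      simp only [D, mem_ofPred_eq, hlt, show σ m x + y < u x by linarith]
    · filter_upwards with m
      have := (hσ x hx.1 m).1
      simp only [D, mem_ofPred_eq, hlt, show ¬ σ m x + y < u x by intro h; apply hlt; linarith]
  -- On each level set of the floor, `σ m` is a fixed time, where the ordinary Markov property
  -- applies. The remaining off time and the later cycles are those of the shifted path, so the
  -- factor from the past does not depend on `y` and `Z`.
  have hfib : ∀ y Z m, 0 ≤ y → MeasurableSet Z → κ (D y Z m) =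
      κ (D 0 univ m) * startOff κ {x | y < up x 0 ∧ cycle x ∈ Z} := by
    intro y Z m hy hZ
    have hEm : MeasurableSet {x | y < up x 0 ∧ cycle x ∈ Z} :=
      (measurableSet_lt measurable_const (measurable_up 0)).inter (measurable_cycle hZ)
    let f : Path → ℕ := fun x ↦ ⌊τ x * 2 ^ m⌋₊
    have hf : Measurable f := Nat.measurable_floor.comp (hτ.mul_const _)
    have hsum : ∀ D : Set Path, MeasurableSet D → κ D = ∑' j, κ (D ∩ f ⁻¹' {j}) := by
      intro D hD
      rw [← measure_iUnion]
      · congr 1; ext x; simp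
      · intro i j hij
        exact Disjoint.mono inter_subset_right inter_subset_right
          ((disjoint_singleton.2 hij).preimage f)
      · exact fun j ↦ hD.inter (hf (measurableSet_singleton j))
    have hj : ∀ y Z, 0 ≤ y → MeasurableSet Z → ∀ j : ℕ, κ (D y Z m ∩ f ⁻¹' {j}) =
        κ (stopAt ((j + 1) / 2 ^ m) ⁻¹' (B ((j + 1) / 2 ^ m) (1 / 2 ^ m)) ∩
          {x | x ((j + 1) / 2 ^ m) = false}) * startOff κ {x | y < up x 0 ∧ cycle x ∈ Z} := by
      intro y Z hy hZ j
      have hEm : MeasurableSet {x | y < up x 0 ∧ cycle x ∈ Z} :=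
        (measurableSet_lt measurable_const (measurable_up 0)).inter (measurable_cycle hZ)
      rw [← hκ.markov _ (hBm _ _) hEm]
      refine measure_congr ?_
      filter_upwards [h0, hA, hshift] with x hx hA hs
      have hc : (((j + 1) / 2 ^ m : ℚ≥0) : ℝ) = (j + 1) / 2 ^ m := by push_cast; ring
      have hd : ((1 / 2 ^ m : ℚ≥0) : ℝ) = 1 / 2 ^ m := by push_cast; ring
      specialize hA ((j + 1) / 2 ^ m) (1 / 2 ^ m)
      specialize hs ((j + 1) / 2 ^ m)
      specialize hB ((j + 1) / 2 ^ m) (1 / 2 ^ m) x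
      rw [hc, hd] at hA
      rw [hc] at hs
      have h2 : (0 : ℝ) < 2 ^ m := by positivity
      have hfl : f x = j ↔ ((j + 1) / 2 ^ m - 1 / 2 ^ m : ℝ) ≤ τ x ∧ τ x < (j + 1) / 2 ^ m := by
        rw [← sub_div, add_sub_cancel_right, Nat.floor_eq_iff (mul_nonneg hx.1 h2.le), div_le_iff₀ h2,
          lt_div_iff₀ h2]
      refine eq_iff_iff.2 ?_
      change (x ∈ D y Z m ∧ f x = j) ↔
        ((stopAt _ x ∈ B _ _ ∧ x _ = false) ∧ (y < up (shift _ x) 0 ∧ cycle (shift _ x) ∈ Z))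
      constructor
      · rintro ⟨⟨h1, h2, h3⟩, h4⟩
        have hσ : σ m x = (j + 1) / 2 ^ m := by rw [← h4]
        rw [hσ] at h2
        obtain ⟨h5, h6⟩ := hfl.1 h4
        obtain ⟨h7, h8⟩ := hs h6 (by linarith)
        obtain ⟨h9, h10⟩ := hA.2 ⟨h1, h5, h6, by linarith⟩
        refine ⟨⟨(hB h9).2 h10, h9⟩, ?_, ?_⟩
        · rw [h7]; linarith
        · rwa [h8]
      · rintro ⟨⟨h1, h2⟩, h3, h4⟩
        obtain ⟨h5, h6, h7, h8⟩ := hA.1 ⟨h2, (hB h2).1 h1⟩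
        have hfx := hfl.2 ⟨h6, h7⟩
        have hσ : σ m x = (j + 1) / 2 ^ m := by rw [← hfx]
        obtain ⟨h9, h10⟩ := hs h7 h8
        refine ⟨⟨h5, ?_, by rwa [← h10]⟩, hfx⟩
        rw [hσ]
        linarith
    rw [hsum _ (hDm y Z m hZ), hsum _ (hDm 0 univ m .univ), ← ENNReal.tsum_mul_right]
    refine tsum_congr fun j ↦ ?_
    rw [hj y Z hy hZ, hj 0 univ le_rfl .univ, mul_assoc]
    congr 1
    -- For `y = 0` and `Z = univ` the future has probability `1`, which identifies the factor from
    -- the past.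
    have h1 : startOff κ {x | 0 < up x 0 ∧ cycle x ∈ (univ : Set (ℕ → ℝ × ℝ))} = 1 := by
      have := hκ.isProbabilityMeasure_startOff
      exact (mem_ae_iff_prob_eq_one ((measurableSet_lt measurable_const (measurable_up 0)).inter
        (measurable_cycle .univ))).1 <| ae_startOff <| hκ.good.mono fun x hx ↦
          ⟨hx.up_pos 0, mem_univ _⟩
    rw [h1, one_mul]
  have h1 := hlim y Z hZ
  have h2 := hlim 0 univ .univ
  have h3 : κ {x | x ∈ A ∧ 0 < u x - τ x ∧ V x ∈ univ} = κ A := by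
    refine measure_congr ?_
    filter_upwards [h0] with x hx
    refine eq_iff_iff.2 ⟨fun h ↦ h.1, fun h ↦ ⟨h, by linarith, mem_univ _⟩⟩
  rw [h3] at h2
  simp only [fun m ↦ hfib y Z m hy hZ] at h1
  have := hκ.isProbabilityMeasure_startOff
  exact tendsto_nhds_unique h1 (ENNReal.Tendsto.mul_const h2 (Or.inr (measure_ne_top _ _)))

end Regenerative

end

end SNRCrossing

/-! ### Uniqueness of the law and independence of successive periods -/

namespace SNRCrossing

noncomputable section

namespace Regenerative

variable {κ : Measure Path} {h : ℚ≥0 → ENNReal}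

/-- The induction step for uniqueness: iterated, it expresses off probabilities through `h` at the
gaps, up to the probability of being off at `0`. -/
theorem offOn_insert_max (hκ : Regenerative κ h) (G : Finset ℚ≥0) (g : ℚ≥0) (hg : ∀ f ∈ G, f < g) :
    κ (offOn (insert 0 (insert g G))) = κ (offOn (insert 0 G)) *
      h (g - (insert 0 G).max' (Finset.insert_nonempty 0 G)) := by
  set m := (insert 0 G).max' (Finset.insert_nonempty 0 G) with hm
  have hmem : m ∈ insert 0 G := Finset.max'_mem _ _
  have hmg : m ≤ g := by
    rcases Finset.mem_insert.1 hmem with h | h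
    · rw [h]; exact zero_le
    · exact (hg m h).le
  have := hκ.step (insert 0 G) m (g - m) (fun f hf ↦ Finset.le_max' _ f hf)
  rwa [add_tsub_cancel_of_le hmg, Finset.insert_eq_self.2 hmem, Finset.insert_comm] at this

theorem ae_startOff_next (hκ : Regenerative κ h) :
    ∀ᵐ x ∂startOff κ, Good x ∧ next false x 0 = 0 := by
  filter_upwards [ae_startOff hκ.good, ae_startOff_zero (κ := κ)] with x hx h0
  refine ⟨hx, le_antisymm (not_lt.1 fun hlt ↦ ?_) hx.nonneg⟩
  have := hx.initial_on 0 (by simpa using hlt)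
  rw [h0] at this
  exact absurd this (by simp)

variable [IsProbabilityMeasure κ]

theorem startOff_regenerative (hκ : Regenerative κ h) : Regenerative (startOff κ) h where
  pos := by
    have := hκ.isProbabilityMeasure_startOff
    rw [(mem_ae_iff_prob_eq_one (measurableSet_path_eq 0 false)).1 ae_startOff_zero]
    exact one_ne_zero
  step F s g hF := by
    have := hκ.step (insert 0 F) s g (by simpa using hF)
    rw [startOff_apply, startOff_apply, ← offOn_insert, ← offOn_insert, mul_assoc]
    rw [Finset.insert_comm 0, Finset.insert_comm 0, this]
  good := ae_startOff hκ.good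

theorem startOff_startOff (hκ : Regenerative κ h) : startOff (startOff κ) = startOff κ := by
  have := hκ.isProbabilityMeasure_startOff
  ext s -
  have h1 := (mem_ae_iff_prob_eq_one (measurableSet_path_eq 0 false)).1 (ae_startOff_zero (κ := κ))
  rw [startOff_apply (κ := startOff κ), h1, inv_one, one_mul]
  refine measure_congr ?_
  filter_upwards [ae_startOff_zero (κ := κ)] with x hx
  exact eq_iff_iff.2 ⟨fun h ↦ h.2, fun h ↦ ⟨hx, h⟩⟩

/-- The law of a regenerative path that starts off is determined by its off probabilities. -/
theorem startOff_unique {κ' : Measure Path} [IsProbabilityMeasure κ'] (hκ : Regenerative κ h)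
    (hκ' : Regenerative κ' h) : startOff κ = startOff κ' := by
  have h1 := hκ.isProbabilityMeasure_startOff
  have h2 := hκ'.isProbabilityMeasure_startOff
  have hzero : ∀ (κ : Measure Path) G, startOff κ (offOn (insert 0 G)) = startOff κ (offOn G) := by
    intro κ G
    refine measure_congr ?_
    filter_upwards [ae_startOff_zero (κ := κ)] with x hx
    rw [offOn_insert]
    exact eq_iff_iff.2 ⟨fun h ↦ h.2, fun h ↦ ⟨hx, h⟩⟩
  refine ext_of_off fun G ↦ ?_
  change startOff κ (offOn G) = startOff κ' (offOn G)
  rw [← hzero κ, ← hzero κ']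
  induction G using Finset.induction_on_max with
  | empty =>
    rw [hzero, hzero]
    have : offOn ∅ = univ := by ext; simp [offOn]
    rw [this, measure_univ, measure_univ]
  | insert g G hg ih =>
    rw [hκ.startOff_regenerative.offOn_insert_max G g hg,
      hκ'.startOff_regenerative.offOn_insert_max G g hg, ih]

/-- Cycles are differences of switching times, so they do not see a change of origin within the
first off interval. -/
theorem cycle_shift_initial {x : Path} (hx : Good x) {s : ℚ≥0} (h1 : next false x 0 < s)
    (h2 : (s : ℝ) < up x 0) : up (shift s x) 0 = up x 0 - s ∧ cycle (shift s x) = cycle x := by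
  have := hx.shift_initial h1 h2
  refine ⟨this.up_eq 0, ?_⟩
  funext n
  simp only [cycle, this.up_eq, this.down_eq]
  ext <;> simp

theorem cycle_shift_succ {x : Path} (hx : Good x) {s : ℚ≥0} (h1 : down x 0 < s)
    (h2 : (s : ℝ) < up x 1) :
    up (shift s x) 0 = up x 1 - s ∧ cycle (shift s x) = fun n ↦ cycle x (n + 1) := by
  have := hx.shift_succ h1 h2
  refine ⟨this.up_eq 0, ?_⟩
  funext n
  simp only [cycle, this.up_eq, this.down_eq]
  ext <;> simp

theorem measurableSet_off_between {f : Path → ℝ} (hf : Measurable f) (s : ℚ≥0) :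
    MeasurableSet {x : Path | ∀ q : ℚ≥0, f x < q → q ≤ s → x q = false} := by
  have : {x : Path | ∀ q : ℚ≥0, f x < q → q ≤ s → x q = false} =
      ⋂ q : ℚ≥0, {x | f x < q}ᶜ ∪ ({_x | q ≤ s}ᶜ ∪ {x | x q = false}) := by
    ext x; simp only [mem_ofPred_eq, mem_iInter, mem_union, mem_compl_iff]; grind
  rw [this]
  exact .iInter fun q ↦ (measurableSet_lt hf measurable_const).compl.union
    ((MeasurableSet.const _).compl.union (measurableSet_path_eq q false))

/-- The cycles of a regenerative path have the same law whether or not the path starts off. -/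
theorem map_cycle_eq (hκ : Regenerative κ h) : κ.map cycle = (startOff κ).map cycle := by
  have h0 : Measurable fun x ↦ next false x 0 := Measurable.next measurable_const
  ext Z hZ
  rw [Measure.map_apply measurable_cycle hZ, Measure.map_apply measurable_cycle hZ]
  have key := hκ.strongMarkov (τ := fun x ↦ next false x 0) (u := fun x ↦ up x 0) (V := cycle)
    (A := univ) h0 (measurable_up 0) measurable_cycle .univ
    (hκ.good.mono fun x hx ↦ ⟨hx.nonneg, hx.lt_zero⟩)
    -- The event `s < up x 0` looks into the future. It is replaced by the condition that the path
    -- has been off since the end of the initial on interval.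
    (B := fun s d ↦ {x | ((s : ℝ) - d ≤ next false x 0 ∧ next false x 0 < s) ∧
      ∀ q : ℚ≥0, next false x 0 < q → q ≤ s → x q = false})
    (fun s d ↦ ((measurableSet_le measurable_const h0).inter
      (measurableSet_lt h0 measurable_const)).inter (measurableSet_off_between h0 s))
    ?_ ?_ (hκ.good.mono fun x hx s ↦ cycle_shift_initial hx) le_rfl hZ
  · have hκ' := hκ.isProbabilityMeasure_startOff
    rw [measure_univ, one_mul] at key
    refine Eq.trans (measure_congr ?_) (key.trans (measure_congr ?_))
    · filter_upwards [hκ.good] with x hx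
      exact eq_iff_iff.2 ⟨fun h ↦ ⟨mem_univ _, sub_pos.2 hx.lt_zero, h⟩, fun h ↦ h.2.2⟩
    · filter_upwards [ae_startOff hκ.good] with x hx
      exact eq_iff_iff.2 ⟨fun h ↦ h.2, fun h ↦ ⟨hx.up_pos 0, h⟩⟩
  · intro s d x hs
    -- `next_stopAt` needs a time after `0`. At `s = 0` both events are empty, since `next false`
    -- from time `0` is never negative.
    rcases eq_or_lt_of_le (zero_le (a := s)) with rfl | hpos
    · have hn : ∀ z : Path, ¬ next false z 0 < ((0 : ℚ≥0) : ℝ) := fun z hz ↦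
        absurd (show 0 ≤ next false z 0 from Real.sInf_nonneg (by rintro r ⟨hr, -⟩; exact hr.le))
          (not_le.2 (by simpa using hz))
      exact ⟨fun h ↦ absurd h.1.2 (hn _), fun h ↦ absurd h.1.2 (hn _)⟩
    · have : next false (stopAt s x) 0 = next false x 0 :=
        next_stopAt le_rfl (by exact_mod_cast hpos) hs
      simp only [mem_ofPred_eq, this]
      refine and_congr_right fun _ ↦ forall_congr' fun q ↦ imp_congr_right fun _ ↦
        imp_congr_right fun hq ↦ ?_
      rw [stopAt_of_le hq]
  · filter_upwards [hκ.good] with x hx s d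
    simp only [mem_univ, true_and]
    constructor
    · rintro ⟨hs, ⟨h1, h2⟩, h3⟩
      refine ⟨h1, h2, not_le.1 fun hle ↦ ?_⟩
      rcases hle.eq_or_lt with heq | hlt
      · have := hx.on 0 s heq.le (heq ▸ hx.lt_down 0)
        simp [hs] at this
      · obtain ⟨q, hq1, hq2⟩ := exists_nnrat_btwn (hx.up_pos 0).le (lt_min hlt (hx.lt_down 0))
        have := hx.on 0 q hq1.le (hq2.trans_le (min_le_right _ _))
        rw [h3 q (hx.lt_zero.trans hq1) (by exact_mod_cast (hq2.trans_le (min_le_left _ _)).le)]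
          at this
        exact absurd this (by simp)
    · rintro ⟨h1, h2, h3⟩
      exact ⟨hx.initial_off s h2 h3, ⟨h1, h2⟩, fun q hq hqs ↦
        hx.initial_off q hq (lt_of_le_of_lt (by exact_mod_cast hqs) h3)⟩

/-- The first on period is independent of what follows, and what follows starts afresh. -/
theorem measure_cycle_zero (hκ : Regenerative κ h) {C : Set ℝ} (hC : MeasurableSet C) {y : ℝ}
    (hy : 0 ≤ y) {Z : Set (ℕ → ℝ × ℝ)} (hZ : MeasurableSet Z) :
    startOff κ {x | (cycle x 0).1 ∈ C ∧ y < (cycle x 0).2 ∧ (fun n ↦ cycle x (n + 1)) ∈ Z} =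
      startOff κ {x | (cycle x 0).1 ∈ C} * startOff κ {x | y < up x 0 ∧ cycle x ∈ Z} := by
  have hP := hκ.isProbabilityMeasure_startOff
  have hκ' := hκ.startOff_regenerative
  -- For a path that starts off, the first up-crossing is simply the first on time after `0`. In
  -- this form it is a function of the stopped path as soon as that path has been on.
  let u : Path → ℝ := fun x ↦ next true x 0
  let w : Path → ℝ := fun x ↦ next false x (u x)
  have hu : Measurable u := Measurable.next measurable_const
  have hw : Measurable w := Measurable.next hu
  have huw : ∀ x, Good x → next false x 0 = 0 → u x = up x 0 ∧ w x = down x 0 := by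
    intro x hx h0
    have : u x = up x 0 := by simp only [u, up, h0]
    exact ⟨this, by simp only [w, this, down]⟩
  have key := hκ'.strongMarkov (τ := fun x ↦ down x 0) (u := fun x ↦ up x 1)
    (V := fun x n ↦ cycle x (n + 1)) (A := {x | (cycle x 0).1 ∈ C}) (measurable_down 0)
    (measurable_up 1)
    (measurable_pi_lambda _ fun n ↦ (measurable_pi_apply (n + 1)).comp measurable_cycle)
    (((measurable_pi_apply 0).comp measurable_cycle).fst hC)
    (hκ'.good.mono fun x hx ↦ ⟨((hx.up_pos 0).trans (hx.lt_down 0)).le, hx.lt_up 0⟩)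
    -- The first clause says that the path has been on by time `s`. Otherwise, if it is off at `s`,
    -- the stopped path is never on after `0`, and its `u` is the default value `0`.
    (B := fun s d ↦ {x | (∃ q : ℚ≥0, q ≤ s ∧ 0 < q ∧ x q = true) ∧ w x - u x ∈ C ∧
      ((s : ℝ) - d ≤ w x ∧ w x < s) ∧ ∀ q : ℚ≥0, w x < q → q ≤ s → x q = false})
    ?_ ?_ ?_ (hκ'.good.mono fun x hx s ↦ cycle_shift_succ hx) hy hZ
  · rw [hκ.startOff_startOff] at key
    exact key
  · intro s d
    have : MeasurableSet {x : Path | ∃ q : ℚ≥0, q ≤ s ∧ 0 < q ∧ x q = true} := by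
      have : {x : Path | ∃ q : ℚ≥0, q ≤ s ∧ 0 < q ∧ x q = true} =
          ⋃ q : ℚ≥0, {_x | q ≤ s} ∩ ({_x | 0 < q} ∩ {x | x q = true}) := by
        ext x; simp
      rw [this]
      exact .iUnion fun q ↦ (MeasurableSet.const _).inter
        ((MeasurableSet.const _).inter (measurableSet_path_eq q true))
    exact MeasurableSet.inter this (((hw.sub hu) hC).inter
      (((measurableSet_le measurable_const hw).inter (measurableSet_lt hw measurable_const)).inter
        (measurableSet_off_between hw s)))
  · intro s d x hs
    have h1 : (∃ q : ℚ≥0, q ≤ s ∧ 0 < q ∧ stopAt s x q = true) ↔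
        ∃ q : ℚ≥0, q ≤ s ∧ 0 < q ∧ x q = true :=
      exists_congr fun q ↦ and_congr_right fun hq ↦ by rw [stopAt_of_le hq]
    simp only [mem_ofPred_eq, h1]
    refine and_congr_right ?_
    rintro ⟨q, hqs, hq0, hq⟩
    have hu' : u (stopAt s x) = u x := next_stopAt hqs (by exact_mod_cast hq0) hq
    have hus : u x < s := by
      refine lt_of_le_of_lt (next_le (by exact_mod_cast hq0) hq) ?_
      have : q ≠ s := by
        rintro rfl
        simp [hs] at hq
      exact_mod_cast lt_of_le_of_ne hqs this
    have hw' : w (stopAt s x) = w x := by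
      simp only [w, hu']
      exact next_stopAt le_rfl hus hs
    rw [hu', hw']
    refine and_congr_right fun _ ↦ and_congr_right fun _ ↦ forall_congr' fun q ↦
      imp_congr_right fun _ ↦ imp_congr_right fun hq ↦ ?_
    rw [stopAt_of_le hq]
  · filter_upwards [hκ.ae_startOff_next] with x ⟨hx, h0⟩ s d
    obtain ⟨hu', hw'⟩ := huw x hx h0
    simp only [hu', hw']
    constructor
    · rintro ⟨hs, -, h1, ⟨h2, h3⟩, h4⟩
      refine ⟨h1, h2, h3, not_le.1 fun hle ↦ ?_⟩
      rcases hle.eq_or_lt with heq | hlt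
      · have := hx.on 1 s heq.le (heq ▸ hx.lt_down 1)
        simp [hs] at this
      · obtain ⟨q, hq1, hq2⟩ := exists_nnrat_btwn (hx.up_pos 1).le (lt_min hlt (hx.lt_down 1))
        have := hx.on 1 q hq1.le (hq2.trans_le (min_le_right _ _))
        rw [h4 q ((hx.lt_up 0).trans hq1) (by exact_mod_cast (hq2.trans_le (min_le_left _ _)).le)]
          at this
        exact absurd this (by simp)
    · rintro ⟨h1, h2, h3, h4⟩
      obtain ⟨q, hq1, hq2⟩ := exists_nnrat_btwn (hx.up_pos 0).le (hx.lt_down 0)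
      exact ⟨hx.off 0 s h3 h4, ⟨q, by exact_mod_cast (hq2.trans h3).le,
        by exact_mod_cast (hx.up_pos 0).trans hq1, hx.on 0 q hq1.le hq2⟩, h1, ⟨h2, h3⟩,
        fun q hq hqs ↦ hx.off 0 q hq (lt_of_le_of_lt (by exact_mod_cast hqs) h4)⟩

/-- A path that starts off is independent of its first off interval after it. -/
theorem measure_lt_up_zero_inter (hκ : Regenerative κ h) (s : ℚ≥0) {Z : Set (ℕ → ℝ × ℝ)}
    (hZ : MeasurableSet Z) : startOff κ {x | (s : ℝ) < up x 0 ∧ cycle x ∈ Z} =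
      startOff κ {x | (s : ℝ) < up x 0} * startOff κ {x | cycle x ∈ Z} := by
  have hP := hκ.isProbabilityMeasure_startOff
  have hκ' := hκ.startOff_regenerative
  rcases eq_or_lt_of_le (zero_le (a := s)) with rfl | hpos
  · have h1 : ∀ᵐ x ∂startOff κ, ((0 : ℚ≥0) : ℝ) < up x 0 :=
      hκ'.good.mono fun x hx ↦ by simpa using hx.up_pos 0
    rw [(mem_ae_iff_prob_eq_one (measurableSet_lt measurable_const (measurable_up 0))).1 h1, one_mul]
    refine measure_congr ?_
    filter_upwards [h1] with x hx
    exact eq_iff_iff.2 ⟨fun h ↦ h.2, fun h ↦ ⟨hx, h⟩⟩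
  -- The bound `-1` lies below all times, so that time `0` is included.
  · have hA : MeasurableSet {x : Path | ∀ q : ℚ≥0, (-1 : ℝ) < q → q ≤ s → x q = false} :=
      measurableSet_off_between measurable_const s
    have key := hκ'.markov s hA (measurable_cycle hZ)
    rw [hκ.startOff_startOff] at key
    have hiff : ∀ x, Good x → next false x 0 = 0 → x 0 = false →
        ((stopAt s x ∈ {x : Path | ∀ q : ℚ≥0, (-1 : ℝ) < q → q ≤ s → x q = false} ∧ x s = false) ↔
          (s : ℝ) < up x 0) := by
      intro x hx h0 hx0
      constructor
      · rintro ⟨h1, h2⟩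
        refine not_le.1 fun hle ↦ ?_
        rcases hle.eq_or_lt with heq | hlt
        · have := hx.on 0 s heq.le (heq ▸ hx.lt_down 0)
          simp [h2] at this
        · obtain ⟨q, hq1, hq2⟩ := exists_nnrat_btwn (hx.up_pos 0).le (lt_min hlt (hx.lt_down 0))
          have hqs : q ≤ s := by exact_mod_cast (hq2.trans_le (min_le_left _ _)).le
          have := hx.on 0 q hq1.le (hq2.trans_le (min_le_right _ _))
          rw [← stopAt_of_le hqs x, h1 q (by linarith [q.cast_nonneg (α := ℝ)]) hqs] at this
          exact absurd this (by simp)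
      · intro hlt
        have : ∀ q ≤ s, x q = false := by
          intro q hq
          rcases eq_or_lt_of_le (zero_le (a := q)) with rfl | hq0
          · exact hx0
          · exact hx.initial_off q (by rw [h0]; exact_mod_cast hq0)
              (lt_of_le_of_lt (by exact_mod_cast hq) hlt)
        exact ⟨fun q _ hq ↦ by rw [stopAt_of_le hq]; exact this q hq, this s le_rfl⟩
    refine Eq.trans (measure_congr ?_) (key.trans ?_)
    · filter_upwards [hκ.ae_startOff_next, ae_startOff_zero (κ := κ)] with x ⟨hx, h0⟩ hx0
      refine eq_iff_iff.2 ?_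
      change (s : ℝ) < up x 0 ∧ cycle x ∈ Z ↔ (stopAt s x ∈
        {x : Path | ∀ q : ℚ≥0, (-1 : ℝ) < q → q ≤ s → x q = false} ∧ x s = false) ∧
          cycle (shift s x) ∈ Z
      rw [hiff x hx h0 hx0]
      refine and_congr_right fun hlt ↦ ?_
      rw [(cycle_shift_initial hx (by rw [h0]; exact_mod_cast hpos) hlt).2]
    · congr 1
      refine measure_congr ?_
      filter_upwards [hκ.ae_startOff_next, ae_startOff_zero (κ := κ)] with x ⟨hx, h0⟩ hx0
      exact eq_iff_iff.2 (hiff x hx h0 hx0)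

end Regenerative

end

end SNRCrossing

/-! ### Product laws, exponential off periods and i.i.d. cycles -/

namespace SNRCrossing

noncomputable section

/-- A cylinder over any finite set of indices is one over an initial segment, with full factors at
the missing indices. -/
theorem eq_infinitePi_of_range {α : Type*} [MeasurableSpace α] {ν : Measure α}
    [IsProbabilityMeasure ν] {μ : Measure (ℕ → α)}
    (h : ∀ (n : ℕ) (t : ℕ → Set α), (∀ i, MeasurableSet (t i)) →
      μ {z | ∀ i < n, z i ∈ t i} = ∏ i ∈ Finset.range n, ν (t i)) :
    μ = Measure.infinitePi fun _ ↦ ν := by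
  refine Measure.eq_infinitePi _ fun s t ht ↦ ?_
  classical
  obtain ⟨n, hn⟩ : ∃ n, ∀ i ∈ s, i < n := ⟨s.sup id + 1, fun i hi ↦
    Nat.lt_succ_of_le (Finset.le_sup (f := id) hi)⟩
  have := h n (fun i ↦ if i ∈ s then t i else univ) fun i ↦ by
    split_ifs; exacts [ht i, .univ]
  have hs : s = (Finset.range n).filter (· ∈ s) := by
    ext i; simp only [Finset.mem_filter, Finset.mem_range]; exact ⟨fun h ↦ ⟨hn i h, h⟩, fun h ↦ h.2⟩
  calc μ (Set.pi s t) = μ {z | ∀ i < n, z i ∈ if i ∈ s then t i else univ} := by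
        congr 1
        ext z
        simp only [Set.mem_pi, Finset.mem_coe, mem_ofPred_eq]
        constructor
        · intro h i _; split_ifs with hi; exacts [h i hi, mem_univ _]
        · intro h i hi; simpa [hi] using h i (hn i hi)
    _ = ∏ i ∈ Finset.range n, if i ∈ s then ν (t i) else 1 := by
        rw [this]
        refine Finset.prod_congr rfl fun i _ ↦ ?_
        split_ifs <;> simp
    _ = ∏ i ∈ s, ν (t i) := by
        rw [← Finset.prod_filter, ← hs]

theorem measurableSet_forall_lt_mem {α : Type*} [MeasurableSpace α] (n : ℕ) {t : ℕ → Set α}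
    (ht : ∀ i, MeasurableSet (t i)) : MeasurableSet {z : ℕ → α | ∀ i < n, z i ∈ t i} := by
  have : {z : ℕ → α | ∀ i < n, z i ∈ t i} =
      ⋂ i ∈ Finset.range n, (fun z ↦ z i) ⁻¹' t i := by ext; simp
  rw [this]
  exact Finset.measurableSet_biInter _ fun i _ ↦ measurable_pi_apply i (ht _)

theorem forall_lt_succ_mem_iff {α : Type*} (n : ℕ) (t : ℕ → Set α) (z : ℕ → α) :
    (∀ i < n + 1, z i ∈ t i) ↔ z 0 ∈ t 0 ∧ ∀ i < n, z (i + 1) ∈ t (i + 1) := by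
  constructor
  · exact fun hz ↦ ⟨hz 0 n.succ_pos, fun i hi ↦ hz (i + 1) (by omega)⟩
  · rintro ⟨h0, hz⟩ (_ | i) hi
    exacts [h0, hz i (by omega)]

/-- A law on sequences is a product law if the first term is independent of the remaining terms,
which have the same law as the whole sequence. -/
theorem eq_infinitePi_of_cons {α : Type*} [MeasurableSpace α] {ν : Measure α}
    [IsProbabilityMeasure ν] {μ : Measure (ℕ → α)} [IsProbabilityMeasure μ]
    (h : ∀ s Z, MeasurableSet s → MeasurableSet Z →
      μ {z | z 0 ∈ s ∧ (fun n ↦ z (n + 1)) ∈ Z} = ν s * μ Z) :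
    μ = Measure.infinitePi fun _ ↦ ν := by
  refine eq_infinitePi_of_range fun n ↦ ?_
  induction n with
  | zero => intro t _; simp
  | succ n ih =>
    intro t ht
    rw [Finset.prod_range_succ', ← ih _ fun i ↦ ht (i + 1), mul_comm,
      ← h _ _ (ht 0) (measurableSet_forall_lt_mem n fun i ↦ ht (i + 1))]
    congr 1
    ext z
    exact forall_lt_succ_mem_iff n t z

/-- Splitting off the first term of an i.i.d. sequence. -/
theorem map_cons_infinitePi {α : Type*} [MeasurableSpace α] (ν : Measure α)
    [IsProbabilityMeasure ν] :
    (Measure.infinitePi fun _ : ℕ ↦ ν).map (fun z ↦ (z 0, fun n ↦ z (n + 1))) =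
      ν.prod (Measure.infinitePi fun _ ↦ ν) := by
  let cons : α × (ℕ → α) → ℕ → α := fun y n ↦ Nat.casesOn n y.1 y.2
  have hcons : Measurable cons := measurable_pi_lambda _ fun n ↦ by
    cases n
    · exact measurable_fst
    · exact (measurable_pi_apply _).comp measurable_snd
  have hsplit : Measurable fun z : ℕ → α ↦ (z 0, fun n ↦ z (n + 1)) :=
    (measurable_pi_apply 0).prodMk (measurable_pi_lambda _ fun n ↦ measurable_pi_apply (n + 1))
  have key : (ν.prod (Measure.infinitePi fun _ ↦ ν)).map cons = Measure.infinitePi fun _ ↦ ν := by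
    refine eq_infinitePi_of_range fun n t ht ↦ ?_
    rw [Measure.map_apply hcons (measurableSet_forall_lt_mem n ht)]
    cases n with
    | zero => simp
    | succ n =>
      have h1 : cons ⁻¹' {z | ∀ i < n + 1, z i ∈ t i} =
          t 0 ×ˢ Set.pi (Finset.range n : Set ℕ) fun i ↦ t (i + 1) := by
        ext y
        simp only [mem_preimage, mem_ofPred_eq, forall_lt_succ_mem_iff, Set.mem_prod, Set.mem_pi,
          Finset.mem_coe, Finset.mem_range]
        rfl
      rw [h1, Measure.prod_prod, Measure.infinitePi_pi _ fun i _ ↦ ht (i + 1),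
        Finset.prod_range_succ', mul_comm]
  conv_lhs => rw [← key]
  rw [Measure.map_map hsplit hcons]
  exact Measure.map_id

theorem ext_of_Ioi_nnrat {μ ν : Measure ℝ} [IsFiniteMeasure μ] (hμ : μ (Iic 0) = 0)
    (hν : ν (Iic 0) = 0) (h : ∀ q : ℚ≥0, μ (Ioi (q : ℝ)) = ν (Ioi (q : ℝ))) : μ = ν := by
  have huniv : ∀ {μ : Measure ℝ}, μ (Iic 0) = 0 → ∀ s, Ioi 0 ⊆ s → μ s = μ (Ioi 0) := by
    intro μ hμ s hs
    refine le_antisymm ?_ (measure_mono hs)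
    calc μ s ≤ μ (Iic 0 ∪ Ioi 0) := measure_mono (by rw [Iic_union_Ioi]; exact subset_univ _)
      _ ≤ _ := (measure_union_le _ _).trans (by rw [hμ, zero_add])
  have h0 : μ (Ioi 0) = ν (Ioi 0) := by simpa using h 0
  refine ext_of_generate_finite _ (by rw [← Real.borel_eq_generateFrom_Ioi_rat]; exact BorelSpace.measurable_eq)
    Real.isPiSystem_Ioi_rat ?_ ?_
  · intro s hs
    simp only [mem_iUnion, mem_singleton_iff] at hs
    obtain ⟨q, rfl⟩ := hs
    rcases le_or_gt 0 q with hq | hq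
    · lift q to ℚ≥0 using hq
      simpa using h q
    · have : Ioi (0 : ℝ) ⊆ Ioi (q : ℝ) := Ioi_subset_Ioi (by exact_mod_cast hq.le)
      rw [huniv hμ _ this, huniv hν _ this, h0]
  · rw [huniv hμ _ (subset_univ _), huniv hν _ (subset_univ _), h0]

theorem expMeasure_Ioi {a : ℝ} (ha : 0 < a) {s : ℝ} (hs : 0 ≤ s) :
    expMeasure a (Ioi s) = ENNReal.ofReal (Real.exp (-(a * s))) := by
  have := isProbabilityMeasure_expMeasure ha
  have h1 := cdf_expMeasure_eq ha s
  rw [if_pos hs, cdf_eq_real] at h1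
  rw [← ofReal_measureReal, ← compl_Iic, probReal_compl_eq_one_sub measurableSet_Iic, h1]
  congr 1; ring

theorem expMeasure_Iic_zero {a : ℝ} (ha : 0 < a) : expMeasure a (Iic 0) = 0 := by
  have := isProbabilityMeasure_expMeasure ha
  have h1 := cdf_expMeasure_eq ha 0
  rw [if_pos le_rfl, cdf_eq_real] at h1
  rw [← ofReal_measureReal, h1]
  simp

/-- The function `h` of off probabilities decays at rate `a` at time `0`. -/
def HasRate (h : ℚ≥0 → ENNReal) (a : ℝ) : Prop :=
  0 < a ∧ ∀ s : ℚ≥0, Tendsto (fun m : ℕ ↦ h (s / 2 ^ m) ^ 2 ^ m) atTop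
    (𝓝 (ENNReal.ofReal (Real.exp (-(a * s)))))

namespace Regenerative

variable {κ : Measure Path} [IsProbabilityMeasure κ] {h : ℚ≥0 → ENNReal}

/-- Each further grid point costs one factor `h d`, by regeneration at its predecessor. -/
theorem startOff_grid (hκ : Regenerative κ h) (d : ℚ≥0) (N : ℕ) :
    startOff κ {x | ∀ j : ℕ, j ≤ N → x (j * d) = false} = h d ^ N := by
  have hP := hκ.isProbabilityMeasure_startOff
  have heq : ∀ N, offOn ((Finset.range (N + 1)).image fun j : ℕ ↦ j * d) =
      {x | ∀ j : ℕ, j ≤ N → x (j * d) = false} := fun N ↦ by ext; simp [offOn]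
  induction N with
  | zero =>
    simp only [nonpos_iff_eq_zero, forall_eq, Nat.cast_zero, zero_mul, pow_zero]
    exact (mem_ae_iff_prob_eq_one (measurableSet_path_eq 0 false)).1 ae_startOff_zero
  | succ N ih =>
    have h1 := hκ.startOff_regenerative.step ((Finset.range (N + 1)).image fun j : ℕ ↦ j * d)
      (N * d) d (by
        simp only [Finset.mem_image, Finset.mem_range]
        rintro _ ⟨j, hj, rfl⟩
        gcongr
        omega)
    have h2 : (N : ℚ≥0) * d ∈ (Finset.range (N + 1)).image fun j : ℕ ↦ j * d :=
      Finset.mem_image.2 ⟨N, Finset.self_mem_range_succ N, rfl⟩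
    rw [Finset.insert_eq_self.2 h2, heq, ih] at h1
    rw [← heq, Finset.range_add_one, Finset.image_insert, pow_succ, ← h1]
    push_cast
    rw [add_mul, one_mul]

/-- Being off up to time `s` is the decreasing limit of being off on the dyadic grids of `[0, s]`,
whose probabilities are `h (s / 2 ^ m) ^ 2 ^ m`. No on interval escapes all grids, as it has
positive length. -/
theorem startOff_lt_up_zero (hκ : Regenerative κ h) {a : ℝ} (hexp : HasRate h a) (s : ℚ≥0) :
    startOff κ {x | (s : ℝ) < up x 0} = ENNReal.ofReal (Real.exp (-(a * s))) := by
  have hP := hκ.isProbabilityMeasure_startOff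
  let G : ℕ → Set Path := fun m ↦ {x | ∀ j : ℕ, j ≤ 2 ^ m → x (j * (s / 2 ^ m)) = false}
  have hGm : ∀ m, MeasurableSet (G m) := fun m ↦ by
    have : G m = ⋂ j ∈ Finset.range (2 ^ m + 1), {x | x ((j : ℚ≥0) * (s / 2 ^ m)) = false} := by
      ext; simp [G]
    rw [this]
    exact Finset.measurableSet_biInter _ fun j _ ↦ measurableSet_path_eq _ _
  have hanti : Antitone G := by
    refine antitone_nat_of_succ_le fun m x hx j hj ↦ ?_
    have := hx (2 * j) (by rw [pow_succ]; omega)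
    rw [← this]
    congr 1
    push_cast
    rw [pow_succ]
    field_simp
  have hlim := tendsto_measure_iInter_atTop (μ := startOff κ) (fun m ↦ (hGm m).nullMeasurableSet)
    hanti ⟨0, measure_ne_top _ _⟩
  have h1 : (startOff κ) ∘ G = fun m : ℕ ↦ h (s / 2 ^ m) ^ 2 ^ m := by
    funext m
    exact hκ.startOff_grid (s / 2 ^ m) (2 ^ m)
  rw [h1] at hlim
  rw [← tendsto_nhds_unique hlim (hexp.2 s)]
  refine measure_congr ?_
  filter_upwards [hκ.ae_startOff_next, ae_startOff_zero (κ := κ)] with x ⟨hx, h0⟩ hx0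
  refine eq_iff_iff.2 ?_
  change (s : ℝ) < up x 0 ↔ x ∈ ⋂ m, G m
  rw [mem_iInter]
  constructor
  · intro hlt m j hj
    rcases eq_or_lt_of_le (zero_le (a := (j * (s / 2 ^ m) : ℚ≥0))) with h | hpos
    · rw [← h]; exact hx0
    · refine hx.initial_off _ (by rw [h0]; exact_mod_cast hpos) (lt_of_le_of_lt ?_ hlt)
      have : (j * (s / 2 ^ m) : ℚ≥0) ≤ s := by
        rw [← mul_div_assoc, div_le_iff₀ (by positivity), mul_comm]
        gcongr
        exact_mod_cast hj
      exact_mod_cast this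
  · intro hG
    refine not_le.1 fun hle ↦ ?_
    have hu := hx.up_pos 0
    have hs : (0 : ℝ) < s := hu.trans_le hle
    rcases hle.eq_or_lt with heq | hlt
    · have := hx.on 0 s heq.le (heq ▸ hx.lt_down 0)
      rw [show x s = false by simpa using hG 0 1 (by simp)] at this
      exact absurd this (by simp)
    -- The path is on throughout `[up x 0, b)`. Once the mesh is smaller than its length, the first
    -- grid point `j` after `up x 0` falls into it.
    · set b := min (s : ℝ) (down x 0) with hb
      have hub : up x 0 < b := lt_min hlt (hx.lt_down 0)
      obtain ⟨m, hm⟩ := pow_unbounded_of_one_lt (s / (b - up x 0)) (one_lt_two)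
      have h2 : (0 : ℝ) < 2 ^ m := by positivity
      have hd : (s : ℝ) / 2 ^ m < b - up x 0 := by
        rw [div_lt_iff₀ (by linarith)] at hm
        rw [div_lt_iff₀ h2]; linarith
      have hdpos : (0 : ℝ) < s / 2 ^ m := by positivity
      set j := ⌊up x 0 / (s / 2 ^ m)⌋₊ + 1 with hj
      have hj1 : up x 0 < j * (s / 2 ^ m) := by
        rw [← div_lt_iff₀ hdpos, hj]
        push_cast
        exact Nat.lt_floor_add_one _
      have hj2 : j * (s / 2 ^ m) < b := by
        have := Nat.floor_le (div_nonneg hu.le hdpos.le)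
        rw [le_div_iff₀ hdpos] at this
        rw [hj]
        push_cast
        linarith
      have hjm : j ≤ 2 ^ m := by
        have : (j : ℝ) * (s / 2 ^ m) < s := hj2.trans_le (min_le_left _ _)
        rw [← mul_div_assoc, div_lt_iff₀ h2, mul_comm, mul_lt_mul_iff_right₀ hs] at this
        exact_mod_cast this.le
      have h3 := hG m j hjm
      have h4 := hx.on 0 (j * (s / 2 ^ m)) (by push_cast; exact hj1.le)
        (by push_cast; exact hj2.trans_le (min_le_right _ _))
      rw [h3] at h4
      exact absurd h4 (by simp)

/-- For fixed `Z` the left side is a finite measure in `E`, and half-lines with rational endpoints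
determine it. There, being off until `q` is an event at which the path starts afresh with the same
cycles. -/
theorem startOff_up_zero_mem_inter (hκ : Regenerative κ h) {a : ℝ} (hexp : HasRate h a) {E : Set ℝ} (hE : MeasurableSet E)
    {Z : Set (ℕ → ℝ × ℝ)} (hZ : MeasurableSet Z) : startOff κ {x | up x 0 ∈ E ∧ cycle x ∈ Z} =
      expMeasure a E * startOff κ {x | cycle x ∈ Z} := by
  have hP := hκ.isProbabilityMeasure_startOff
  have := isProbabilityMeasure_expMeasure hexp.1
  have hZ' : MeasurableSet {x | cycle x ∈ Z} := measurable_cycle hZ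
  have hap : ∀ E, MeasurableSet E → ((startOff κ).restrict {x | cycle x ∈ Z}).map (fun x ↦ up x 0) E
      = startOff κ {x | up x 0 ∈ E ∧ cycle x ∈ Z} := by
    intro E hE
    rw [Measure.map_apply (measurable_up 0) hE, Measure.restrict_apply (measurable_up 0 hE)]
    rfl
  have key : ((startOff κ).restrict {x | cycle x ∈ Z}).map (fun x ↦ up x 0) =
      startOff κ {x | cycle x ∈ Z} • expMeasure a := by
    refine ext_of_Ioi_nnrat ?_ ?_ fun q ↦ ?_
    · rw [hap _ measurableSet_Iic]
      refine measure_mono_null (fun x hx ↦ hx.1) (t := {x | up x 0 ∈ Iic 0}) ?_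
      have := ae_startOff hκ.good
      rw [ae_iff] at this
      exact measure_mono_null (fun x hx (hg : Good x) ↦ (hg.up_pos 0).not_ge hx) this
    · rw [Measure.smul_apply, expMeasure_Iic_zero hexp.1, smul_zero]
    · rw [hap _ measurableSet_Ioi, Measure.smul_apply, smul_eq_mul,
        expMeasure_Ioi hexp.1 q.cast_nonneg, ← hκ.startOff_lt_up_zero hexp q, mul_comm]
      exact hκ.measure_lt_up_zero_inter q hZ
  rw [← hap E hE, key, Measure.smul_apply, smul_eq_mul, mul_comm]

/-- After the first on period the path starts afresh in the off state: the off period that follows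
behaves like the initial off interval, and the later cycles like all cycles. -/
theorem startOff_cycle_zero_mem_inter (hκ : Regenerative κ h) {a : ℝ} (hexp : HasRate h a) {C E : Set ℝ} (hC : MeasurableSet C)
    (hE : MeasurableSet E) {Z : Set (ℕ → ℝ × ℝ)} (hZ : MeasurableSet Z) :
    startOff κ {x | (cycle x 0).1 ∈ C ∧ (cycle x 0).2 ∈ E ∧ (fun n ↦ cycle x (n + 1)) ∈ Z} =
      startOff κ {x | (cycle x 0).1 ∈ C} * expMeasure a E * startOff κ {x | cycle x ∈ Z} := by
  have hP := hκ.isProbabilityMeasure_startOff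
  have := isProbabilityMeasure_expMeasure hexp.1
  have hc : Measurable fun x ↦ cycle x 0 := (measurable_pi_apply 0).comp measurable_cycle
  have hs : Measurable fun x n ↦ cycle x (n + 1) :=
    measurable_pi_lambda _ fun n ↦ (measurable_pi_apply (n + 1)).comp measurable_cycle
  let D : Set Path := {x | (cycle x 0).1 ∈ C ∧ (fun n ↦ cycle x (n + 1)) ∈ Z}
  have hD : MeasurableSet D := (hc.fst hC).inter (hs hZ)
  have hap : ∀ E, MeasurableSet E → ((startOff κ).restrict D).map (fun x ↦ (cycle x 0).2) E =
      startOff κ {x | (cycle x 0).1 ∈ C ∧ (cycle x 0).2 ∈ E ∧ (fun n ↦ cycle x (n + 1)) ∈ Z} := by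
    intro E hE
    rw [Measure.map_apply hc.snd hE, Measure.restrict_apply (hc.snd hE)]
    congr 1
    ext x
    exact and_left_comm
  have key : ((startOff κ).restrict D).map (fun x ↦ (cycle x 0).2) =
      (startOff κ {x | (cycle x 0).1 ∈ C} * startOff κ {x | cycle x ∈ Z}) • expMeasure a := by
    refine ext_of_Ioi_nnrat ?_ ?_ fun q ↦ ?_
    · rw [hap _ measurableSet_Iic]
      refine measure_mono_null (fun x hx ↦ hx.2.1) (t := {x | (cycle x 0).2 ∈ Iic 0}) ?_
      have := ae_startOff hκ.good
      rw [ae_iff] at this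
      exact measure_mono_null (fun x hx (hg : Good x) ↦ (sub_pos.2 (hg.lt_up 0)).not_ge hx) this
    · rw [Measure.smul_apply, expMeasure_Iic_zero hexp.1, smul_zero]
    · rw [hap _ measurableSet_Ioi]
      refine (hκ.measure_cycle_zero hC q.cast_nonneg hZ).trans ?_
      have := hκ.startOff_up_zero_mem_inter hexp (measurableSet_Ioi (a := (q : ℝ))) hZ
      simp only [mem_Ioi] at this
      rw [this, Measure.smul_apply, smul_eq_mul]
      ring
  rw [← hap E hE, key, Measure.smul_apply, smul_eq_mul]
  ring

/-- The cycles of a regenerative path are i.i.d., with independent on and off periods, and the off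
periods are exponential. -/
theorem map_cycle (hκ : Regenerative κ h) {a : ℝ} (hexp : HasRate h a) : κ.map cycle = Measure.infinitePi fun _ ↦
      ((startOff κ).map fun x ↦ (cycle x 0).1).prod (expMeasure a) := by
  have hP := hκ.isProbabilityMeasure_startOff
  have := isProbabilityMeasure_expMeasure hexp.1
  have hc : Measurable fun x ↦ cycle x 0 := (measurable_pi_apply 0).comp measurable_cycle
  have hs : Measurable fun (z : ℕ → ℝ × ℝ) n ↦ z (n + 1) :=
    measurable_pi_lambda _ fun n ↦ measurable_pi_apply (n + 1)
  have hs' : Measurable fun x n ↦ cycle x (n + 1) := hs.comp measurable_cycle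
  have : IsProbabilityMeasure ((startOff κ).map fun x ↦ (cycle x 0).1) :=
    Measure.isProbabilityMeasure_map hc.fst.aemeasurable
  have : IsProbabilityMeasure ((startOff κ).map cycle) :=
    Measure.isProbabilityMeasure_map measurable_cycle.aemeasurable
  rw [hκ.map_cycle_eq]
  refine eq_infinitePi_of_cons fun s Z hsm hZ ↦ ?_
  have key : ((startOff κ).restrict {x | (fun n ↦ cycle x (n + 1)) ∈ Z}).map (fun x ↦ cycle x 0) =
      startOff κ {x | cycle x ∈ Z} •
        ((startOff κ).map fun x ↦ (cycle x 0).1).prod (expMeasure a) := by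
    refine Measure.ext_prod fun {C E} hC hE ↦ ?_
    rw [Measure.map_apply hc (hC.prod hE), Measure.restrict_apply (hc (hC.prod hE)),
      Measure.smul_apply, Measure.prod_prod, Measure.map_apply hc.fst hC, smul_eq_mul]
    refine Eq.trans ?_ ((hκ.startOff_cycle_zero_mem_inter hexp hC hE hZ).trans (mul_comm _ _))
    congr 1
    ext x
    exact and_assoc
  have hms : MeasurableSet {z : ℕ → ℝ × ℝ | z 0 ∈ s ∧ (fun n ↦ z (n + 1)) ∈ Z} :=
    (measurable_pi_apply 0 hsm).inter (hs hZ)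
  rw [Measure.map_apply measurable_cycle hms, Measure.map_apply measurable_cycle hZ]
  have := congrArg (fun μ ↦ μ s) key
  rw [Measure.map_apply hc hsm, Measure.restrict_apply (hc hsm), Measure.smul_apply, smul_eq_mul,
    mul_comm] at this
  exact this

end Regenerative

end

end SNRCrossing

/-! ### Laplace transforms of measures on the line -/

namespace SNRCrossing

noncomputable section

/-- The kernel of the Laplace transform. -/
def laplaceKernel (θ x : ℝ) : ENNReal := ENNReal.ofReal (Real.exp (-(θ * x)))

theorem measurable_laplaceKernel (θ : ℝ) : Measurable (laplaceKernel θ) := by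
  unfold laplaceKernel; fun_prop

theorem laplaceKernel_add (θ x y : ℝ) :
    laplaceKernel θ (x + y) = laplaceKernel θ x * laplaceKernel θ y := by
  rw [laplaceKernel, laplaceKernel, laplaceKernel, ← ENNReal.ofReal_mul (Real.exp_pos _).le,
    ← Real.exp_add]
  congr 2; ring

theorem lintegral_laplaceKernel_Ico {θ : ℝ} (hθ : 0 < θ) {a b : ℝ} (hab : a ≤ b) :
    ∫⁻ t in Ico a b, laplaceKernel θ t =
      ENNReal.ofReal ((Real.exp (-(θ * a)) - Real.exp (-(θ * b))) / θ) := by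
  unfold laplaceKernel
  rw [← ofReal_integral_eq_lintegral_ofReal, integral_Ico_eq_integral_Ioc,
    ← intervalIntegral.integral_of_le hab]
  · congr 1
    have : ∀ t ∈ uIcc a b, HasDerivAt (fun t ↦ -Real.exp (-(θ * t)) / θ) (Real.exp (-(θ * t))) t := by
      intro t _
      have := (((hasDerivAt_id t).const_mul θ).neg.exp.neg).div_const θ
      simp only [id] at this
      rw [mul_one, mul_neg, neg_neg, mul_div_cancel_right₀ _ hθ.ne'] at this
      exact this
    rw [intervalIntegral.integral_eq_sub_of_hasDerivAt this
      (by apply Continuous.intervalIntegrable; fun_prop)]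
    ring
  · exact (Continuous.integrableOn_Icc (by fun_prop)).mono_set Ico_subset_Icc_self
  · exact ae_of_all _ fun t ↦ (Real.exp_pos _).le

theorem lintegral_laplaceKernel_Ici {θ : ℝ} (hθ : 0 < θ) :
    ∫⁻ t in Ici 0, laplaceKernel θ t = ENNReal.ofReal (1 / θ) := by
  unfold laplaceKernel
  rw [← ofReal_integral_eq_lintegral_ofReal, integral_Ici_eq_integral_Ioi]
  · congr 1
    have := integral_exp_mul_Ioi (neg_lt_zero.2 hθ) 0
    simp only [neg_mul] at this
    rw [this]
    simp
  · rw [← IntegrableOn, integrableOn_Ici_iff_integrableOn_Ioi]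
    simpa using integrableOn_exp_mul_Ioi (neg_lt_zero.2 hθ) 0
  · exact ae_of_all _ fun t ↦ (Real.exp_pos _).le

/-- The additive form avoids the truncated subtraction of `ENNReal`. -/
theorem laplaceKernel_add_lintegral_Ico {θ : ℝ} (hθ : 0 < θ) {l : ℝ} (hl : 0 ≤ l) :
    ENNReal.ofReal θ * (∫⁻ t in Ico 0 l, laplaceKernel θ t) + laplaceKernel θ l = 1 := by
  have h1 : Real.exp (-(θ * l)) ≤ 1 := Real.exp_le_one_iff.2 (by nlinarith)
  rw [lintegral_laplaceKernel_Ico hθ hl, laplaceKernel, ← ENNReal.ofReal_mul hθ.le,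
    ← ENNReal.ofReal_add, ← ENNReal.ofReal_one]
  · congr 1
    rw [mul_div_cancel₀ _ hθ.ne']
    simp
  · rw [mul_div_cancel₀ _ hθ.ne']
    simpa using h1
  · exact (Real.exp_pos _).le

/-- Tonelli on the region `0 ≤ t < l`. -/
theorem lintegral_Ico_laplaceKernel_eq (μ : Measure ℝ) [SFinite μ] (θ : ℝ) :
    ∫⁻ l, (∫⁻ t in Ico 0 l, laplaceKernel θ t) ∂μ =
      ∫⁻ t in Ici 0, laplaceKernel θ t * μ (Ioi t) := by
  have h1 : ∀ l : ℝ, ∫⁻ t in Ico 0 l, laplaceKernel θ t =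
      ∫⁻ t in Ici 0, (Ioi t).indicator (fun _ ↦ laplaceKernel θ t) l := by
    intro l
    rw [← Ici_inter_Iio, inter_comm, ← Measure.restrict_restrict measurableSet_Iio,
      ← lintegral_indicator measurableSet_Iio]
    rfl
  simp only [h1]
  rw [lintegral_lintegral_swap]
  · refine lintegral_congr fun t ↦ ?_
    rw [lintegral_indicator measurableSet_Ioi, lintegral_const, Measure.restrict_apply .univ,
      univ_inter]
  · refine Measurable.aemeasurable ?_
    have : MeasurableSet {z : ℝ × ℝ | z.2 < z.1} := measurableSet_lt measurable_snd measurable_fst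
    exact ((measurable_laplaceKernel θ).comp measurable_snd).indicator this

/-- The Laplace transform in terms of the tail. -/
theorem laplace_tail (μ : Measure ℝ) [IsProbabilityMeasure μ] (hμ : μ (Iio 0) = 0) {θ : ℝ}
    (hθ : 0 < θ) : ENNReal.ofReal θ * (∫⁻ t in Ici 0, laplaceKernel θ t * μ (Ioi t)) +
      ∫⁻ y, laplaceKernel θ y ∂μ = 1 := by
  have h0 : ∀ᵐ y ∂μ, 0 ≤ y := by
    rw [ae_iff]; simpa [Iio_def] using hμ
  rw [← lintegral_Ico_laplaceKernel_eq, ← lintegral_const_mul' _ _ ENNReal.ofReal_ne_top,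
    ← lintegral_add_right _ (measurable_laplaceKernel θ)]
  rw [lintegral_congr_ae (h0.mono fun y hy ↦ laplaceKernel_add_lintegral_Ico hθ hy)]
  simp

theorem lintegral_laplaceKernel_expMeasure {a θ : ℝ} (ha : 0 < a) (hθ : 0 < θ) :
    ∫⁻ y, laplaceKernel θ y ∂expMeasure a = ENNReal.ofReal (a / (a + θ)) := by
  have h1 : expMeasure a = volume.withDensity (exponentialPDF a) := rfl
  rw [h1, lintegral_withDensity_eq_lintegral_mul₀
    (by exact (measurable_exponentialPDFReal a).ennreal_ofReal.aemeasurable)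
    (measurable_laplaceKernel θ).aemeasurable]
  have h2 : ∀ y, (exponentialPDF a * laplaceKernel θ) y =
      ENNReal.ofReal (a / (a + θ)) * exponentialPDF (a + θ) y := by
    intro y
    rw [Pi.mul_apply]
    rcases lt_or_ge y 0 with hy | hy
    · rw [exponentialPDF_of_neg hy, exponentialPDF_of_neg hy]; simp
    · rw [exponentialPDF_of_nonneg hy, exponentialPDF_of_nonneg hy, laplaceKernel,
        ← ENNReal.ofReal_mul (by positivity), ← ENNReal.ofReal_mul (by positivity), mul_assoc,
        ← Real.exp_add]
      congr 1
      rw [← mul_assoc, div_mul_cancel₀ _ (by positivity)]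
      congr 2; ring
  simp only [h2]
  rw [lintegral_const_mul' _ _ ENNReal.ofReal_ne_top, lintegral_exponentialPDF_eq_one (by positivity),
    mul_one]

theorem integrable_exp_of_laplace {μ : Measure ℝ} {θ : ℝ}
    (h : ∫⁻ y, laplaceKernel θ y ∂μ ≠ ⊤) : Integrable (fun y ↦ Real.exp (-(θ * y))) μ := by
  refine ⟨by fun_prop, ?_⟩
  rw [hasFiniteIntegral_iff_ofReal (ae_of_all _ fun y ↦ (Real.exp_pos _).le)]
  exact h.lt_top

/-- Measures on the line are determined by their Laplace transform on `(0, ∞)`, provided that it is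
finite. -/
theorem ext_of_laplace {μ ν : Measure ℝ}
    (hfin : ∀ θ : ℝ, 0 < θ → ∫⁻ y, laplaceKernel θ y ∂μ ≠ ⊤)
    (h : ∀ θ : ℝ, 0 < θ → ∫⁻ y, laplaceKernel θ y ∂μ = ∫⁻ y, laplaceKernel θ y ∂ν) : μ = ν := by
  have hfin' : ∀ θ : ℝ, 0 < θ → ∫⁻ y, laplaceKernel θ y ∂ν ≠ ⊤ := fun θ hθ ↦ h θ hθ ▸ hfin θ hθ
  -- The tilt by `e^{-y}` makes the measures finite and turns the transform at `1 - t` into the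
  -- moment generating function at `t`, which is then finite for all `t < 1`, a neighbourhood of
  -- `0`.
  let T : Measure ℝ → Measure ℝ := fun μ ↦ μ.withDensity (laplaceKernel 1)
  have hinv : ∀ μ : Measure ℝ, (T μ).withDensity (fun y ↦ (laplaceKernel 1 y)⁻¹) = μ := by
    intro μ
    exact withDensity_inv_same (measurable_laplaceKernel 1)
      (ae_of_all _ fun y ↦ (ENNReal.ofReal_pos.2 (Real.exp_pos _)).ne')
      (ae_of_all _ fun y ↦ ENNReal.ofReal_ne_top)
  have hint : ∀ μ : Measure ℝ, (∀ θ : ℝ, 0 < θ → ∫⁻ y, laplaceKernel θ y ∂μ ≠ ⊤) →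
      ∀ t < (1 : ℝ), Integrable (fun y ↦ Real.exp (t * y)) (T μ) := by
    intro μ hμ t ht
    have hlap : ∫⁻ y, laplaceKernel (-t) y ∂T μ = ∫⁻ y, laplaceKernel (1 - t) y ∂μ := by
      rw [lintegral_withDensity_eq_lintegral_mul _ (measurable_laplaceKernel 1)
        (measurable_laplaceKernel _)]
      refine lintegral_congr fun y ↦ ?_
      rw [Pi.mul_apply, laplaceKernel, laplaceKernel, laplaceKernel,
        ← ENNReal.ofReal_mul (Real.exp_pos _).le, ← Real.exp_add]
      congr 2; ring
    have := integrable_exp_of_laplace (hlap ▸ hμ (1 - t) (by linarith))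
    simpa only [neg_mul, neg_neg] using this
  have hmgf : ∀ μ : Measure ℝ, ∀ t < (1 : ℝ), mgf id (T μ) t =
      (∫⁻ y, laplaceKernel (1 - t) y ∂μ).toReal := by
    intro μ t ht
    rw [mgf, integral_eq_lintegral_of_nonneg_ae (ae_of_all _ fun y ↦ (Real.exp_pos _).le)
      (by fun_prop), lintegral_withDensity_eq_lintegral_mul _ (measurable_laplaceKernel 1)
        (by fun_prop)]
    congr 1
    refine lintegral_congr fun y ↦ ?_
    rw [Pi.mul_apply, laplaceKernel, laplaceKernel,
      ← ENNReal.ofReal_mul (Real.exp_pos _).le, ← Real.exp_add]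
    simp only [id]
    congr 2; ring
  have hfm : ∀ μ : Measure ℝ, (∀ θ : ℝ, 0 < θ → ∫⁻ y, laplaceKernel θ y ∂μ ≠ ⊤) →
      IsFiniteMeasure (T μ) := by
    intro μ hμ
    refine ⟨?_⟩
    rw [withDensity_apply _ .univ, setLIntegral_univ]
    exact (hμ 1 one_pos).lt_top
  have := hfm μ hfin
  have := hfm ν hfin'
  have hsub : ∀ μ : Measure ℝ, (∀ θ : ℝ, 0 < θ → ∫⁻ y, laplaceKernel θ y ∂μ ≠ ⊤) →
      {z : ℂ | z.re < 1} ⊆ {z | z.re ∈ interior (integrableExpSet id (T μ))} := by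
    intro μ hμ z hz
    exact interior_mono (s := Iio 1) (fun t ht ↦ hint μ hμ t ht) (by rw [isOpen_Iio.interior_eq]; exact hz)
  have heq : EqOn (complexMGF id (T μ)) (complexMGF id (T ν)) {z : ℂ | z.re < 1} := by
    refine (analyticOnNhd_complexMGF.mono (hsub μ hfin)).eqOn_of_preconnected_of_frequently_eq
      (analyticOnNhd_complexMGF.mono (hsub ν hfin')) (convex_halfSpace_re_lt 1).isPreconnected
      (z₀ := 0) (by simp) ?_
    -- Real points that accumulate inside the half-plane of analyticity, as the identity theorem
    -- requires. The half-plane contains the imaginary axis, which carries the characteristic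
    -- function.
    have hlim : Tendsto (fun n : ℕ ↦ ((-(1 / ((n : ℝ) + 1)) : ℝ) : ℂ)) atTop (𝓝[≠] 0) := by
      refine tendsto_nhdsWithin_iff.2 ⟨?_, Eventually.of_forall fun n ↦ ?_⟩
      · have := (tendsto_one_div_add_atTop_nhds_zero_nat (𝕜 := ℝ)).neg
        rw [neg_zero] at this
        exact (Complex.continuous_ofReal.tendsto 0).comp this
      · rw [mem_compl_iff, mem_singleton_iff, Complex.ofReal_eq_zero, neg_eq_zero]
        exact (Nat.one_div_pos_of_nat).ne'
    refine hlim.frequently (Frequently.of_forall fun n ↦ ?_)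
    have hlt : -(1 / ((n : ℝ) + 1)) < 1 :=
      (neg_lt_zero.2 Nat.one_div_pos_of_nat).trans one_pos
    rw [complexMGF_ofReal, complexMGF_ofReal, hmgf μ _ hlt, hmgf ν _ hlt, h _ (by linarith)]
  have : T μ = T ν := by
    refine Measure.ext_of_charFun (funext fun t ↦ ?_)
    rw [← complexMGF_id_mul_I, ← complexMGF_id_mul_I]
    exact heq (by simp)
  rw [← hinv μ, this, hinv ν]

end

end SNRCrossing

/-! ### The Laplace transform of the off set and of the on period -/

namespace SNRCrossing

noncomputable section

/-- The union of the off intervals of a path that starts off. -/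
def offSet (x : Path) : Set ℝ := Ico 0 (up x 0) ∪ ⋃ n, Ico (down x n) (up x (n + 1))

theorem Switches.strictMono {x : Path} {σ : ℝ} {a b : ℕ → ℝ} (h : Switches x σ a b) :
    StrictMono a := strictMono_nat_of_lt_succ fun n ↦ (h.lt_down n).trans (h.lt_up n)

theorem measurableSet_mem_offSet : MeasurableSet {z : Path × ℝ | z.2 ∈ offSet z.1} := by
  have : {z : Path × ℝ | z.2 ∈ offSet z.1} = {z | 0 ≤ z.2 ∧ z.2 < up z.1 0} ∪
      ⋃ n, {z | down z.1 n ≤ z.2 ∧ z.2 < up z.1 (n + 1)} := by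
    ext z; simp [offSet]
  rw [this]
  exact ((measurableSet_le measurable_const measurable_snd).inter
    (measurableSet_lt measurable_snd ((measurable_up 0).comp measurable_fst))).union
    (.iUnion fun n ↦ (measurableSet_le ((measurable_down n).comp measurable_fst) measurable_snd).inter
      (measurableSet_lt measurable_snd ((measurable_up (n + 1)).comp measurable_fst)))

/-- The times `q n` approach `t` from the right, and the intervals of `offSet` contain their left
endpoints; so the unknown value of the path at a down-crossing plays no role. -/
theorem Good.eventually_eq_false_iff {x : Path} (hx : Good x) (h0 : next false x 0 = 0) {t : ℝ}
    (ht : 0 ≤ t) {q : ℕ → ℚ≥0} (hq : ∀ n, t < q n) (hlim : Tendsto (fun n ↦ (q n : ℝ)) atTop (𝓝 t)) :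
    ∀ᶠ n in atTop, x (q n) = false ↔ t ∈ offSet x := by
  by_cases hmem : t ∈ offSet x
  · rcases hmem with hmem | hmem
    · filter_upwards [hlim.eventually_lt_const hmem.2] with n hn
      exact iff_of_true (hx.initial_off _ (by rw [h0]; exact ht.trans_lt (hq n)) hn) (Or.inl hmem)
    · obtain ⟨m, hm⟩ := mem_iUnion.1 hmem
      filter_upwards [hlim.eventually_lt_const hm.2] with n hn
      exact iff_of_true (hx.off m _ (hm.1.trans_lt (hq n)) hn) (Or.inr hmem)
  · have hex : ∃ n, t < up x n := by
      obtain ⟨N, hN⟩ := exists_nat_gt t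
      obtain ⟨n, hn⟩ := hx.unbounded N
      exact ⟨n, hN.trans hn⟩
    obtain ⟨m, hm1, hm2⟩ : ∃ m, up x m ≤ t ∧ t < down x m := by
      classical
      have h1 := Nat.find_spec hex
      have h2 := fun k ↦ Nat.find_min hex (m := k)
      rcases hN : Nat.find hex with _ | m
      · rw [hN] at h1
        exact absurd (Or.inl ⟨ht, h1⟩) hmem
      · rw [hN] at h1
        refine ⟨m, not_lt.1 (h2 m (by omega)), not_le.1 fun hle ↦ hmem (Or.inr ?_)⟩
        exact mem_iUnion.2 ⟨m, hle, h1⟩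
    filter_upwards [hlim.eventually_lt_const hm2] with n hn
    refine iff_of_false ?_ hmem
    rw [hx.on m _ (hm1.trans (hq n).le) hn]
    simp

/-- The integral of the Laplace kernel over a prefix. -/
def laplaceGap (θ l : ℝ) : ENNReal := ∫⁻ t in Ico 0 l, laplaceKernel θ t

theorem lintegral_laplaceKernel_Ico_eq (θ a b : ℝ) :
    ∫⁻ t in Ico a b, laplaceKernel θ t = laplaceKernel θ a * laplaceGap θ (b - a) := by
  rw [laplaceGap, ← lintegral_const_mul' (laplaceKernel θ a) _ ENNReal.ofReal_ne_top,
    ← lintegral_indicator measurableSet_Ico, ← lintegral_indicator measurableSet_Ico,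
    ← lintegral_add_left_eq_self _ a]
  refine lintegral_congr fun t ↦ ?_
  simp only [indicator, mem_Ico]
  rw [laplaceKernel_add]
  congr 1
  simp only [eq_iff_iff]
  constructor <;> rintro ⟨h1, h2⟩ <;> constructor <;> linarith

theorem measurable_laplaceGap (θ : ℝ) : Measurable (laplaceGap θ) := by
  have : Monotone (laplaceGap θ) := fun a b hab ↦
    lintegral_mono_set (Ico_subset_Ico_right hab)
  exact this.measurable

/-- The contribution of the off period of cycle `n` to the Laplace transform of the off set, from
the beginning of cycle `0` onwards. -/
def laplaceTerm (θ : ℝ) : ℕ → (ℕ → ℝ × ℝ) → ENNReal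
  | 0, z => laplaceKernel θ (z 0).1 * laplaceGap θ (z 0).2
  | n + 1, z => laplaceKernel θ (z 0).1 * laplaceKernel θ (z 0).2 *
      laplaceTerm θ n fun i ↦ z (i + 1)

theorem measurable_tail {α : Type*} [MeasurableSpace α] :
    Measurable fun (z : ℕ → α) n ↦ z (n + 1) :=
  measurable_pi_lambda _ fun n ↦ measurable_pi_apply (n + 1)

theorem measurable_laplaceTerm (θ : ℝ) (n : ℕ) : Measurable (laplaceTerm θ n) := by
  have h0 : Measurable fun z : ℕ → ℝ × ℝ ↦ z 0 := measurable_pi_apply 0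
  induction n with
  | zero => exact ((measurable_laplaceKernel θ).comp h0.fst).mul ((measurable_laplaceGap θ).comp h0.snd)
  | succ n ih =>
    exact (((measurable_laplaceKernel θ).comp h0.fst).mul
      ((measurable_laplaceKernel θ).comp h0.snd)).mul (ih.comp measurable_tail)

/-- Telescoping: the periods from the `k`-th up-crossing onwards add up to the start of the off
interval in question, and the kernel is multiplicative. -/
theorem laplaceTerm_cycle (θ : ℝ) (x : Path) (n k : ℕ) :
    laplaceKernel θ (down x (k + n)) * laplaceGap θ (up x (k + n + 1) - down x (k + n)) =
      laplaceKernel θ (up x k) * laplaceTerm θ n fun i ↦ cycle x (k + i) := by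
  induction n generalizing k with
  | zero =>
    simp only [laplaceTerm, cycle, add_zero]
    rw [← mul_assoc, ← laplaceKernel_add]
    congr 2; ring
  | succ n ih =>
    have h1 := ih (k + 1)
    rw [show k + 1 + n = k + (n + 1) by ring] at h1
    rw [h1, laplaceTerm, ← mul_assoc, ← mul_assoc]
    congr 1
    · simp only [cycle, add_zero]
      rw [← laplaceKernel_add, ← laplaceKernel_add]
      congr 1; ring
    · congr 1
      funext i
      congr 1; ring

theorem Good.lintegral_offSet {x : Path} (hx : Good x) (θ : ℝ) :
    ∫⁻ t in offSet x, laplaceKernel θ t = laplaceGap θ (up x 0) +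
      laplaceKernel θ (up x 0) * ∑' n, laplaceTerm θ n (cycle x) := by
  have hle : ∀ i j, i < j → up x (i + 1) ≤ down x j := fun i j hij ↦
    (hx.strictMono.monotone hij).trans (hx.lt_down j).le
  rw [offSet, lintegral_union (.iUnion fun n ↦ measurableSet_Ico), lintegral_iUnion]
  · rw [← ENNReal.tsum_mul_left]
    congr 1
    refine tsum_congr fun n ↦ ?_
    rw [lintegral_laplaceKernel_Ico_eq]
    simpa using laplaceTerm_cycle θ x n 0
  · exact fun n ↦ measurableSet_Ico
  · intro i j hij
    refine Set.disjoint_left.2 fun t h1 h2 ↦ ?_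
    rcases lt_or_gt_of_ne hij with h | h
    · exact absurd (h1.2.trans_le (hle i j h)) (not_lt.2 h2.1)
    · exact absurd (h2.2.trans_le (hle j i h)) (not_lt.2 h1.1)
  · refine Set.disjoint_left.2 fun t h1 h2 ↦ ?_
    obtain ⟨n, hn⟩ := mem_iUnion.1 h2
    have := (hx.strictMono.monotone (Nat.zero_le n)).trans (hx.lt_down n).le
    exact absurd (h1.2.trans_le this) (not_lt.2 hn.1)

/-- Independence of the cycles: each complete cycle contributes a factor, and peeling off the first
one is the induction. -/
theorem lintegral_laplaceTerm (θ : ℝ) (F E : Measure ℝ) [IsProbabilityMeasure F]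
    [IsProbabilityMeasure E] (n : ℕ) :
    ∫⁻ z, laplaceTerm θ n z ∂Measure.infinitePi (fun _ ↦ F.prod E) =
      ((∫⁻ y, laplaceKernel θ y ∂F) * ∫⁻ y, laplaceKernel θ y ∂E) ^ n *
        ((∫⁻ y, laplaceKernel θ y ∂F) * ∫⁻ y, laplaceGap θ y ∂E) := by
  have hsplit : Measurable fun z : ℕ → ℝ × ℝ ↦ (z 0, fun n ↦ z (n + 1)) :=
    (measurable_pi_apply 0).prodMk measurable_tail
  have hk := measurable_laplaceKernel θ
  induction n with
  | zero =>
    have : ∫⁻ z, laplaceTerm θ 0 z ∂Measure.infinitePi (fun _ ↦ F.prod E) =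
        ∫⁻ y, laplaceKernel θ y.1 * laplaceGap θ y.2 ∂F.prod E := by
      have hm : Measurable fun y : ℝ × ℝ ↦ laplaceKernel θ y.1 * laplaceGap θ y.2 :=
        (hk.comp measurable_fst).mul ((measurable_laplaceGap θ).comp measurable_snd)
      conv_rhs => rw [← Measure.infinitePi_map_eval (fun _ : ℕ ↦ F.prod E) 0]
      rw [lintegral_map hm (measurable_pi_apply 0)]
      rfl
    rw [this, lintegral_prod_mul hk.aemeasurable (measurable_laplaceGap θ).aemeasurable, pow_zero,
      one_mul]
  | succ n ih =>
    have : ∫⁻ z, laplaceTerm θ (n + 1) z ∂Measure.infinitePi (fun _ ↦ F.prod E) =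
        ∫⁻ y, (laplaceKernel θ y.1.1 * laplaceKernel θ y.1.2) * laplaceTerm θ n y.2
          ∂(F.prod E).prod (Measure.infinitePi fun _ ↦ F.prod E) := by
      rw [← map_cons_infinitePi, lintegral_map _ hsplit]
      · rfl
      · exact ((hk.comp measurable_fst.fst).mul (hk.comp measurable_fst.snd)).mul
          ((measurable_laplaceTerm θ n).comp measurable_snd)
    rw [this, lintegral_prod_mul (f := fun y : ℝ × ℝ ↦ laplaceKernel θ y.1 * laplaceKernel θ y.2)
      ((hk.comp measurable_fst).mul (hk.comp measurable_snd)).aemeasurable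
      (measurable_laplaceTerm θ n).aemeasurable, ih,
      lintegral_prod_mul hk.aemeasurable hk.aemeasurable, pow_succ]
    ring

namespace Regenerative

variable {κ : Measure Path} [IsProbabilityMeasure κ] {h : ℚ≥0 → ENNReal}

theorem startOff_eq_false (hκ : Regenerative κ h) (q : ℚ≥0) : startOff κ {x | x q = false} = h q := by
  have := hκ.startOff_grid q 1
  rw [pow_one] at this
  rw [← this]
  refine measure_congr ?_
  filter_upwards [ae_startOff_zero (κ := κ)] with x hx
  refine eq_iff_iff.2 ⟨fun (h : x q = false) ↦ ?_, fun h ↦ ?_⟩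
  swap
  · have := h 1 le_rfl
    rwa [Nat.cast_one, one_mul] at this
  intro j hj
  interval_cases j
  · simpa using hx
  · simpa using h

/-- Real times are approached from the right by rational ones. Off probabilities converge on one
side by dominated convergence, on the other by continuity of `H`. -/
theorem startOff_mem_offSet (hκ : Regenerative κ h) {H : ℝ → ENNReal} (hH : Continuous H)
    (hh : ∀ q : ℚ≥0, h q = H q) {t : ℝ} (ht : 0 ≤ t) :
    startOff κ {x | t ∈ offSet x} = H t := by
  have hP := hκ.isProbabilityMeasure_startOff
  have hex : ∀ n : ℕ, ∃ q : ℚ≥0, t < q ∧ (q : ℝ) < t + 1 / ((n : ℝ) + 1) := fun n ↦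
    exists_nnrat_btwn ht (lt_add_of_pos_right t Nat.one_div_pos_of_nat)
  choose q hq1 hq2 using hex
  have hlim : Tendsto (fun n ↦ (q n : ℝ)) atTop (𝓝 t) := by
    refine tendsto_of_tendsto_of_tendsto_of_le_of_le tendsto_const_nhds ?_ (fun n ↦ (hq1 n).le)
      (fun n ↦ (hq2 n).le)
    simpa using (tendsto_one_div_add_atTop_nhds_zero_nat (𝕜 := ℝ)).const_add t
  have h1 : Tendsto (fun n ↦ startOff κ {x | x (q n) = false}) atTop
      (𝓝 (startOff κ {x | t ∈ offSet x})) := by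
    refine tendsto_measure_of_ae_tendsto_indicator_of_isFiniteMeasure _
      (measurable_prodMk_right measurableSet_mem_offSet) (fun n ↦ measurableSet_path_eq _ _) ?_
    filter_upwards [hκ.ae_startOff_next] with x ⟨hx, h0⟩
    exact hx.eventually_eq_false_iff h0 ht hq1 hlim
  have h2 : Tendsto (fun n ↦ startOff κ {x | x (q n) = false}) atTop (𝓝 (H t)) := by
    simp only [hκ.startOff_eq_false, hh]
    exact (hH.tendsto t).comp hlim
  exact tendsto_nhds_unique h1 h2

/-- The Laplace transform of the probability of being off, in terms of the Laplace transforms of the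
on and the off periods. -/
theorem lintegral_laplaceKernel_mul (hκ : Regenerative κ h) {a : ℝ} (hrate : HasRate h a)
    {H : ℝ → ENNReal} (hH : Continuous H) (hh : ∀ q : ℚ≥0, h q = H q) (θ : ℝ) :
    ∫⁻ t in Ici 0, laplaceKernel θ t * H t = (∫⁻ y, laplaceGap θ y ∂expMeasure a) *
      (1 - (∫⁻ y, laplaceKernel θ y ∂((startOff κ).map fun x ↦ (cycle x 0).1)) *
        ∫⁻ y, laplaceKernel θ y ∂expMeasure a)⁻¹ := by
  have hP := hκ.isProbabilityMeasure_startOff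
  have hE := isProbabilityMeasure_expMeasure hrate.1
  have hc : Measurable fun x ↦ (cycle x 0).1 := ((measurable_pi_apply 0).comp measurable_cycle).fst
  have hF : IsProbabilityMeasure ((startOff κ).map fun x ↦ (cycle x 0).1) :=
    Measure.isProbabilityMeasure_map hc.aemeasurable
  set F := (startOff κ).map fun x ↦ (cycle x 0).1 with hFdef
  have hQ : (startOff κ).map cycle = Measure.infinitePi fun _ ↦ F.prod (expMeasure a) := by
    rw [← hκ.map_cycle_eq]; exact hκ.map_cycle hrate
  have hjoint : (startOff κ).map (fun x ↦ (up x 0, cycle x)) =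
      (expMeasure a).prod (Measure.infinitePi fun _ ↦ F.prod (expMeasure a)) := by
    refine (Measure.prod_eq fun s Z hs hZ ↦ ?_).symm
    rw [← hQ, Measure.map_apply ((measurable_up 0).prodMk measurable_cycle) (hs.prod hZ),
      Measure.map_apply measurable_cycle hZ]
    exact hκ.startOff_up_zero_mem_inter hrate hs hZ
  have hterm : ∀ n, ∫⁻ x, laplaceKernel θ (up x 0) * laplaceTerm θ n (cycle x) ∂startOff κ =
      (∫⁻ y, laplaceKernel θ y ∂expMeasure a) *
        ∫⁻ z, laplaceTerm θ n z ∂Measure.infinitePi fun _ ↦ F.prod (expMeasure a) := by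
    intro n
    have hm : Measurable fun z : ℝ × (ℕ → ℝ × ℝ) ↦ laplaceKernel θ z.1 * laplaceTerm θ n z.2 :=
      ((measurable_laplaceKernel θ).comp measurable_fst).mul
        ((measurable_laplaceTerm θ n).comp measurable_snd)
    rw [← lintegral_prod_mul (measurable_laplaceKernel θ).aemeasurable
      (measurable_laplaceTerm θ n).aemeasurable, ← hjoint, lintegral_map hm
      ((measurable_up 0).prodMk measurable_cycle)]
  have hgap : ∫⁻ x, laplaceGap θ (up x 0) ∂startOff κ = ∫⁻ y, laplaceGap θ y ∂expMeasure a := by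
    have : (startOff κ).map (fun x ↦ up x 0) = expMeasure a := by
      ext s hs
      rw [Measure.map_apply (measurable_up 0) hs]
      have := hκ.startOff_up_zero_mem_inter hrate hs .univ
      simp only [mem_univ, and_true, measure_univ, mul_one, ofPred_true] at this
      exact this
    rw [← this, lintegral_map (measurable_laplaceGap θ) (measurable_up 0)]
  have hindm : Measurable fun z : ℝ × Path ↦ (offSet z.2).indicator (laplaceKernel θ) z.1 := by
    have : MeasurableSet {z : ℝ × Path | z.1 ∈ offSet z.2} :=
      measurable_swap measurableSet_mem_offSet
    exact ((measurable_laplaceKernel θ).comp measurable_fst).indicator this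
  calc ∫⁻ t in Ici 0, laplaceKernel θ t * H t
      = ∫⁻ t in Ici 0, (∫⁻ x, (offSet x).indicator (laplaceKernel θ) t ∂startOff κ) := by
        refine setLIntegral_congr_fun measurableSet_Ici fun t ht ↦ ?_
        rw [← hκ.startOff_mem_offSet hH hh ht, ← lintegral_indicator_const]
        · rfl
        · exact measurable_prodMk_right measurableSet_mem_offSet
    _ = ∫⁻ x, (∫⁻ t in Ici 0, (offSet x).indicator (laplaceKernel θ) t) ∂startOff κ :=
        lintegral_lintegral_swap hindm.aemeasurable
    _ = ∫⁻ x, (laplaceGap θ (up x 0) +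
          ∑' n, laplaceKernel θ (up x 0) * laplaceTerm θ n (cycle x)) ∂startOff κ := by
        refine lintegral_congr_ae ?_
        filter_upwards [ae_startOff hκ.good] with x hx
        have hm : MeasurableSet (offSet x) :=
          measurableSet_Ico.union (.iUnion fun n ↦ measurableSet_Ico)
        rw [lintegral_indicator hm, Measure.restrict_restrict hm, inter_eq_left.2,
          hx.lintegral_offSet, ENNReal.tsum_mul_left]
        rintro t (ht | ht)
        · exact ht.1
        · obtain ⟨n, hn⟩ := mem_iUnion.1 ht
          exact ((hx.up_pos n).trans (hx.lt_down n)).le.trans hn.1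
    _ = _ := by
        have hm : Measurable fun x ↦ laplaceGap θ (up x 0) :=
          (measurable_laplaceGap θ).comp (measurable_up 0)
        rw [lintegral_add_left hm, lintegral_tsum, hgap]
        · simp only [hterm, lintegral_laplaceTerm]
          set b := ∫⁻ y, laplaceKernel θ y ∂F
          set c := ∫⁻ y, laplaceKernel θ y ∂expMeasure a
          set G := ∫⁻ y, laplaceGap θ y ∂expMeasure a
          -- `G + ∑ c (b c)ⁿ b G = G ∑ (b c)ⁿ`: the initial off interval supplies the term of order
          -- zero of the geometric series.
          rw [← ENNReal.tsum_geometric, tsum_eq_zero_add' (f := fun n ↦ (b * c) ^ n) ENNReal.summable, pow_zero, mul_add, mul_one,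
            ← ENNReal.tsum_mul_left]
          congr 1
          refine tsum_congr fun n ↦ ?_
          rw [pow_succ]
          ring
        · exact fun n ↦ (((measurable_laplaceKernel θ).comp (measurable_up 0)).mul
            ((measurable_laplaceTerm θ n).comp measurable_cycle)).aemeasurable

/-- The Laplace transform of the tail of the on period. -/
theorem lintegral_laplaceKernel_tail (hκ : Regenerative κ h) {a : ℝ} (hrate : HasRate h a)
    {H : ℝ → ENNReal} (hH : Continuous H) (hh : ∀ q : ℚ≥0, h q = H q) {θ : ℝ} (hθ : 0 < θ) {J : ℝ}
    (hJ0 : 0 < J) (hJ : ∫⁻ t in Ici 0, laplaceKernel θ t * H t = ENNReal.ofReal J) :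
    ∫⁻ t in Ici 0, laplaceKernel θ t * ((startOff κ).map fun x ↦ (cycle x 0).1) (Ioi t) =
      ENNReal.ofReal ((1 - θ * J) / (a * θ * J)) := by
  have ha := hrate.1
  have hP := hκ.isProbabilityMeasure_startOff
  have hE := isProbabilityMeasure_expMeasure ha
  have hc : Measurable fun x ↦ (cycle x 0).1 := ((measurable_pi_apply 0).comp measurable_cycle).fst
  have hF : IsProbabilityMeasure ((startOff κ).map fun x ↦ (cycle x 0).1) :=
    Measure.isProbabilityMeasure_map hc.aemeasurable
  have hF0 : ((startOff κ).map fun x ↦ (cycle x 0).1) (Iio 0) = 0 := by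
    rw [Measure.map_apply hc measurableSet_Iio]
    have := ae_startOff hκ.good
    rw [ae_iff] at this
    exact measure_mono_null (fun x hx (hg : Good x) ↦ (sub_pos.2 (hg.lt_down 0)).not_gt hx) this
  have hE0 : expMeasure a (Iio 0) = 0 :=
    measure_mono_null Iio_subset_Iic_self (expMeasure_Iic_zero ha)
  have key := hκ.lintegral_laplaceKernel_mul hrate hH hh θ
  have hT := laplace_tail _ hF0 hθ
  have hG := laplace_tail _ hE0 hθ
  rw [← lintegral_Ico_laplaceKernel_eq] at hG
  change ENNReal.ofReal θ * (∫⁻ l, laplaceGap θ l ∂expMeasure a) + _ = 1 at hG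
  rw [hJ] at key
  rw [lintegral_laplaceKernel_expMeasure ha hθ] at key hG
  set F := (startOff κ).map fun x ↦ (cycle x 0).1
  set b := ∫⁻ y, laplaceKernel θ y ∂F
  set T := ∫⁻ t in Ici 0, laplaceKernel θ t * F (Ioi t)
  set G := ∫⁻ l, laplaceGap θ l ∂expMeasure a
  have hb1 : b ≤ 1 := by rw [← hT]; exact le_add_self
  have hbt : b ≠ ⊤ := (hb1.trans_lt ENNReal.one_lt_top).ne
  have hθ0 : ENNReal.ofReal θ ≠ 0 := (ENNReal.ofReal_pos.2 hθ).ne'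
  have hsolve : ∀ (T : ENNReal) (r : ℝ), 0 ≤ r → r ≤ 1 →
      ENNReal.ofReal θ * T + ENNReal.ofReal r = 1 → T = ENNReal.ofReal ((1 - r) / θ) := by
    intro T r hr0 hr1 h
    have h1 : ENNReal.ofReal θ * T = ENNReal.ofReal (1 - r) := by
      rw [ENNReal.ofReal_sub _ hr0, ENNReal.ofReal_one]
      exact ENNReal.eq_sub_of_add_eq ENNReal.ofReal_ne_top h
    rw [ENNReal.ofReal_div_of_pos hθ, ← h1, mul_comm, ENNReal.mul_div_cancel_right hθ0
      ENNReal.ofReal_ne_top]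
  have hbr1 : b.toReal ≤ 1 := by simpa using ENNReal.toReal_mono ENNReal.one_ne_top hb1
  have hbr0 : 0 ≤ b.toReal := ENNReal.toReal_nonneg
  have hb : b = ENNReal.ofReal b.toReal := (ENNReal.ofReal_toReal hbt).symm
  rw [hb] at hT key
  rw [hsolve T _ hbr0 hbr1 hT]
  have hc1 : a / (a + θ) ≤ 1 := by rw [div_le_one (by positivity)]; linarith
  have hlt : b.toReal * (a / (a + θ)) < 1 := by
    refine lt_of_le_of_lt (mul_le_of_le_one_left (by positivity) hbr1) ?_
    rw [div_lt_one (by positivity)]; linarith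
  rw [hsolve G _ (by positivity) hc1 hG, ← ENNReal.ofReal_mul hbr0, ← ENNReal.ofReal_one,
    ← ENNReal.ofReal_sub _ (by positivity), ← ENNReal.ofReal_inv_of_pos (by linarith),
    ← ENNReal.ofReal_mul (div_nonneg (by linarith) hθ.le), ENNReal.ofReal_eq_ofReal_iff hJ0.le
      (mul_nonneg (div_nonneg (by linarith) hθ.le) (inv_nonneg.2 (by linarith)))] at key
  congr 1
  have h1 : a + θ - a * b.toReal ≠ 0 := by nlinarith
  -- The exponential law has transform `a / (a + θ)` and `G = 1 / (a + θ)`; substituting these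
  -- leaves `J (a + θ - a b) = 1`, from which `b` is eliminated below.
  have h2 : J = (a + θ - a * b.toReal)⁻¹ := by
    rw [key]
    have h3 : 1 - b.toReal * (a / (a + θ)) = (a + θ - a * b.toReal) / (a + θ) := by
      field_simp
    rw [h3, inv_div]
    field_simp
    ring
  have h4 : 1 - θ * J = a * (1 - b.toReal) * J := by
    rw [h2]
    have h5 := mul_inv_cancel₀ h1
    linear_combination -h5
  rw [h4]
  field_simp

end Regenerative

end

end SNRCrossing

/-! ### The forward recurrence time as a geometric sum -/

namespace SNRCrossing

noncomputable section

theorem measurable_prefixSum : Measurable fun z : ℕ × (ℕ → ℝ) ↦ ∑ i ∈ Finset.range z.1, z.2 i :=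
  measurable_from_prod_countable_right fun m ↦
    (Finset.measurable_sum (Finset.range m) fun i _ ↦ measurable_pi_apply i :
      Measurable fun z : ℕ → ℝ ↦ ∑ i ∈ Finset.range m, z i)

theorem laplace_prefixSum (μ : Measure ℝ) [IsProbabilityMeasure μ] (θ : ℝ) (m : ℕ) :
    ∫⁻ z, laplaceKernel θ (∑ i ∈ Finset.range m, z i) ∂Measure.infinitePi (fun _ : ℕ ↦ μ) =
      (∫⁻ y, laplaceKernel θ y ∂μ) ^ m := by
  have hk := measurable_laplaceKernel θ
  have hs : ∀ m, Measurable fun z : ℕ → ℝ ↦ ∑ i ∈ Finset.range m, z i := fun m ↦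
    Finset.measurable_sum _ fun i _ ↦ measurable_pi_apply i
  induction m with
  | zero => simp [laplaceKernel]
  | succ m ih =>
    have hm : Measurable fun z : ℝ × (ℕ → ℝ) ↦
        laplaceKernel θ z.1 * laplaceKernel θ (∑ i ∈ Finset.range m, z.2 i) :=
      (hk.comp measurable_fst).mul (hk.comp ((hs m).comp measurable_snd))
    have := lintegral_prod_mul (μ := μ) (ν := Measure.infinitePi fun _ : ℕ ↦ μ) hk.aemeasurable
      (hk.comp (hs m)).aemeasurable
    simp only [Function.comp_apply] at this
    rw [ih, ← map_cons_infinitePi, lintegral_map hm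
      ((measurable_pi_apply 0).prodMk measurable_tail)] at this
    rw [pow_succ', ← this]
    refine lintegral_congr fun z ↦ ?_
    rw [Finset.sum_range_succ', add_comm, laplaceKernel_add]

/-- The tail of a probability law, integrated, is its mean. -/
theorem withDensity_tail_univ (F : Measure ℝ) (hF : F (Iio 0) = 0) :
    (volume.restrict (Ici 0)).withDensity (fun z ↦ F (Ioi z)) univ =
      ∫⁻ y, ENNReal.ofReal y ∂F := by
  have h0 : 0 ≤ᵐ[F] fun y : ℝ ↦ y := by
    rw [EventuallyLE, ae_iff]; simpa [Iio_def] using hF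
  rw [withDensity_apply _ .univ, Measure.restrict_univ,
    lintegral_eq_lintegral_meas_lt F h0 aemeasurable_id, restrict_Ioi_eq_restrict_Ici]
  rfl

theorem antitone_tail (F : Measure ℝ) : Antitone fun z ↦ F (Ioi z) :=
  fun _ _ h ↦ measure_mono (Ioi_subset_Ioi h)

variable {Ω : Type*} [MeasurableSpace Ω] {Q : Measure Ω} [IsProbabilityMeasure Q]

/-- A geometric sum of i.i.d. terms with the law of the minimal residual service time has the law of
the forward recurrence time of the on period. -/
theorem hasLaw_geometric_sum {a ν : ℝ} (ha : 0 < a) (hν0 : 0 < ν) (hν1 : ν < 1) {H : ℝ → ℝ}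
    (hHν : ∀ t, 0 ≤ t → 1 - ν ≤ H t) (hH1 : ∀ t, H t ≤ 1) (hH0 : H 0 = 1)
    {F : Measure ℝ} (hF : F (Iio 0) = 0)
    (hFT : ∀ θ J : ℝ, 0 < θ → 0 < J →
      ∫⁻ t in Ici 0, laplaceKernel θ t * ENNReal.ofReal (H t) = ENNReal.ofReal J →
      ∫⁻ t in Ici 0, laplaceKernel θ t * F (Ioi t) = ENNReal.ofReal ((1 - θ * J) / (a * θ * J)))
    {M : Ω → ℕ} {U : ℕ → Ω → ℝ} (hM : AEMeasurable M Q)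
    (hlawM : ∀ l : ℕ, Q.real {ω | M ω = l + 1} = (1 - ν) * ν ^ l)
    (hU : ∀ n, AEMeasurable (U n) Q)
    (hlawU : ∀ n, ∀ u : ℝ, 0 ≤ u → Q.real {ω | U n ω ≤ u} = 1 / ν * (1 - H u))
    (hind : iIndepFun U Q) (hindM : IndepFun M (fun ω n ↦ U n ω) Q) :
    HasLaw (fun ω ↦ ∑ i ∈ Finset.range (M ω), U i ω) (forwardRecurrence F) Q := by
  -- the common law of the summands
  let μ := Q.map (U 0)
  have hμP : IsProbabilityMeasure μ := Measure.isProbabilityMeasure_map (hU 0)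
  have hIic : ∀ n u, 0 ≤ u → (Q.map (U n)).real (Iic u) = 1 / ν * (1 - H u) := by
    intro n u hu
    rw [← hlawU n u hu, map_measureReal_apply_of_aemeasurable (hU n) measurableSet_Iic]
    rfl
  have hneg : ∀ n, Q.map (U n) (Iic 0) = 0 := by
    intro n
    have hP : IsProbabilityMeasure (Q.map (U n)) := Measure.isProbabilityMeasure_map (hU n)
    have := hIic n 0 le_rfl
    rw [hH0, sub_self, mul_zero] at this
    exact (measureReal_eq_zero_iff (measure_ne_top _ _)).1 this
  have hIoi : ∀ n u, 0 ≤ u → Q.map (U n) (Ioi u) = ENNReal.ofReal (1 - 1 / ν * (1 - H u)) := by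
    intro n u hu
    have hP : IsProbabilityMeasure (Q.map (U n)) := Measure.isProbabilityMeasure_map (hU n)
    rw [← hIic n u hu, ← probReal_compl_eq_one_sub measurableSet_Iic, compl_Iic, ofReal_measureReal]
  have hlaw : ∀ n, Q.map (U n) = μ := by
    intro n
    have hP : IsProbabilityMeasure (Q.map (U n)) := Measure.isProbabilityMeasure_map (hU n)
    refine ext_of_Ioi_nnrat (hneg n) (hneg 0) fun q ↦ ?_
    rw [hIoi n q q.cast_nonneg]
    exact (hIoi 0 q q.cast_nonneg).symm
  have hUm : AEMeasurable (fun ω n ↦ U n ω) Q := aemeasurable_pi_iff.2 hU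
  have hseq : Q.map (fun ω n ↦ U n ω) = Measure.infinitePi fun _ ↦ μ := by
    rw [hind.map_fun_eq_infinitePi_map₀ hUm]
    simp only [hlaw]
  have hMP : IsProbabilityMeasure (Q.map M) := Measure.isProbabilityMeasure_map hM
  have hjoint : Q.map (fun ω ↦ (M ω, fun n ↦ U n ω)) =
      (Q.map M).prod (Measure.infinitePi fun _ ↦ μ) := by
    rw [(indepFun_iff_map_prod_eq_prod_map_map hM hUm).1 hindM, hseq]
  have hpm : ∀ l : ℕ, Q.map M {l + 1} = ENNReal.ofReal ((1 - ν) * ν ^ l) := by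
    intro l
    rw [← hlawM l, Measure.map_apply_of_aemeasurable hM (measurableSet_singleton _),
      ofReal_measureReal]
    rfl
  -- The prescribed masses of `1, 2, …` already sum to `1`.
  have hp0 : Q.map M {0} = 0 := by
    have h1 : ∑' l, Q.map M {l} = 1 := by
      have := lintegral_countable' (μ := Q.map M) (fun _ : ℕ ↦ (1 : ENNReal))
      simp only [lintegral_const, measure_univ, one_mul] at this
      exact this.symm
    rw [tsum_eq_zero_add' ENNReal.summable] at h1
    have h2 : ∑' l : ℕ, Q.map M {l + 1} = 1 := by
      simp only [hpm]
      rw [← ENNReal.ofReal_tsum_of_nonneg, tsum_mul_left, tsum_geometric_of_lt_one hν0.le hν1,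
        mul_inv_cancel₀ (by linarith), ENNReal.ofReal_one]
      · intro l
        have : 0 < 1 - ν := by linarith
        positivity
      · exact (summable_geometric_of_lt_one hν0.le hν1).mul_left _
    rw [h2] at h1
    simpa using h1
  have hSm : AEMeasurable (fun ω ↦ ∑ i ∈ Finset.range (M ω), U i ω) Q :=
    measurable_prefixSum.comp_aemeasurable (hM.prodMk hUm)
  refine ⟨hSm, ?_⟩
  set G := Q.map (fun ω ↦ ∑ i ∈ Finset.range (M ω), U i ω) with hG
  have hGP : IsProbabilityMeasure G := Measure.isProbabilityMeasure_map hSm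
  have hGlap : ∀ θ, ∫⁻ y, laplaceKernel θ y ∂G =
      ∑' l : ℕ, ENNReal.ofReal ((1 - ν) * ν ^ l) * (∫⁻ y, laplaceKernel θ y ∂μ) ^ (l + 1) := by
    intro θ
    have hGeq : G = ((Q.map M).prod (Measure.infinitePi fun _ ↦ μ)).map
        (fun z ↦ ∑ i ∈ Finset.range z.1, z.2 i) := by
      rw [← hjoint, AEMeasurable.map_map_of_aemeasurable measurable_prefixSum.aemeasurable
        (hM.prodMk hUm)]
      rfl
    have hk : Measurable fun z : ℕ × (ℕ → ℝ) ↦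
        laplaceKernel θ (∑ i ∈ Finset.range z.1, z.2 i) :=
      (measurable_laplaceKernel θ).comp measurable_prefixSum
    rw [hGeq, lintegral_map (measurable_laplaceKernel θ) measurable_prefixSum,
      lintegral_prod _ hk.aemeasurable]
    simp only [laplace_prefixSum]
    rw [lintegral_countable', tsum_eq_zero_add' ENNReal.summable, hp0, mul_zero, zero_add]
    refine tsum_congr fun l ↦ ?_
    rw [hpm, mul_comm]
  -- Since `H t = ν ℙ(U > t) + (1 - ν)` for `t ≥ 0`, the transforms of `H` and of `U` determine each
  -- other.
  have hJ : ∀ θ : ℝ, 0 < θ → ∃ J : ℝ, 0 < J ∧ θ * J ≤ 1 ∧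
      ∫⁻ t in Ici 0, laplaceKernel θ t * ENNReal.ofReal (H t) = ENNReal.ofReal J ∧
      ∫⁻ y, laplaceKernel θ y ∂μ = ENNReal.ofReal ((1 - θ * J) / ν) := by
    intro θ hθ
    set I := ∫⁻ t in Ici 0, laplaceKernel θ t * ENNReal.ofReal (H t) with hI
    have hIle : I ≤ ENNReal.ofReal (1 / θ) := by
      rw [← lintegral_laplaceKernel_Ici hθ]
      exact lintegral_mono fun t ↦ mul_le_of_le_one_right' (by simpa using hH1 t)
    have hItop : I ≠ ⊤ := (hIle.trans_lt ENNReal.ofReal_lt_top).ne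
    have hsplit : I = ENNReal.ofReal ν * (∫⁻ t in Ici 0, laplaceKernel θ t * μ (Ioi t)) +
        ENNReal.ofReal ((1 - ν) / θ) := by
      have h1 : ENNReal.ofReal ((1 - ν) / θ) =
          ∫⁻ t in Ici 0, laplaceKernel θ t * ENNReal.ofReal (1 - ν) := by
        rw [lintegral_mul_const' _ _ ENNReal.ofReal_ne_top, lintegral_laplaceKernel_Ici hθ,
          ← ENNReal.ofReal_mul (by positivity)]
        congr 1; ring
      rw [h1, ← lintegral_const_mul' _ _ ENNReal.ofReal_ne_top, ← lintegral_add_right]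
      · refine setLIntegral_congr_fun measurableSet_Ici fun t ht ↦ ?_
        have h2 := hIoi 0 t ht
        have h3 := hHν t ht
        have h4 : 0 ≤ 1 - 1 / ν * (1 - H t) := by
          rw [sub_nonneg, one_div, inv_mul_le_iff₀ hν0]; linarith
        change Measure.map (U 0) Q (Ioi t) = _ at h2
        simp only [μ]
        rw [h2, mul_left_comm, ← mul_add, ← ENNReal.ofReal_mul hν0.le,
          ← ENNReal.ofReal_add (by positivity) (by linarith)]
        congr 2
        field_simp
        ring
      · exact (measurable_laplaceKernel θ).mul_const _
    set T := ∫⁻ t in Ici 0, laplaceKernel θ t * μ (Ioi t) with hT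
    have hμ0 : μ (Iio 0) = 0 := measure_mono_null Iio_subset_Iic_self (hneg 0)
    have htail := laplace_tail μ hμ0 hθ
    rw [← hT] at htail
    have hTtop : T ≠ ⊤ := by
      rintro h
      rw [hsplit, h, ENNReal.mul_top (ENNReal.ofReal_pos.2 hν0).ne'] at hItop
      exact hItop (top_add _)
    have hu : ∫⁻ y, laplaceKernel θ y ∂μ ≠ ⊤ := by
      intro h
      rw [h] at htail
      simp at htail
    have e1 := congrArg ENNReal.toReal hsplit
    have e2 := congrArg ENNReal.toReal htail
    rw [ENNReal.toReal_add (ENNReal.mul_ne_top ENNReal.ofReal_ne_top hTtop) ENNReal.ofReal_ne_top,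
      ENNReal.toReal_mul, ENNReal.toReal_ofReal hν0.le,
      ENNReal.toReal_ofReal (div_nonneg (by linarith) hθ.le)] at e1
    rw [ENNReal.toReal_add (ENNReal.mul_ne_top ENNReal.ofReal_ne_top hTtop) hu,
      ENNReal.toReal_mul, ENNReal.toReal_ofReal hθ.le, ENNReal.toReal_one] at e2
    have hTr : 0 ≤ T.toReal := ENNReal.toReal_nonneg
    have hIr : I.toReal ≤ 1 / θ := by
      have := ENNReal.toReal_mono ENNReal.ofReal_ne_top hIle
      rwa [ENNReal.toReal_ofReal (by positivity)] at this
    have h1ν : 0 < (1 - ν) / θ := div_pos (by linarith) hθ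
    refine ⟨I.toReal, by nlinarith, ?_, (ENNReal.ofReal_toReal hItop).symm, ?_⟩
    · rw [le_div_iff₀ hθ] at hIr; linarith
    · rw [← ENNReal.ofReal_toReal hu]
      congr 1
      rw [eq_div_iff hν0.ne', e1]
      have h5 : θ * ((1 - ν) / θ) = 1 - ν := mul_div_cancel₀ _ hθ.ne'
      linear_combination ν * e2 + h5
  -- The constant by which the two transforms differ; the comparison of total masses in `hmean`
  -- shows that it is the mean of `F`.
  set K := ν / (a * (1 - ν)) with hK
  have h1ν : 0 < 1 - ν := by linarith
  have hKpos : 0 < K := by positivity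
  -- With `û = (1 - θ J) / ν`, the sum has transform `(1 - ν) û / (1 - ν û)`, where `1 - ν û = θ J`;
  -- times `K` this is `(1 - θ J) / (a θ J)`.
  have hmain : (volume.restrict (Ici 0)).withDensity (fun z ↦ F (Ioi z)) = ENNReal.ofReal K • G := by
    have hlap : ∀ θ, ∫⁻ y, laplaceKernel θ y ∂(volume.restrict (Ici 0)).withDensity
        (fun z ↦ F (Ioi z)) = ∫⁻ t in Ici 0, laplaceKernel θ t * F (Ioi t) := by
      intro θ
      rw [lintegral_withDensity_eq_lintegral_mul _ (antitone_tail F).measurable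
        (measurable_laplaceKernel θ)]
      simp only [Pi.mul_apply, mul_comm]
    refine ext_of_laplace (fun θ hθ ↦ ?_) fun θ hθ ↦ ?_
    · obtain ⟨J, hJ0, -, hJ1, -⟩ := hJ θ hθ
      rw [hlap, hFT θ J hθ hJ0 hJ1]
      exact ENNReal.ofReal_ne_top
    · obtain ⟨J, hJ0, hJle, hJ1, hJ2⟩ := hJ θ hθ
      rw [hlap, hFT θ J hθ hJ0 hJ1, lintegral_smul_measure, hGlap, hJ2, smul_eq_mul]
      have hu0 : 0 ≤ (1 - θ * J) / ν := div_nonneg (by linarith) hν0.le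
      have hθJ : 0 < θ * J := by positivity
      have hlt : ν * ((1 - θ * J) / ν) < 1 := by rw [mul_div_cancel₀ _ hν0.ne']; linarith
      have hterm : ∀ l : ℕ, ENNReal.ofReal ((1 - ν) * ν ^ l) *
          ENNReal.ofReal ((1 - θ * J) / ν) ^ (l + 1) =
          ENNReal.ofReal ((1 - ν) * ((1 - θ * J) / ν) * (ν * ((1 - θ * J) / ν)) ^ l) := by
        intro l
        rw [← ENNReal.ofReal_pow hu0, ← ENNReal.ofReal_mul (by positivity)]
        congr 1
        rw [mul_pow, pow_succ]; ring
      simp only [hterm]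
      rw [← ENNReal.ofReal_tsum_of_nonneg (fun l ↦ by positivity)
        ((summable_geometric_of_lt_one (by positivity) hlt).mul_left _), tsum_mul_left,
        tsum_geometric_of_lt_one (by positivity) hlt, ← ENNReal.ofReal_mul hKpos.le]
      congr 1
      rw [mul_div_cancel₀ _ hν0.ne', sub_sub_cancel, hK]
      field_simp
  have hmean : ∫⁻ y, ENNReal.ofReal y ∂F = ENNReal.ofReal K := by
    rw [← withDensity_tail_univ F hF, hmain, Measure.smul_apply, measure_univ, smul_eq_mul, mul_one]
  rw [forwardRecurrence, hmain, hmean, smul_smul,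
    ENNReal.inv_mul_cancel (ENNReal.ofReal_pos.2 hKpos).ne' ENNReal.ofReal_ne_top, one_smul]

end

end SNRCrossing

/-! ### Deterministic sets of times that alternate -/

namespace SNRCrossing

noncomputable section

/-- A set of times that is locally a finite union of nondegenerate intervals which contain their
left endpoints. -/
structure LocallyAlternating (S : Set ℝ) : Prop where
  right : ∀ t, 0 ≤ t → (∀ᶠ s in 𝓝[>] t, s ∈ S) ∨ ∀ᶠ s in 𝓝[>] t, s ∉ S
  left : ∀ t, 0 < t → (∀ᶠ s in 𝓝[<] t, s ∈ S) ∨ ∀ᶠ s in 𝓝[<] t, s ∉ S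
  off_right : ∀ t, 0 ≤ t → t ∉ S → ∀ᶠ s in 𝓝[>] t, s ∉ S
  on_side : ∀ t, 0 < t → t ∈ S → (∀ᶠ s in 𝓝[>] t, s ∈ S) ∨ ∀ᶠ s in 𝓝[<] t, s ∈ S

namespace LocallyAlternating

variable {S : Set ℝ}

/-- If the set were on just after the infimum of the off times, the infimum would itself be off, and
then `off_right` would make it off just after. -/
theorem nextOff_spec (h : LocallyAlternating S) (hoff : ∀ N : ℝ, ∃ t, N < t ∧ t ∉ S) {t : ℝ}
    (ht : 0 ≤ t) : t ≤ nextOff S t ∧ Ioo t (nextOff S t) ⊆ S ∧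
      ∀ᶠ s in 𝓝[>] (nextOff S t), s ∉ S := by
  set A := {s | t < s ∧ s ∉ S} with hA
  have hne : A.Nonempty := by obtain ⟨s, h1, h2⟩ := hoff t; exact ⟨s, h1, h2⟩
  have hbdd : BddBelow A := ⟨t, fun s hs ↦ hs.1.le⟩
  have hle : t ≤ nextOff S t := le_csInf hne fun s hs ↦ hs.1.le
  refine ⟨hle, fun s hs ↦ ?_, ?_⟩
  · by_contra hsS
    exact absurd (csInf_le hbdd ⟨hs.1, hsS⟩) (not_le.2 hs.2)
  · refine (h.right _ (ht.trans hle)).resolve_left fun hon ↦ ?_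
    have hnotin : nextOff S t ∉ S := by
      intro hin
      obtain ⟨u, hu, hsub⟩ := mem_nhdsGT_iff_exists_Ioo_subset.1 hon
      obtain ⟨s, hs, hsu⟩ := (csInf_lt_iff hbdd hne).1 (show sInf A < u from hu)
      have h1 : nextOff S t ≤ s := csInf_le hbdd hs
      rcases h1.eq_or_lt with heq | hlt
      · exact hs.2 (heq ▸ hin)
      · exact hs.2 (hsub ⟨hlt, hsu⟩)
    obtain ⟨s, h1, h2⟩ := (hon.and (h.off_right _ (ht.trans hle) hnotin)).exists
    exact h2 h1

/-- The condition `on_side` excludes an isolated on time: on times next to the infimum cannot lie to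
its left, so they lie to its right. By `off_right` the infimum is then on itself. -/
theorem nextOn_spec (h : LocallyAlternating S) (hon : ∀ N : ℝ, ∃ t, N < t ∧ t ∈ S) {t : ℝ}
    (ht : 0 ≤ t) (hoff : ∀ᶠ s in 𝓝[>] t, s ∉ S) : t < nextOn S t ∧ Ioo t (nextOn S t) ⊆ Sᶜ ∧
      nextOn S t ∈ S ∧ ∀ᶠ s in 𝓝[>] (nextOn S t), s ∈ S := by
  set A := {s | t < s ∧ s ∈ S} with hA
  have hne : A.Nonempty := by obtain ⟨s, h1, h2⟩ := hon t; exact ⟨s, h1, h2⟩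
  have hbdd : BddBelow A := ⟨t, fun s hs ↦ hs.1.le⟩
  have hlt : t < nextOn S t := by
    obtain ⟨u, hu, hsub⟩ := mem_nhdsGT_iff_exists_Ioo_subset.1 hoff
    refine lt_of_lt_of_le hu (le_csInf hne fun s hs ↦ ?_)
    by_contra! hsu
    exact hsub ⟨hs.1, hsu⟩ hs.2
  have hsub : Ioo t (nextOn S t) ⊆ Sᶜ := by
    intro s hs hsS
    exact absurd (csInf_le hbdd ⟨hs.1, hsS⟩) (not_le.2 hs.2)
  have hpos := ht.trans_lt hlt
  have hon' : ∀ᶠ s in 𝓝[>] (nextOn S t), s ∈ S := by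
    refine (h.right _ hpos.le).resolve_right fun hoff' ↦ ?_
    have hin : nextOn S t ∈ S := by
      by_contra hnot
      obtain ⟨u, hu, hsub'⟩ := mem_nhdsGT_iff_exists_Ioo_subset.1 hoff'
      obtain ⟨s, hs, hsu⟩ := (csInf_lt_iff hbdd hne).1 (show sInf A < u from hu)
      have h1 : nextOn S t ≤ s := csInf_le hbdd hs
      rcases h1.eq_or_lt with heq | hlt
      · exact hnot (heq ▸ hs.2)
      · exact hsub' ⟨hlt, hsu⟩ hs.2
    rcases h.on_side _ hpos hin with h1 | h1
    · obtain ⟨s, h2, h3⟩ := (h1.and hoff').exists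
      exact h3 h2
    · have h2 : ∀ᶠ s in 𝓝[<] (nextOn S t), s ∈ Ioo t (nextOn S t) := Ioo_mem_nhdsLT hlt
      obtain ⟨s, h3, h4⟩ := (h1.and h2).exists
      exact hsub h4 h3
  refine ⟨hlt, hsub, ?_, hon'⟩
  by_contra hnot
  obtain ⟨s, h1, h2⟩ := (hon'.and (h.off_right _ hpos.le hnot)).exists
  exact h2 h1

theorem lt_nextOff (h : LocallyAlternating S) (hoff : ∀ N : ℝ, ∃ t, N < t ∧ t ∉ S) {t : ℝ}
    (ht : 0 ≤ t) (hon : ∀ᶠ s in 𝓝[>] t, s ∈ S) : t < nextOff S t := by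
  refine lt_of_le_of_ne (h.nextOff_spec hoff ht).1 fun heq ↦ ?_
  have := (h.nextOff_spec hoff ht).2.2
  rw [← heq] at this
  obtain ⟨s, h1, h2⟩ := (hon.and this).exists
  exact h2 h1

variable (h : LocallyAlternating S) (hon : ∀ N : ℝ, ∃ t, N < t ∧ t ∈ S)
  (hoff : ∀ N : ℝ, ∃ t, N < t ∧ t ∉ S)

include h hon hoff

theorem upCrossing_spec (n : ℕ) : 0 < upCrossing S n ∧ upCrossing S n ∈ S ∧
    ∀ᶠ s in 𝓝[>] (upCrossing S n), s ∈ S := by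
  induction n with
  | zero =>
    have h1 := h.nextOff_spec hoff le_rfl
    have h2 := h.nextOn_spec hon h1.1 h1.2.2
    exact ⟨h1.1.trans_lt h2.1, h2.2.2⟩
  | succ n ih =>
    have h1 := h.nextOff_spec hoff ih.1.le
    have h2 := h.nextOn_spec hon (ih.1.le.trans h1.1) h1.2.2
    exact ⟨(ih.1.trans_le h1.1).trans h2.1, h2.2.2⟩

theorem downCrossing_spec (n : ℕ) : upCrossing S n < downCrossing S n ∧
    Ioo (upCrossing S n) (downCrossing S n) ⊆ S ∧ downCrossing S n < upCrossing S (n + 1) ∧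
      Ioo (downCrossing S n) (upCrossing S (n + 1)) ⊆ Sᶜ := by
  have h0 := h.upCrossing_spec hon hoff n
  have h1 := h.nextOff_spec hoff h0.1.le
  have h2 := h.nextOn_spec hon (h0.1.le.trans h1.1) h1.2.2
  exact ⟨h.lt_nextOff hoff h0.1.le h0.2.2, h1.2.1, h2.1, h2.2.1⟩

theorem alternates : Alternates S := by
  have h1 := h.nextOff_spec hoff le_rfl
  have h2 := h.nextOn_spec hon h1.1 h1.2.2
  have hspec := h.downCrossing_spec hon hoff
  have hmono : StrictMono (upCrossing S) :=
    strictMono_nat_of_lt_succ fun n ↦ (hspec n).1.trans (hspec n).2.2.1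
  refine ⟨h1.1, h2.1, h1.2.1, h2.2.1, fun n ↦ (hspec n).1, fun n ↦ (hspec n).2.2.1,
    fun n ↦ (hspec n).2.1, fun n ↦ (hspec n).2.2.2, ?_⟩
  -- Otherwise the up-crossings accumulate at some `L` from the left. Midpoints of on intervals and
  -- midpoints of off intervals both tend to `L`, against the condition `left`.
  refine (tendsto_atTop_of_monotone hmono.monotone).resolve_right ?_
  rintro ⟨L, hL⟩
  have hlt : ∀ n, upCrossing S n < L := fun n ↦
    (hmono n.lt_succ_self).trans_le (hmono.monotone.ge_of_tendsto hL (n + 1))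
  have hL0 : 0 < L := (h.upCrossing_spec hon hoff 0).1.trans (hlt 0)
  have hL1 : Tendsto (fun n ↦ upCrossing S (n + 1)) atTop (𝓝 L) := hL.comp (tendsto_add_atTop_nat 1)
  have hlim : ∀ c : ℕ → ℝ, (∀ n, upCrossing S n < c n ∧ c n < upCrossing S (n + 1)) →
      Tendsto c atTop (𝓝[<] L) := fun c hc ↦ tendsto_nhdsWithin_iff.2
    ⟨tendsto_of_tendsto_of_tendsto_of_le_of_le hL hL1 (fun n ↦ (hc n).1.le) (fun n ↦ (hc n).2.le),
      Eventually.of_forall fun n ↦ (hc n).2.trans (hlt _)⟩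
  rcases h.left L hL0 with hl | hl
  · have := hlim (fun n ↦ (downCrossing S n + upCrossing S (n + 1)) / 2) fun n ↦ by
      constructor <;> linarith [(hspec n).1, (hspec n).2.2.1]
    obtain ⟨n, hn⟩ := (this.eventually hl).exists
    exact (hspec n).2.2.2 ⟨by linarith [(hspec n).2.2.1], by linarith [(hspec n).2.2.1]⟩ hn
  · have := hlim (fun n ↦ (upCrossing S n + downCrossing S n) / 2) fun n ↦ by
      constructor <;> linarith [(hspec n).1, (hspec n).2.2.1]
    obtain ⟨n, hn⟩ := (this.eventually hl).exists
    exact hn ((hspec n).2.1 ⟨by linarith [(hspec n).1], by linarith [(hspec n).1]⟩)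

theorem switches {x : Path} (hx : ∀ q : ℚ≥0, x q = true ↔ (q : ℝ) ∈ S) :
    Switches x (nextOff S 0) (upCrossing S) (downCrossing S) := by
  have halt := h.alternates hon hoff
  have hfalse : ∀ q : ℚ≥0, x q = false ↔ (q : ℝ) ∉ S := fun q ↦ by
    rw [← hx, Bool.not_eq_true]
  refine ⟨halt.initial_nonneg, halt.initial_lt, halt.up_lt_down, halt.down_lt_up, ?_, ?_, ?_, ?_, ?_⟩
  · intro q hq
    rw [hx]
    -- `initial_on` does not speak about time `0`; but if `0` were off, it would be followed by off
    -- times.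
    rcases (q.cast_nonneg (α := ℝ)).eq_or_lt with h0 | hpos
    · rw [← h0] at hq ⊢
      by_contra hnot
      have h2 : ∀ᶠ s in 𝓝[>] (0 : ℝ), s ∈ Ioo 0 (nextOff S 0) := Ioo_mem_nhdsGT hq
      obtain ⟨s, h3, h4⟩ := ((h.off_right 0 le_rfl hnot).and h2).exists
      exact h3 (halt.initial_on h4)
    · exact halt.initial_on ⟨hpos, hq⟩
  · intro q h1 h2
    exact (hfalse q).2 (halt.initial_off ⟨h1, h2⟩)
  · intro n q h1 h2
    rw [hx]
    rcases h1.eq_or_lt with heq | hlt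
    · rw [← heq]; exact (h.upCrossing_spec hon hoff n).2.1
    · exact halt.on n ⟨hlt, h2⟩
  · intro n q h1 h2
    exact (hfalse q).2 (halt.off n ⟨h1, h2⟩)
  · intro N
    exact (halt.tendsto.eventually_gt_atTop (N : ℝ)).exists

end LocallyAlternating

end

end SNRCrossing

/-! ### From the law of the cycles to alternating renewal processes -/

namespace SNRCrossing

noncomputable section

/-- The components of an i.i.d. sequence of independent pairs are independent. -/
theorem iIndepFun_components_infinitePi {μ ν : Measure ℝ} [IsProbabilityMeasure μ]
    [IsProbabilityMeasure ν] :
    iIndepFun (fun (p : ℕ × Bool) (z : ℕ → ℝ × ℝ) ↦ if p.2 then (z p.1).1 else (z p.1).2)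
      (Measure.infinitePi fun _ ↦ μ.prod ν) := by
  let X : ℕ → Bool → (ℕ → ℝ × ℝ) → ℝ := fun n b z ↦ if b then (z n).1 else (z n).2
  have hX : ∀ n b, Measurable (X n b) := fun n b ↦ by
    cases b
    · exact (measurable_pi_apply n).snd
    · exact (measurable_pi_apply n).fst
  have h1 : iIndepFun (fun n z ↦ (X n · z)) (Measure.infinitePi fun _ : ℕ ↦ μ.prod ν) :=
    iIndepFun_infinitePi (P := fun _ : ℕ ↦ μ.prod ν)
      (X := fun _ (y : ℝ × ℝ) (b : Bool) ↦ if b then y.1 else y.2) fun _ ↦ by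
        refine measurable_pi_lambda _ fun b ↦ ?_
        cases b <;> simp <;> fun_prop
  have h2 : ∀ n, iIndepFun (X n) (Measure.infinitePi fun _ : ℕ ↦ μ.prod ν) := fun n ↦ by
    have hind : IndepFun (X n true) (X n false) (Measure.infinitePi fun _ : ℕ ↦ μ.prod ν) := by
      have hf : Measurable fun z : ℕ → ℝ × ℝ ↦ z n := measurable_pi_apply n
      rw [indepFun_iff_map_prod_eq_prod_map_map (hX n true).aemeasurable (hX n false).aemeasurable]
      change Measure.map (fun z : ℕ → ℝ × ℝ ↦ z n) _ = (Measure.map (Prod.fst ∘ fun z : ℕ → ℝ × ℝ ↦ z n) _).prod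
        (Measure.map (Prod.snd ∘ fun z : ℕ → ℝ × ℝ ↦ z n) _)
      rw [← Measure.map_map measurable_fst hf, ← Measure.map_map measurable_snd hf,
        Measure.infinitePi_map_eval]
      simp
    rw [iIndepFun_iff_measure_inter_preimage_eq_mul]
    intro B t ht
    have hB : B = ∅ ∨ B = {true} ∨ B = {false} ∨ B = {true, false} := by
      clear ht; decide +revert
    rcases hB with rfl | rfl | rfl | rfl
    · simp
    · simp
    · simp
    · have hi : ⋂ i, X n i ⁻¹' t i = X n true ⁻¹' t true ∩ X n false ⁻¹' t false := iInf_bool_eq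
      simpa [hi] using hind.measure_inter_preimage_eq_mul _ _ (ht true (by simp)) (ht false (by simp))
  exact iIndepFun_uncurry' hX h1 h2

/-- The first and the second components of an i.i.d. sequence of independent pairs are independent
sequences. -/
theorem indepFun_fst_snd_infinitePi {μ ν : Measure ℝ} [IsProbabilityMeasure μ]
    [IsProbabilityMeasure ν] :
    IndepFun (fun (z : ℕ → ℝ × ℝ) n ↦ (z n).1) (fun z n ↦ (z n).2)
      (Measure.infinitePi fun _ ↦ μ.prod ν) := by
  let X : ℕ × Bool → (ℕ → ℝ × ℝ) → ℝ := fun p z ↦ if p.2 then (z p.1).1 else (z p.1).2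
  have hX : ∀ p, Measurable (X p) := by
    rintro ⟨n, b⟩
    cases b
    · exact (measurable_pi_apply n).snd
    · exact (measurable_pi_apply n).fst
  have h : iIndepFun X (Measure.infinitePi fun _ ↦ μ.prod ν) := iIndepFun_components_infinitePi
  have hle : ∀ p : ℕ × Bool, MeasurableSpace.comap (X p) inferInstance ≤
      (inferInstance : MeasurableSpace (ℕ → ℝ × ℝ)) := fun p ↦ (hX p).comap_le
  have hdisj : Disjoint {p : ℕ × Bool | p.2 = true} {p : ℕ × Bool | p.2 = false} := by
    rw [Set.disjoint_left]; rintro ⟨n, b⟩ h1 h2; simp_all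
  have hind := indep_iSup_of_disjoint hle h hdisj
  refine indep_of_indep_of_le_left (indep_of_indep_of_le_right hind ?_) ?_
  · rw [MeasurableSpace.pi, MeasurableSpace.comap_iSup]
    refine iSup_le fun n ↦ ?_
    rw [MeasurableSpace.comap_comp]
    exact le_iSup₂_of_le (n, false) rfl le_rfl
  · rw [MeasurableSpace.pi, MeasurableSpace.comap_iSup]
    refine iSup_le fun n ↦ ?_
    rw [MeasurableSpace.comap_comp]
    exact le_iSup₂_of_le (n, true) rfl le_rfl

variable {Ω : Type*} [MeasurableSpace Ω] {P : Measure Ω} [IsProbabilityMeasure P]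

/-- Apart from alternation, every clause concerns the joint law of the periods only, so it can be
checked on the product space. -/
theorem isAlternatingRenewal_of_hasLaw {S : Ω → Set ℝ} (hS : ∀ᵐ ω ∂P, Alternates (S ω))
    {F E : Measure ℝ} [IsProbabilityMeasure F] [IsProbabilityMeasure E]
    (h : HasLaw (fun ω n ↦ (onPeriod (S ω) n, offPeriod (S ω) n))
      (Measure.infinitePi fun _ ↦ F.prod E) P) :
    IsAlternatingRenewal P S ∧ (∀ n, HasLaw (fun ω ↦ onPeriod (S ω) n) F P) ∧
      ∀ n, HasLaw (fun ω ↦ offPeriod (S ω) n) E P := by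
  have hn : ∀ n, HasLaw (fun ω ↦ (onPeriod (S ω) n, offPeriod (S ω) n)) (F.prod E) P := fun n ↦
    HasLaw.comp (Y := fun z : ℕ → ℝ × ℝ ↦ z n) ⟨(measurable_pi_apply n).aemeasurable,
      Measure.infinitePi_map_eval (fun _ : ℕ ↦ F.prod E) n⟩ h
  have hF : ∀ n, HasLaw (fun ω ↦ onPeriod (S ω) n) F P := fun n ↦
    HasLaw.comp (Y := Prod.fst) ⟨measurable_fst.aemeasurable, by simp⟩ (hn n)
  have hE : ∀ n, HasLaw (fun ω ↦ offPeriod (S ω) n) E P := fun n ↦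
    HasLaw.comp (Y := Prod.snd) ⟨measurable_snd.aemeasurable, by simp⟩ (hn n)
  have hpair : iIndepFun (fun n ω ↦ (onPeriod (S ω) n, offPeriod (S ω) n)) P :=
    (iIndepFun_iff_map_fun_eq_infinitePi_map₀ h.aemeasurable).2 (by
      rw [h.map_eq]; simp_rw [(hn _).map_eq])
  refine ⟨⟨hS, fun n ↦ (hF n).identDistrib (hF 0), fun n ↦ (hE n).identDistrib (hE 0),
    hpair.comp (fun _ ↦ Prod.fst) fun _ ↦ measurable_fst,
    hpair.comp (fun _ ↦ Prod.snd) fun _ ↦ measurable_snd, ?_⟩, hF, hE⟩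
  have h1 : Measurable fun (z : ℕ → ℝ × ℝ) n ↦ (z n).1 := by fun_prop
  have h2 : Measurable fun (z : ℕ → ℝ × ℝ) n ↦ (z n).2 := by fun_prop
  have key := indepFun_fst_snd_infinitePi (μ := F) (ν := E)
  have hm1 : AEMeasurable (fun ω n ↦ onPeriod (S ω) n) P := h1.comp_aemeasurable h.aemeasurable
  have hm2 : AEMeasurable (fun ω n ↦ offPeriod (S ω) n) P := h2.comp_aemeasurable h.aemeasurable
  rw [← h.map_eq, indepFun_iff_map_prod_eq_prod_map_map h1.aemeasurable h2.aemeasurable,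
    AEMeasurable.map_map_of_aemeasurable (h1.prodMk h2).aemeasurable h.aemeasurable,
    AEMeasurable.map_map_of_aemeasurable h1.aemeasurable h.aemeasurable,
    AEMeasurable.map_map_of_aemeasurable h2.aemeasurable h.aemeasurable] at key
  exact (indepFun_iff_map_prod_eq_prod_map_map hm1 hm2).2 key

/-! ### Random sets of times that start afresh from every time off -/

/-- A random set of times `S` that starts afresh from every time which is not in `S`: `H g` is the
probability of being off a time `g` later, and it is constant from `D` on. -/
structure IsRegenerativeSet (P : Measure Ω) (S : Ω → Set ℝ) (H : ℝ → ℝ) (D : ℝ) : Prop where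
  nullMeasurable : ∀ t, 0 ≤ t → NullMeasurableSet {ω | t ∈ S ω} P
  pos : P {ω | 0 ∉ S ω} ≠ 0
  step : ∀ (F : Finset ℝ) (s g : ℝ), (∀ f ∈ F, 0 ≤ f ∧ f ≤ s) → 0 ≤ s → 0 ≤ g →
    P {ω | ∀ t ∈ insert (s + g) (insert s F), t ∉ S ω} =
      P {ω | ∀ t ∈ insert s F, t ∉ S ω} * ENNReal.ofReal (H g)
  locallyAlternating : ∀ᵐ ω ∂P, LocallyAlternating (S ω)
  length_pos : 0 < D
  far : ∀ t, D ≤ t → P {ω | t ∉ S ω} = ENNReal.ofReal (H D)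
  eq_of_le : ∀ t, D ≤ t → H t = H D
  lt_one : H D < 1
  limit_pos : 0 < H D

namespace IsRegenerativeSet

variable {S : Ω → Set ℝ} {H : ℝ → ℝ} {D : ℝ}

/-- All gaps are at least `D`, so regeneration gives the same factor `H D` each time: off events at
positive multiples of `D` are independent trials. -/
theorem measure_grid (h : IsRegenerativeSet P S H D) (F : Finset ℕ) :
    P {ω | ∀ k ∈ F, ((k : ℝ) + 1) * D ∉ S ω} = ENNReal.ofReal (H D) ^ F.card := by
  have hD := h.length_pos
  induction F using Finset.induction_on_max with
  | empty => simp
  | insert m G hG ih =>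
    have hm : m ∉ G := fun hm ↦ (hG m hm).false
    rw [Finset.card_insert_of_notMem hm]
    rcases G.eq_empty_or_nonempty with rfl | hne
    · simp only [insert_empty_eq, Finset.mem_singleton, forall_eq, Finset.card_empty, zero_add,
        pow_one]
      refine h.far _ ?_
      have : (0 : ℝ) ≤ m := m.cast_nonneg
      nlinarith
    · set j := G.max' hne with hj
      have hjG : j ∈ G := G.max'_mem hne
      have hjm : (j : ℝ) + 1 ≤ m := by exact_mod_cast hG j hjG
      have hj0 : (0 : ℝ) ≤ j := j.cast_nonneg
      have hstep := h.step (G.image fun k : ℕ ↦ ((k : ℝ) + 1) * D) (((j : ℝ) + 1) * D)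
        (((m : ℝ) - j) * D) (fun f hf ↦ by
          obtain ⟨k, hk, rfl⟩ := Finset.mem_image.1 hf
          have : (k : ℝ) ≤ j := by exact_mod_cast G.le_max' k hk
          constructor
          · positivity
          · gcongr) (by positivity) (mul_nonneg (by linarith) hD.le)
      have heq : ((j : ℝ) + 1) * D + ((m : ℝ) - j) * D = ((m : ℝ) + 1) * D := by ring
      rw [h.eq_of_le _ (by nlinarith), heq,
        Finset.insert_eq_self.2 (Finset.mem_image_of_mem (fun k : ℕ ↦ ((k : ℝ) + 1) * D) hjG)] at hstep
      simp only [Finset.mem_insert, Finset.mem_image, forall_eq_or_imp, forall_exists_index,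
        and_imp, forall_apply_eq_imp_iff₂] at hstep ⊢
      rw [hstep, ih, pow_succ]

omit [IsProbabilityMeasure P] in
-- Covering events are only null measurable; Borel–Cantelli and the law of the path are applied to
-- measurable versions.
theorem exists_modification (h : IsRegenerativeSet P S H D) {t : ℝ} (ht : 0 ≤ t) :
    ∃ E : Set Ω, MeasurableSet E ∧ ∀ᵐ ω ∂P, ω ∈ E ↔ t ∈ S ω := by
  obtain ⟨E, -, hE, heq⟩ := (h.nullMeasurable t ht).exists_measurable_superset_ae_eq
  exact ⟨E, hE, heq.mem_iff⟩

/-- The second Borel–Cantelli lemma for the independent trials at the multiples of `D`, with `H D >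
0`. -/
theorem ae_off_unbounded (h : IsRegenerativeSet P S H D) :
    ∀ᵐ ω ∂P, ∀ N : ℝ, ∃ t, N < t ∧ t ∉ S ω := by
  have hD := h.length_pos
  choose E hE hES using fun k : ℕ ↦ h.exists_modification (t := ((k : ℝ) + 1) * D) (by positivity)
  have hall := ae_all_iff.2 hES
  have hcap : ∀ F : Finset ℕ, P (⋂ k ∈ F, (E k)ᶜ) = ENNReal.ofReal (H D) ^ F.card := fun F ↦ by
    rw [← h.measure_grid F]
    refine measure_congr ?_
    filter_upwards [hall] with ω hω
    refine eq_iff_iff.2 ?_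
    change ω ∈ (⋂ k ∈ F, (E k)ᶜ) ↔ ∀ k ∈ F, ((k : ℝ) + 1) * D ∉ S ω
    simp [hω]
  have hone : ∀ k, P (E k)ᶜ = ENNReal.ofReal (H D) := fun k ↦ by simpa using hcap {k}
  have hind : iIndepSet (fun k ↦ (E k)ᶜ) P :=
    (iIndepSet_iff_meas_biInter fun k ↦ (hE k).compl).2 fun F ↦ by simp [hcap, hone]
  have hlim := measure_limsup_eq_one (fun k ↦ (hE k).compl) hind (by
    simp only [hone]
    exact ENNReal.tsum_const_eq_top_of_ne_zero (by simpa using h.limit_pos))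
  have hlim' : ∀ᵐ ω ∂P, ω ∈ limsup (fun k ↦ (E k)ᶜ) atTop :=
    (mem_ae_iff_prob_eq_one (by measurability)).2 hlim
  filter_upwards [hall, hlim'] with ω h1 h2 N
  rw [Filter.mem_limsup_iff_frequently_mem] at h2
  obtain ⟨n, hn⟩ := exists_nat_gt (N / D)
  obtain ⟨k, hk, hkE⟩ := (Filter.frequently_atTop.1 h2) n
  refine ⟨((k : ℝ) + 1) * D, ?_, fun hS ↦ hkE ((h1 k).2 hS)⟩
  rw [div_lt_iff₀ hD] at hn
  have : (n : ℝ) ≤ k := by exact_mod_cast hk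
  nlinarith

/-- `n` consecutive multiples of `D` are all off with probability `H D ^ n`, which tends to `0`. -/
theorem ae_on_unbounded (h : IsRegenerativeSet P S H D) :
    ∀ᵐ ω ∂P, ∀ N : ℝ, ∃ t, N < t ∧ t ∈ S ω := by
  have hD := h.length_pos
  have key : ∀ K : ℕ, P {ω | ∀ k ≥ K, ((k : ℝ) + 1) * D ∉ S ω} = 0 := fun K ↦ by
    refine le_antisymm (ge_of_tendsto (ENNReal.tendsto_pow_atTop_nhds_zero_of_lt_one
      (r := ENNReal.ofReal (H D)) (by simpa using h.lt_one)) (.of_forall fun n ↦ ?_)) zero_le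
    have := h.measure_grid (Finset.Ico K (K + n))
    rw [Nat.card_Ico, Nat.add_sub_cancel_left] at this
    rw [← this]
    exact measure_mono fun ω hω k hk ↦ hω k (Finset.mem_Ico.1 hk).1
  have key' : ∀ᵐ ω ∂P, ∀ K : ℕ, ¬ ∀ k ≥ K, ((k : ℝ) + 1) * D ∉ S ω := ae_all_iff.2 fun K ↦ by
    rw [ae_iff]; simpa using key K
  filter_upwards [key'] with ω hω N
  obtain ⟨n, hn⟩ := exists_nat_gt (N / D)
  have h2 := hω n
  push Not at h2
  obtain ⟨k, hk, hkS⟩ := h2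
  refine ⟨_, ?_, hkS⟩
  rw [div_lt_iff₀ hD] at hn
  have : (n : ℝ) ≤ k := by exact_mod_cast hk
  nlinarith

theorem ae_alternates (h : IsRegenerativeSet P S H D) : ∀ᵐ ω ∂P, Alternates (S ω) := by
  filter_upwards [h.locallyAlternating, h.ae_on_unbounded, h.ae_off_unbounded] with ω h1 h2 h3
  exact h1.alternates h2 h3

omit [IsProbabilityMeasure P] in
/-- The path of a random set of times on the nonnegative rationals. -/
theorem exists_path (h : IsRegenerativeSet P S H D) : ∃ X : Ω → Path, Measurable X ∧
    ∀ᵐ ω ∂P, ∀ q : ℚ≥0, X ω q = true ↔ (q : ℝ) ∈ S ω := by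
  classical
  choose E hE hES using fun q : ℚ≥0 ↦ h.exists_modification (t := q) q.cast_nonneg
  refine ⟨fun ω q ↦ decide (ω ∈ E q), measurable_pi_lambda _ fun q ↦ ?_, ?_⟩
  · refine measurable_to_bool ?_
    convert hE q using 1
    ext; simp
  · filter_upwards [ae_all_iff.2 hES] with ω hω q
    simpa using hω q

/-- The on and off periods of a random set that starts afresh from every time off. -/
theorem exists_hasLaw (h : IsRegenerativeSet P S H D) {a : ℝ}
    (hrate : HasRate (fun q ↦ ENNReal.ofReal (H q)) a) : ∃ κ : Measure Path,
      IsProbabilityMeasure κ ∧ Regenerative κ (fun q ↦ ENNReal.ofReal (H q)) ∧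
      HasLaw (fun ω n ↦ (onPeriod (S ω) n, offPeriod (S ω) n)) (Measure.infinitePi fun _ ↦
        ((startOff κ).map fun x ↦ (cycle x 0).1).prod (expMeasure a)) P := by
  obtain ⟨X, hX, hXS⟩ := h.exists_path
  have hsw : ∀ᵐ ω ∂P, Switches (X ω) (nextOff (S ω) 0) (upCrossing (S ω)) (downCrossing (S ω)) := by
    filter_upwards [h.locallyAlternating, h.ae_on_unbounded, h.ae_off_unbounded, hXS]
      with ω h1 h2 h3 h4
    exact h1.switches h2 h3 h4
  have hoff : ∀ F : Finset ℚ≥0, P.map X (offOn F) =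
      P {ω | ∀ t ∈ F.image ((↑) : ℚ≥0 → ℝ), t ∉ S ω} := fun F ↦ by
    rw [Measure.map_apply hX (measurableSet_offOn F)]
    refine measure_congr ?_
    filter_upwards [hXS] with ω hω
    refine eq_iff_iff.2 ?_
    change (∀ q ∈ F, X ω q = false) ↔ ∀ t ∈ F.image ((↑) : ℚ≥0 → ℝ), t ∉ S ω
    simp [← hω]
  have hreg : Regenerative (P.map X) fun q ↦ ENNReal.ofReal (H q) := by
    refine ⟨?_, fun F s g hF ↦ ?_, ?_⟩
    · have := hoff {0}
      simp only [offOn, Finset.mem_singleton, forall_eq, Finset.image_singleton,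
        NNRat.cast_zero] at this
      rw [this]
      exact h.pos
    · rw [hoff, hoff, Finset.image_insert, Finset.image_insert, NNRat.cast_add]
      refine h.step _ _ _ (fun f hf ↦ ?_) s.cast_nonneg g.cast_nonneg
      obtain ⟨q, hq, rfl⟩ := Finset.mem_image.1 hf
      exact ⟨q.cast_nonneg, by exact_mod_cast hF q hq⟩
    · rw [ae_map_iff hX.aemeasurable measurableSet_good]
      filter_upwards [hsw] with ω hω using hω.good
  have hprob : IsProbabilityMeasure (P.map X) := Measure.isProbabilityMeasure_map hX.aemeasurable
  refine ⟨P.map X, hprob, hreg, ?_⟩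
  have hcyc : HasLaw (fun ω ↦ cycle (X ω)) (Measure.infinitePi fun _ ↦
      ((startOff (P.map X)).map fun x ↦ (cycle x 0).1).prod (expMeasure a)) P :=
    ⟨(measurable_cycle.comp hX).aemeasurable, by
      rw [← hreg.map_cycle hrate, Measure.map_map measurable_cycle hX]; rfl⟩
  refine hcyc.congr ?_
  filter_upwards [hsw] with ω hω
  funext n
  simp only [cycle, hω.up_eq, hω.down_eq]
  rfl

end IsRegenerativeSet

end

end SNRCrossing

namespace SNRCrossing

noncomputable section

/-! ### The service law -/

/-- The tail of the service law. -/
def serviceTail (r v z : ℝ) : ℝ := √(1 - (v * z / (2 * r)) ^ 2)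

theorem continuous_serviceTail (r v : ℝ) : Continuous (serviceTail r v) := by
  unfold serviceTail; fun_prop

theorem serviceTail_nonneg (r v z : ℝ) : 0 ≤ serviceTail r v z := Real.sqrt_nonneg _

theorem serviceTail_zero (r v : ℝ) : serviceTail r v 0 = 1 := by simp [serviceTail]

variable {r v : ℝ}

theorem serviceTail_eq_zero (hr : 0 < r) (hv : 0 < v) {z : ℝ} (hz : 2 * r / v ≤ z) :
    serviceTail r v z = 0 := by
  refine Real.sqrt_eq_zero_of_nonpos ?_
  have : 1 ≤ v * z / (2 * r) := by
    rw [div_le_iff₀ hv] at hz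
    rw [le_div_iff₀ (by positivity)]; linarith
  nlinarith

theorem serviceTail_eq (hr : 0 < r) (z : ℝ) :
    serviceTail r v z = √(4 * r ^ 2 - v ^ 2 * z ^ 2) / (2 * r) := by
  have h : 1 - (v * z / (2 * r)) ^ 2 = (4 * r ^ 2 - v ^ 2 * z ^ 2) / (2 * r) ^ 2 := by
    field_simp; ring
  rw [serviceTail, h, Real.sqrt_div' _ (by positivity), Real.sqrt_sq (by positivity)]

theorem hasDerivAt_neg_serviceTail (hr : 0 < r) (hv : 0 < v) {z : ℝ} (hz : z ∈ Ioo 0 (2 * r / v)) :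
    HasDerivAt (fun s ↦ -serviceTail r v s) (serviceDensity r v z) z := by
  have hpos : 0 < 4 * r ^ 2 - v ^ 2 * z ^ 2 := by
    have := hz.2
    rw [lt_div_iff₀ hv] at this
    have h2 : 0 ≤ z * v := mul_nonneg hz.1.le hv.le
    nlinarith
  have h1 : HasDerivAt (fun s ↦ 4 * r ^ 2 - v ^ 2 * s ^ 2) (-(v ^ 2 * (2 * z))) z := by
    simpa using ((hasDerivAt_pow 2 z).const_mul (v ^ 2)).const_sub (4 * r ^ 2)
  have h2 := ((h1.sqrt hpos.ne').div_const (2 * r)).neg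
  simp_rw [serviceTail_eq hr]
  refine h2.congr_deriv ?_
  rw [show serviceDensity r v z = v ^ 2 * z / (2 * r * √(4 * r ^ 2 - v ^ 2 * z ^ 2)) from
    if_pos (Ioo_subset_Icc_self hz)]
  have := Real.sqrt_pos.2 hpos
  field_simp

theorem serviceDensity_nonneg (hr : 0 < r) (s : ℝ) : 0 ≤ serviceDensity r v s := by
  unfold serviceDensity
  split_ifs with h
  · have := h.1; positivity
  · exact le_rfl

theorem measurable_serviceDensity (r v : ℝ) : Measurable (serviceDensity r v) := by
  unfold serviceDensity
  exact Measurable.ite measurableSet_Icc (by fun_prop) measurable_const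

theorem serviceLaw_Ioi (hr : 0 < r) (hv : 0 < v) {z : ℝ} (hz : 0 ≤ z) :
    serviceLaw r v (Ioi z) = ENNReal.ofReal (serviceTail r v z) := by
  rw [serviceLaw, withDensity_apply _ measurableSet_Ioi]
  rcases le_or_gt (2 * r / v) z with h | h
  · rw [serviceTail_eq_zero hr hv h, ENNReal.ofReal_zero, setLIntegral_eq_zero_iff measurableSet_Ioi
      (measurable_serviceDensity r v).ennreal_ofReal]
    refine .of_forall fun s hs ↦ ?_
    have : s ∉ Icc 0 (2 * r / v) := fun hs' ↦ absurd hs'.2 (not_le.2 (h.trans_lt hs))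
    simp [serviceDensity, this]
  · have hderiv : ∀ s ∈ Ioo z (2 * r / v),
        HasDerivAt (fun s ↦ -serviceTail r v s) (serviceDensity r v s) s := fun s hs ↦
      hasDerivAt_neg_serviceTail hr hv ⟨hz.trans_lt hs.1, hs.2⟩
    have hcont : ContinuousOn (fun s ↦ -serviceTail r v s) (Icc z (2 * r / v)) :=
      (continuous_serviceTail r v).neg.continuousOn
    -- The density is unbounded near `2 r / v`. Integrability follows from its sign and from the
    -- continuity of the tail up to the endpoint.
    have hint := intervalIntegral.integrableOn_deriv_of_nonneg hcont hderiv fun s _ ↦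
      serviceDensity_nonneg hr s
    have hval := intervalIntegral.integral_eq_sub_of_hasDerivAt_of_le h.le hcont hderiv
      ((intervalIntegrable_iff_integrableOn_Ioc_of_le h.le).2 hint)
    have hsplit : ∫⁻ s in Ioi z, ENNReal.ofReal (serviceDensity r v s) =
        ∫⁻ s in Ioc z (2 * r / v), ENNReal.ofReal (serviceDensity r v s) := by
      rw [← lintegral_indicator measurableSet_Ioi, ← lintegral_indicator measurableSet_Ioc]
      congr 1
      funext s
      by_cases hs : s ∈ Ioc z (2 * r / v)
      · rw [indicator_of_mem hs, indicator_of_mem (show s ∈ Ioi z from hs.1)]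
      · rw [indicator_of_notMem hs]
        by_cases hs' : s ∈ Ioi z
        · have : s ∉ Icc 0 (2 * r / v) := fun h ↦ hs ⟨hs', h.2⟩
          rw [indicator_of_mem hs', serviceDensity, if_neg this, ENNReal.ofReal_zero]
        · rw [indicator_of_notMem hs']
    rw [hsplit, ← ofReal_integral_eq_lintegral_ofReal hint
      (.of_forall fun s ↦ serviceDensity_nonneg hr s), ← intervalIntegral.integral_of_le h.le, hval,
      serviceTail_eq_zero hr hv le_rfl]
    simp

theorem serviceLaw_Iic_zero (r v : ℝ) : serviceLaw r v (Iic 0) = 0 := by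
  rw [serviceLaw, withDensity_apply _ measurableSet_Iic, setLIntegral_eq_zero_iff measurableSet_Iic
      (measurable_serviceDensity r v).ennreal_ofReal]
  refine .of_forall fun s (hs : s ≤ 0) ↦ ?_
  unfold serviceDensity
  split_ifs with h
  · simp [le_antisymm hs h.1]
  · simp

theorem isProbabilityMeasure_serviceLaw (hr : 0 < r) (hv : 0 < v) :
    IsProbabilityMeasure (serviceLaw r v) := by
  refine ⟨?_⟩
  rw [← Iic_union_Ioi (a := (0 : ℝ)), measure_union (Iic_disjoint_Ioi le_rfl) measurableSet_Ioi,
    serviceLaw_Iic_zero, serviceLaw_Ioi hr hv le_rfl, serviceTail_zero]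
  simp

theorem ae_serviceLaw (hr : 0 < r) (hv : 0 < v) : ∀ᵐ s ∂serviceLaw r v, s ∈ Ioc 0 (2 * r / v) := by
  have h1 : ∀ᵐ s ∂serviceLaw r v, s ∉ Iic 0 := measure_eq_zero_iff_ae_notMem.1 (serviceLaw_Iic_zero r v)
  have h2 : ∀ᵐ s ∂serviceLaw r v, s ∉ Ioi (2 * r / v) := measure_eq_zero_iff_ae_notMem.1 (by
    rw [serviceLaw_Ioi hr hv (by positivity), serviceTail_eq_zero hr hv le_rfl, ENNReal.ofReal_zero])
  filter_upwards [h1, h2] with s h3 h4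
  exact ⟨not_le.1 h3, not_lt.1 h4⟩

theorem lintegral_serviceTail (r v : ℝ) {t : ℝ} (ht : 0 ≤ t) :
    ∫⁻ z in Ioc 0 t, ENNReal.ofReal (serviceTail r v z) =
      ENNReal.ofReal (∫ z in 0..t, serviceTail r v z) := by
  rw [intervalIntegral.integral_of_le ht, ofReal_integral_eq_lintegral_ofReal
    ((continuous_serviceTail r v).integrableOn_Ioc) (.of_forall fun z ↦ serviceTail_nonneg r v z)]

theorem integral_serviceTail_of_le (hr : 0 < r) (hv : 0 < v) {t : ℝ} (ht : 2 * r / v ≤ t) :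
    ∫ z in 0..t, serviceTail r v z = ∫ z in 0..2 * r / v, serviceTail r v z := by
  have h := (continuous_serviceTail r v)
  rw [← intervalIntegral.integral_add_adjacent_intervals (h.intervalIntegrable 0 (2 * r / v))
    (h.intervalIntegrable _ t), add_eq_left, intervalIntegral.integral_of_le ht]
  exact setIntegral_eq_zero_of_forall_eq_zero fun z hz ↦ serviceTail_eq_zero hr hv hz.1.le

theorem integral_serviceTail_pos (r v : ℝ) {t : ℝ} (ht : 0 < t) :
    0 < ∫ z in 0..t, serviceTail r v z := by
  refine intervalIntegral.integral_pos ht (continuous_serviceTail r v).continuousOn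
    (fun z _ ↦ serviceTail_nonneg r v z) ⟨0, ⟨le_rfl, ht.le⟩, ?_⟩
  rw [serviceTail_zero]; exact one_pos

theorem integral_serviceTail_mono (r v : ℝ) {s t : ℝ} (hst : s ≤ t) :
    ∫ z in 0..s, serviceTail r v z ≤ ∫ z in 0..t, serviceTail r v z := by
  have h := (continuous_serviceTail r v)
  rw [← intervalIntegral.integral_add_adjacent_intervals (h.intervalIntegrable 0 s)
    (h.intervalIntegrable _ t)]
  have := intervalIntegral.integral_nonneg hst (μ := volume) fun z _ ↦ serviceTail_nonneg r v z
  linarith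

theorem integral_serviceTail_le (hr : 0 < r) (hv : 0 < v) (t : ℝ) :
    ∫ z in 0..t, serviceTail r v z ≤ ∫ z in 0..2 * r / v, serviceTail r v z := by
  rcases le_total t (2 * r / v) with h | h
  · exact integral_serviceTail_mono r v h
  · exact (integral_serviceTail_of_le hr hv h).le

theorem lintegral_serviceLaw (hr : 0 < r) (hv : 0 < v) :
    ∫⁻ s, ENNReal.ofReal s ∂serviceLaw r v =
      ENNReal.ofReal (∫ z in 0..2 * r / v, serviceTail r v z) := by
  have hD : 0 < 2 * r / v := by positivity
  rw [lintegral_eq_lintegral_meas_lt _ ((ae_serviceLaw hr hv).mono fun s hs ↦ hs.1.le)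
    aemeasurable_id, ← lintegral_serviceTail r v hD.le]
  have h1 : ∀ t ∈ Ioi (0 : ℝ), serviceLaw r v {a | t < a} = ENNReal.ofReal (serviceTail r v t) :=
    fun t ht ↦ serviceLaw_Ioi hr hv (le_of_lt ht)
  rw [setLIntegral_congr_fun measurableSet_Ioi h1, ← Ioc_union_Ioi_eq_Ioi hD.le,
    lintegral_union measurableSet_Ioi Ioc_disjoint_Ioi_same,
    (setLIntegral_eq_zero_iff measurableSet_Ioi
      (continuous_serviceTail r v).measurable.ennreal_ofReal).2, add_zero]
  exact .of_forall fun z (hz : _ < z) ↦ by simp [serviceTail_eq_zero hr hv hz.le]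

theorem load_serviceLaw (hr : 0 < r) (hv : 0 < v) (a : ℝ) :
    load a (serviceLaw r v) = a * ∫ z in 0..2 * r / v, serviceTail r v z := by
  rw [load, integral_eq_lintegral_of_nonneg_ae ((ae_serviceLaw hr hv).mono fun s hs ↦ hs.1.le)
    aestronglyMeasurable_id, lintegral_serviceLaw hr hv, ENNReal.toReal_ofReal]
  exact (integral_serviceTail_pos r v (by positivity)).le

/-- The mean service time in the load cancels the normalisation of the forward recurrence law. For
`a = 2 r v λ` this turns the distribution function of the summands into `(1 - offProb) / ν`. -/
theorem load_mul_forwardRecurrence (hr : 0 < r) (hv : 0 < v) (a : ℝ) {u : ℝ} (hu : 0 ≤ u) :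
    load a (serviceLaw r v) * (forwardRecurrence (serviceLaw r v)).real (Iic u) =
      a * ∫ z in 0..u, serviceTail r v z := by
  have hm := integral_serviceTail_pos r v (t := 2 * r / v) (by positivity)
  have h1 : ∀ t ∈ Ioc (0 : ℝ) u, serviceLaw r v (Ioi t) = ENNReal.ofReal (serviceTail r v t) :=
    fun t ht ↦ serviceLaw_Ioi hr hv ht.1.le
  have h2 : forwardRecurrence (serviceLaw r v) (Iic u) =
      (ENNReal.ofReal (∫ z in 0..2 * r / v, serviceTail r v z))⁻¹ *
        ENNReal.ofReal (∫ z in 0..u, serviceTail r v z) := by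
    rw [forwardRecurrence, lintegral_serviceLaw hr hv, Measure.smul_apply, smul_eq_mul,
      withDensity_apply _ measurableSet_Iic, Measure.restrict_restrict measurableSet_Iic,
      Iic_inter_Ici, setLIntegral_congr Ioc_ae_eq_Icc.symm, setLIntegral_congr_fun measurableSet_Ioc h1,
      lintegral_serviceTail r v hu]
  rw [load_serviceLaw hr hv, Measure.real, h2, ENNReal.toReal_mul, ENNReal.toReal_inv,
    ENNReal.toReal_ofReal hm.le, ENNReal.toReal_ofReal
      (intervalIntegral.integral_nonneg hu fun z _ ↦ serviceTail_nonneg r v z)]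
  field_simp

/-- The probability of being off a time `t` after a time off. -/
def offProb (r v lam t : ℝ) : ℝ :=
  Real.exp (-(2 * r * v * lam * ∫ z in 0..max t 0, serviceTail r v z))

variable {lam : ℝ}

theorem continuous_offProb (r v lam : ℝ) : Continuous (offProb r v lam) := by
  have := intervalIntegral.continuous_primitive (μ := volume)
    (fun a b ↦ (continuous_serviceTail r v).intervalIntegrable a b) 0
  unfold offProb
  have h : Continuous fun t : ℝ ↦ ∫ z in 0..max t 0, serviceTail r v z :=
    this.comp (continuous_id.max continuous_const)
  fun_prop

theorem offProb_zero (r v lam : ℝ) : offProb r v lam 0 = 1 := by simp [offProb]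

theorem offProb_of_nonneg {t : ℝ} (ht : 0 ≤ t) :
    offProb r v lam t = Real.exp (-(2 * r * v * lam * ∫ z in 0..t, serviceTail r v z)) := by
  rw [offProb, max_eq_left ht]

/-- The truncation `max t 0` in `offProb` makes this hold at negative times too. -/
theorem offProb_le_one (hr : 0 < r) (hv : 0 < v) (hlam : 0 < lam) (t : ℝ) :
    offProb r v lam t ≤ 1 := by
  have := intervalIntegral.integral_nonneg (le_max_right t 0) (μ := volume)
    fun z _ ↦ serviceTail_nonneg r v z
  rw [offProb, Real.exp_le_one_iff, neg_nonpos]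
  positivity

theorem offProb_eq_of_le (hr : 0 < r) (hv : 0 < v) {t : ℝ} (ht : 2 * r / v ≤ t) :
    offProb r v lam t = offProb r v lam (2 * r / v) := by
  have hD : 0 ≤ 2 * r / v := by positivity
  rw [offProb_of_nonneg (hD.trans ht), offProb_of_nonneg hD, integral_serviceTail_of_le hr hv ht]

theorem offProb_lt_one (hr : 0 < r) (hv : 0 < v) (hlam : 0 < lam) :
    offProb r v lam (2 * r / v) < 1 := by
  have hD : 0 < 2 * r / v := by positivity
  have := integral_serviceTail_pos r v hD
  rw [offProb_of_nonneg hD.le, Real.exp_lt_one_iff, neg_lt_zero]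
  positivity

theorem le_offProb (hr : 0 < r) (hv : 0 < v) (hlam : 0 < lam) (t : ℝ) :
    offProb r v lam (2 * r / v) ≤ offProb r v lam t := by
  have hD : 0 ≤ 2 * r / v := by positivity
  rw [offProb_of_nonneg hD, offProb]
  gcongr
  exact integral_serviceTail_le hr hv _

theorem busyProb_serviceLaw (hr : 0 < r) (hv : 0 < v) (lam : ℝ) :
    busyProb (2 * r * v * lam) (serviceLaw r v) = 1 - offProb r v lam (2 * r / v) := by
  rw [busyProb, load_serviceLaw hr hv, offProb_of_nonneg (by positivity)]

/-- The tail equals `1` at `0`, so its integral over `[0, s / 2 ^ m]` is `s / 2 ^ m` to first order.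
-/
theorem hasRate_offProb (hr : 0 < r) (hv : 0 < v) (hlam : 0 < lam) :
    HasRate (fun q ↦ ENNReal.ofReal (offProb r v lam q)) (2 * r * v * lam) := by
  refine ⟨by positivity, fun s ↦ ?_⟩
  have hd : HasDerivAt (fun t ↦ ∫ z in 0..t, serviceTail r v z) 1 0 := by
    have h := continuous_serviceTail r v
    have := intervalIntegral.integral_hasDerivAt_right (h.intervalIntegrable 0 0)
      (h.stronglyMeasurableAtFilter _ _) h.continuousAt
    rwa [serviceTail_zero] at this
  have key : Tendsto (fun m : ℕ ↦ (2 : ℝ) ^ m * ∫ z in 0..(s : ℝ) / 2 ^ m, serviceTail r v z) atTop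
      (𝓝 s) := by
    rcases eq_or_ne s 0 with rfl | hs
    · simp
    have hs' : (0 : ℝ) < s := by exact_mod_cast pos_iff_ne_zero.2 hs
    have h1 := hasDerivAt_iff_tendsto_slope_zero.1 hd
    have h2 : Tendsto (fun m : ℕ ↦ (s : ℝ) / 2 ^ m) atTop (𝓝[≠] 0) := by
      refine tendsto_nhdsWithin_iff.2 ⟨?_, .of_forall fun m ↦ ?_⟩
      · exact tendsto_const_nhds.div_atTop (tendsto_pow_atTop_atTop_of_one_lt one_lt_two)
      · have : (0 : ℝ) < s / 2 ^ m := by positivity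
        exact this.ne'
    have h3 := (h1.comp h2).const_mul (s : ℝ)
    rw [mul_one] at h3
    refine h3.congr fun m ↦ ?_
    simp only [Function.comp_apply, zero_add, intervalIntegral.integral_same, sub_zero, smul_eq_mul]
    field_simp
  have h4 := (ENNReal.continuous_ofReal.tendsto _).comp ((Real.continuous_exp.tendsto _).comp
    ((key.const_mul (2 * r * v * lam)).neg))
  refine h4.congr fun m ↦ ?_
  simp only [Function.comp_apply]
  rw [offProb_of_nonneg (by positivity), ← ENNReal.ofReal_pow (Real.exp_nonneg _), ← Real.exp_nat_mul]
  congr 2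
  push_cast
  ring

end

end SNRCrossing

namespace SNRCrossing

noncomputable section

/-! ### Unions of intervals -/

namespace LocallyAlternating

theorem eventually_right (t a : ℝ) : (∀ᶠ s in 𝓝[>] t, s < a) ∨ ∀ᶠ s in 𝓝[>] t, a < s := by
  rcases lt_or_ge t a with h | h
  · exact .inl (nhdsWithin_le_nhds (Iio_mem_nhds h))
  · exact .inr (eventually_mem_nhdsWithin.mono fun s hs ↦ h.trans_lt hs)

theorem eventually_left (t a : ℝ) : (∀ᶠ s in 𝓝[<] t, s < a) ∨ ∀ᶠ s in 𝓝[<] t, a < s := by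
  rcases lt_or_ge a t with h | h
  · exact .inr (nhdsWithin_le_nhds (Ioi_mem_nhds h))
  · exact .inl (eventually_mem_nhdsWithin.mono fun s hs ↦ lt_of_lt_of_le hs h)

/-- Nondegeneracy is essential: a single positive time would violate `on_side`. -/
theorem Icc {a b : ℝ} (hab : a < b) : LocallyAlternating (Icc a b) where
  right t _ := by
    rcases eventually_right t a with h | h
    · exact .inr (h.mono fun s hs hs' ↦ absurd hs'.1 (not_le.2 hs))
    rcases eventually_right t b with h' | h'
    · exact .inl (h.mp (h'.mono fun s h1 h2 ↦ ⟨h2.le, h1.le⟩))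
    · exact .inr (h'.mono fun s hs hs' ↦ absurd hs'.2 (not_le.2 hs))
  left t _ := by
    rcases eventually_left t a with h | h
    · exact .inr (h.mono fun s hs hs' ↦ absurd hs'.1 (not_le.2 hs))
    rcases eventually_left t b with h' | h'
    · exact .inl (h.mp (h'.mono fun s h1 h2 ↦ ⟨h2.le, h1.le⟩))
    · exact .inr (h'.mono fun s hs hs' ↦ absurd hs'.2 (not_le.2 hs))
  off_right t _ ht := nhdsWithin_le_nhds (isClosed_Icc.isOpen_compl.mem_nhds ht)
  on_side t _ ht := by
    rcases lt_or_ge t b with h | h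
    · refine .inl ?_
      filter_upwards [self_mem_nhdsWithin, nhdsWithin_le_nhds (Iio_mem_nhds h)] with s hs hs'
      exact ⟨ht.1.trans (le_of_lt hs), le_of_lt hs'⟩
    · refine .inr ?_
      filter_upwards [self_mem_nhdsWithin, nhdsWithin_le_nhds (Ioi_mem_nhds (hab.trans_le h))]
        with s hs hs'
      exact ⟨le_of_lt hs', (le_of_lt hs).trans ht.2⟩

theorem Ico {a b : ℝ} (hab : a < b) : LocallyAlternating (Ico a b) where
  right t ht := ((Icc hab).right t ht).imp (fun h ↦ by
    rcases eventually_right t b with h' | h'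
    · exact h.mp (h'.mono fun s h1 h2 ↦ ⟨h2.1, h1⟩)
    · obtain ⟨s, h1, h2⟩ := (h.and h').exists
      exact absurd h1.2 (not_le.2 h2)) fun h ↦ h.mono fun s hs hs' ↦ hs (Ico_subset_Icc_self hs')
  left t ht := ((Icc hab).left t ht).imp (fun h ↦ by
    rcases eventually_left t b with h' | h'
    · exact h.mp (h'.mono fun s h1 h2 ↦ ⟨h2.1, h1⟩)
    · obtain ⟨s, h1, h2⟩ := (h.and h').exists
      exact absurd h1.2 (not_le.2 h2)) fun h ↦ h.mono fun s hs hs' ↦ hs (Ico_subset_Icc_self hs')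
  off_right t _ ht := by
    rcases lt_or_ge t a with h | h
    · exact nhdsWithin_le_nhds ((eventually_lt_nhds h).mono fun s hs hs' ↦ absurd hs'.1 (not_le.2 hs))
    · have hb : b ≤ t := by by_contra! h'; exact ht ⟨h, h'⟩
      exact eventually_mem_nhdsWithin.mono fun s hs hs' ↦
        absurd (hb.trans_lt hs) (not_lt.2 hs'.2.le)
  on_side t _ ht := by
    refine .inl ?_
    filter_upwards [self_mem_nhdsWithin, nhdsWithin_le_nhds (Iio_mem_nhds ht.2)] with s hs hs'
    exact ⟨ht.1.trans (le_of_lt hs), hs'⟩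

theorem empty : LocallyAlternating ∅ where
  right _ _ := .inr (.of_forall fun _ ↦ id)
  left _ _ := .inr (.of_forall fun _ ↦ id)
  off_right _ _ _ := .of_forall fun _ ↦ id
  on_side _ _ h := h.elim

theorem union {S T : Set ℝ} (hS : LocallyAlternating S) (hT : LocallyAlternating T) :
    LocallyAlternating (S ∪ T) where
  right t ht := by
    rcases hS.right t ht with h | h
    · exact .inl (h.mono fun s ↦ .inl)
    rcases hT.right t ht with h' | h'
    · exact .inl (h'.mono fun s ↦ .inr)
    · exact .inr ((h.and h').mono fun s hs hs' ↦ hs'.elim hs.1 hs.2)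
  left t ht := by
    rcases hS.left t ht with h | h
    · exact .inl (h.mono fun s ↦ .inl)
    rcases hT.left t ht with h' | h'
    · exact .inl (h'.mono fun s ↦ .inr)
    · exact .inr ((h.and h').mono fun s hs hs' ↦ hs'.elim hs.1 hs.2)
  off_right t ht hn := by
    filter_upwards [hS.off_right t ht fun h ↦ hn (.inl h), hT.off_right t ht fun h ↦ hn (.inr h)]
      with s h1 h2 h3 using h3.elim h1 h2
  on_side t ht h := by
    rcases h with h | h
    · exact (hS.on_side t ht h).imp (fun h ↦ h.mono fun s ↦ .inl) fun h ↦ h.mono fun s ↦ .inl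
    · exact (hT.on_side t ht h).imp (fun h ↦ h.mono fun s ↦ .inr) fun h ↦ h.mono fun s ↦ .inr

theorem biUnion {ι : Type*} {J : Set ι} (hJ : J.Finite) {S : ι → Set ℝ}
    (hS : ∀ i ∈ J, LocallyAlternating (S i)) : LocallyAlternating (⋃ i ∈ J, S i) := by
  induction J, hJ using Set.Finite.induction_on with
  | empty => simpa using empty
  | insert _ _ ih =>
    rw [biUnion_insert]
    exact (hS _ (mem_insert _ _)).union (ih fun i hi ↦ hS i (mem_insert_of_mem _ hi))

/-- All four conditions are local in time. This reduces an infinite union to finitely many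
intervals. -/
theorem of_forall_lt {S : Set ℝ} (h : ∀ T : ℝ, ∃ S', LocallyAlternating S' ∧
    ∀ t, 0 ≤ t → t < T → (t ∈ S ↔ t ∈ S')) : LocallyAlternating S where
  right t ht := by
    obtain ⟨S', h1, h2⟩ := h (t + 1)
    have h3 : ∀ᶠ s in 𝓝[>] t, (s ∈ S ↔ s ∈ S') := by
      filter_upwards [self_mem_nhdsWithin, nhdsWithin_le_nhds (Iio_mem_nhds (lt_add_one t))]
        with s hs hs' using h2 s (ht.trans (le_of_lt hs)) hs'
    exact (h1.right t ht).imp (fun h ↦ h.mp (h3.mono fun s hs ↦ hs.2))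
      fun h ↦ h.mp (h3.mono fun s hs ↦ mt hs.1)
  left t ht := by
    obtain ⟨S', h1, h2⟩ := h (t + 1)
    have h3 : ∀ᶠ s in 𝓝[<] t, (s ∈ S ↔ s ∈ S') := by
      filter_upwards [self_mem_nhdsWithin, nhdsWithin_le_nhds (Ioi_mem_nhds ht)]
        with s hs hs' using h2 s (le_of_lt hs') (lt_trans hs (lt_add_one t))
    exact (h1.left t ht).imp (fun h ↦ h.mp (h3.mono fun s hs ↦ hs.2))
      fun h ↦ h.mp (h3.mono fun s hs ↦ mt hs.1)
  off_right t ht hn := by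
    obtain ⟨S', h1, h2⟩ := h (t + 1)
    filter_upwards [self_mem_nhdsWithin, nhdsWithin_le_nhds (Iio_mem_nhds (lt_add_one t)),
      h1.off_right t ht (mt (h2 t ht (lt_add_one t)).2 hn)]
      with s hs hs' h3 using mt (h2 s (ht.trans (le_of_lt hs)) hs').1 h3
  on_side t ht hn := by
    obtain ⟨S', h1, h2⟩ := h (t + 1)
    refine (h1.on_side t ht ((h2 t ht.le (lt_add_one t)).1 hn)).imp (fun h ↦ ?_) fun h ↦ ?_
    · filter_upwards [self_mem_nhdsWithin, nhdsWithin_le_nhds (Iio_mem_nhds (lt_add_one t)), h]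
        with s hs hs' h3 using (h2 s (ht.le.trans (le_of_lt hs)) hs').2 h3
    · filter_upwards [self_mem_nhdsWithin, nhdsWithin_le_nhds (Ioi_mem_nhds ht), h]
        with s hs hs' h3 using (h2 s (le_of_lt hs') (lt_trans hs (lt_add_one t))).2 h3

end LocallyAlternating

end

end SNRCrossing

namespace SNRCrossing

noncomputable section

/-! ### The coverage discs -/

theorem coverageRadius_pos {p w β γ : ℝ} (hp : 0 < p) (hw : 0 < w) (hγ : 0 < γ) :
    0 < coverageRadius p w β γ := Real.rpow_pos_of_pos (by positivity) _

/-- The inequality is solved in `[0, ∞]`, so the distances `0` and `∞` need no separate treatment.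
-/
theorem le_snr_iff {p w β γ : ℝ} (hp : 0 < p) (hw : 0 < w) (hβ : 0 < β) (hγ : 0 < γ)
    (nodes : Set Plane) (x : Plane) : ENNReal.ofReal γ ≤ snr p w β nodes x ↔
      Metric.infEDist x nodes ≤ ENNReal.ofReal (coverageRadius p w β γ) := by
  have hp' : ENNReal.ofReal p ≠ 0 := by simpa using hp
  have hw' : ENNReal.ofReal w ≠ 0 := by simpa using hw
  have hwγ : ENNReal.ofReal γ * ENNReal.ofReal w ≠ 0 := mul_ne_zero (by simpa using hγ) hw'
  have hr : ENNReal.ofReal (coverageRadius p w β γ) =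
      (ENNReal.ofReal p / (ENNReal.ofReal γ * ENNReal.ofReal w)) ^ β⁻¹ := by
    rw [coverageRadius, one_div, ← ENNReal.ofReal_rpow_of_nonneg (by positivity) (by positivity),
      ENNReal.ofReal_div_of_pos (by positivity), ENNReal.ofReal_mul hw.le, mul_comm]
  rw [snr, ENNReal.rpow_neg, ← div_eq_mul_inv,
    ENNReal.le_div_iff_mul_le (.inl hw') (.inl ENNReal.ofReal_ne_top),
    ENNReal.le_div_iff_mul_le (.inr hp') (.inr ENNReal.ofReal_ne_top), hr, ENNReal.le_rpow_inv_iff hβ,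
    ENNReal.le_div_iff_mul_le (.inl hwγ) (.inl (by finiteness)), mul_comm]

theorem infEDist_le_iff {nodes : Set Plane} (h : ∀ A, Bornology.IsBounded A → (nodes ∩ A).Finite)
    (x : Plane) {r : ℝ} (hr : 0 ≤ r) : Metric.infEDist x nodes ≤ ENNReal.ofReal r ↔
      (nodes ∩ Metric.closedBall x r).Nonempty := by
  constructor
  · intro hle
    by_contra hne
    rw [not_nonempty_iff_eq_empty] at hne
    have hfar : ∀ y ∈ nodes, ENNReal.ofReal r < edist x y := fun y hy ↦ by
      rw [edist_dist, ENNReal.ofReal_lt_ofReal_iff_of_nonneg hr, dist_comm]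
      by_contra! hd
      exact (hne ▸ (⟨hy, hd⟩ : y ∈ nodes ∩ Metric.closedBall x r) : y ∈ (∅ : Set Plane))
    have hlt : Metric.infEDist x nodes < ENNReal.ofReal (r + 1) :=
      hle.trans_lt (ENNReal.ofReal_lt_ofReal_iff_of_nonneg hr |>.2 (lt_add_one r))
    obtain ⟨y₀, hy₀, hlt₀⟩ := Metric.infEDist_lt_iff.1 hlt
    have hfin := h (Metric.closedBall x (r + 1)) Metric.isBounded_closedBall
    have hmem : ∀ y ∈ nodes, edist x y < ENNReal.ofReal (r + 1) →
        y ∈ nodes ∩ Metric.closedBall x (r + 1) := fun y hy hd ↦ by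
      rw [edist_dist, ENNReal.ofReal_lt_ofReal_iff (by positivity), dist_comm] at hd
      exact ⟨hy, hd.le⟩
    -- Local finiteness: a closest node exists among the finitely many within distance `r + 1`, and
    -- the other nodes are no closer. So the distance is attained and exceeds `r`.
    obtain ⟨m, hm, hmin⟩ := Set.exists_min_image _ (fun y ↦ edist x y) hfin ⟨y₀, hmem y₀ hy₀ hlt₀⟩
    refine absurd hle (not_le.2 ((hfar m hm.1).trans_le (Metric.le_infEDist.2 fun y hy ↦ ?_)))
    rcases lt_or_ge (edist x y) (ENNReal.ofReal (r + 1)) with h1 | h1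
    · exact hmin y (hmem y hy h1)
    · exact ((hmin y₀ (hmem y₀ hy₀ hlt₀)).trans hlt₀.le).trans h1
  · rintro ⟨y, hy, hd⟩
    refine (Metric.infEDist_le_edist_of_mem hy).trans ?_
    rw [edist_dist, dist_comm]
    exact ENNReal.ofReal_le_ofReal hd

/-- The locations from which a node covers the user at time `t`. -/
def disc (r v : ℝ) (e : Plane) (t : ℝ) : Set Plane := Metric.closedBall (position v e t) r

theorem mem_coveredTimes_iff {Ω : Type*} {Φ : Ω → Set Plane} {p w β v γ : ℝ} (hp : 0 < p)
    (hw : 0 < w) (hβ : 0 < β) (hγ : 0 < γ) {ω : Ω}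
    (h : ∀ A, Bornology.IsBounded A → (Φ ω ∩ A).Finite) (e : Plane) (t : ℝ) :
    t ∈ coveredTimes Φ p w β v γ e ω ↔
      (Φ ω ∩ disc (coverageRadius p w β γ) v e t).Nonempty := by
  rw [disc, ← infEDist_le_iff h _ (coverageRadius_pos hp hw hγ).le, ← le_snr_iff hp hw hβ hγ]
  simp [coveredTimes, levelCrossing]

/-- The ball of radius `r` around `x` is convex: containing the user at times `f` and `t`, it
contains the user in between. This is why the past before an off time `s` is irrelevant to coverage
after `s`. -/
theorem disc_inter_subset (r v : ℝ) (e : Plane) {f s t : ℝ} (hfs : f ≤ s) (hst : s ≤ t) :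
    disc r v e f ∩ disc r v e t ⊆ disc r v e s := by
  rintro x ⟨hf, ht⟩
  rw [disc, Metric.mem_closedBall'] at hf ht ⊢
  rw [← Metric.mem_closedBall] at hf ht ⊢
  rcases hfs.eq_or_lt with rfl | hlt
  · exact hf
  have hpos : 0 < t - f := by linarith
  have h1 : 0 ≤ (t - s) / (t - f) := div_nonneg (by linarith) hpos.le
  have h2 : 0 ≤ (s - f) / (t - f) := div_nonneg (by linarith) hpos.le
  have h := (convex_closedBall x r) hf ht h1 h2 (by field_simp; ring)
  convert h using 1
  simp only [position, smul_smul, ← add_smul]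
  congr 1
  field_simp
  ring

theorem measurableSet_disc (r v : ℝ) (e : Plane) (t : ℝ) : MeasurableSet (disc r v e t) :=
  measurableSet_closedBall

theorem isBounded_disc (r v : ℝ) (e : Plane) (t : ℝ) : Bornology.IsBounded (disc r v e t) :=
  Metric.isBounded_closedBall

/-- Cartesian coordinates whose first axis is the direction of motion. -/
theorem exists_coordinates {e : Plane} (he : ‖e‖ = 1) : ∃ T : Plane → ℝ × ℝ,
    MeasurePreserving T volume volume ∧ ∀ x, (T x).1 = inner ℝ e x ∧
      ∀ t : ℝ, ‖x - t • e‖ ^ 2 = ((T x).1 - t) ^ 2 + (T x).2 ^ 2 := by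
  have hon : Orthonormal ℝ (({0} : Set (Fin 2)).domRestrict (fun _ ↦ e)) :=
    ⟨fun _ ↦ he, fun i j hij ↦ (hij (Subsingleton.elim i j)).elim⟩
  obtain ⟨b, hb⟩ := hon.exists_orthonormalBasis_extension_of_card_eq (by simp)
  have hb0 : b 0 = e := hb 0 rfl
  refine ⟨fun x ↦ (b.repr x 0, b.repr x 1), ?_, fun x ↦ ⟨?_, fun t ↦ ?_⟩⟩
  · exact (volume_preserving_finTwoArrow ℝ).comp
      ((PiLp.volume_preserving_ofLp (Fin 2)).comp b.measurePreserving_repr)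
  · change b.repr x 0 = _
    rw [b.repr_apply_apply, hb0]
  · rw [← b.repr.norm_map, EuclideanSpace.norm_sq_eq, Fin.sum_univ_two, map_sub, map_smul, ← hb0,
      b.repr_self]
    simp

/-- An interval of length `2 √(r² - y²)` is translated by `δ` and the original is removed; what is
left has length `δ`, but at most the whole length. -/
theorem volume_slice_crescent {r δ c : ℝ} (hδ : 0 ≤ δ) (y : ℝ) :
    volume {x : ℝ | (x - (c + δ)) ^ 2 + y ^ 2 ≤ r ^ 2 ∧ r ^ 2 < (x - c) ^ 2 + y ^ 2} =
      ENNReal.ofReal (min δ (2 * √(r ^ 2 - y ^ 2))) := by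
  rcases lt_or_ge (r ^ 2) (y ^ 2) with h | h
  · have : {x : ℝ | (x - (c + δ)) ^ 2 + y ^ 2 ≤ r ^ 2 ∧ r ^ 2 < (x - c) ^ 2 + y ^ 2} = ∅ := by
      ext x
      simp only [mem_ofPred_eq, mem_empty_iff_false, iff_false, not_and]
      intro h1
      nlinarith [sq_nonneg (x - (c + δ))]
    rw [this, Real.sqrt_eq_zero_of_nonpos (by linarith), measure_empty, mul_zero, min_eq_right hδ,
      ENNReal.ofReal_zero]
  set l := √(r ^ 2 - y ^ 2) with hl
  have hl0 : 0 ≤ l := Real.sqrt_nonneg _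
  have h1 : ∀ x a : ℝ, (x - a) ^ 2 + y ^ 2 ≤ r ^ 2 ↔ a - l ≤ x ∧ x ≤ a + l := fun x a ↦ by
    rw [← le_sub_iff_add_le, Real.sq_le (by linarith), ← hl]
    constructor <;> rintro ⟨h1, h2⟩ <;> constructor <;> linarith
  simp only [← not_le, h1]
  rcases le_total δ (2 * l) with hle | hle
  · have : {x : ℝ | (c + δ - l ≤ x ∧ x ≤ c + δ + l) ∧ ¬(c - l ≤ x ∧ x ≤ c + l)} =
        Ioc (c + l) (c + δ + l) := by
      ext x
      simp only [mem_ofPred_eq, mem_Ioc, not_and, not_le]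
      constructor
      · rintro ⟨⟨h2, h3⟩, h4⟩; exact ⟨h4 (by linarith), h3⟩
      · rintro ⟨h2, h3⟩; exact ⟨⟨by linarith, h3⟩, fun _ ↦ h2⟩
    rw [this, Real.volume_Ioc, min_eq_left hle]
    congr 1; ring
  · have : (Ioc (c + δ - l) (c + δ + l) : Set ℝ) =ᵐ[volume]
        {x : ℝ | (c + δ - l ≤ x ∧ x ≤ c + δ + l) ∧ ¬(c - l ≤ x ∧ x ≤ c + l)} := by
      have hne : ∀ᵐ x : ℝ, x ≠ c + δ - l := by simp [ae_iff]
      filter_upwards [hne] with x hx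
      refine eq_iff_iff.2 ?_
      change (c + δ - l < x ∧ x ≤ c + δ + l) ↔
        ((c + δ - l ≤ x ∧ x ≤ c + δ + l) ∧ ¬(c - l ≤ x ∧ x ≤ c + l))
      constructor
      · rintro ⟨h2, h3⟩; exact ⟨⟨h2.le, h3⟩, fun h4 ↦ by linarith [h4.2]⟩
      · rintro ⟨⟨h2, h3⟩, -⟩; exact ⟨lt_of_le_of_ne h2 hx.symm, h3⟩
    rw [← measure_congr this, Real.volume_Ioc, min_eq_right hle]
    congr 1; ring

/-- At height `y` the crescent has length `min (g v) (2 √(r² - y²))`, which is `v` times the measure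
of the `z ∈ (0, g)` for which the chord at height `y` takes longer than `z` to traverse. The region
`R` of these pairs `(z, y)` is then sliced the other way: for given `z` the heights form an interval
of length `2 r ℙ(W > z)`. -/
theorem volume_crescent {r v : ℝ} (hr : 0 < r) (hv : 0 < v) {e : Plane} (he : ‖e‖ = 1) (s : ℝ)
    {g : ℝ} (hg : 0 ≤ g) : volume (disc r v e (s + g) \ disc r v e s) =
      ENNReal.ofReal (2 * r * v * ∫ z in 0..g, serviceTail r v z) := by
  obtain ⟨T, hT, hTx⟩ := exists_coordinates he
  have hdisc : ∀ t x, x ∈ disc r v e t ↔ ((T x).1 - t * v) ^ 2 + (T x).2 ^ 2 ≤ r ^ 2 := fun t x ↦ by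
    rw [← (hTx x).2, disc, Metric.mem_closedBall, dist_eq_norm, position,
      sq_le_sq₀ (norm_nonneg _) hr.le]
  let C : Set (ℝ × ℝ) := {z | (z.1 - (s * v + g * v)) ^ 2 + z.2 ^ 2 ≤ r ^ 2 ∧
    r ^ 2 < (z.1 - s * v) ^ 2 + z.2 ^ 2}
  have hC : MeasurableSet C := by
    have h : ∀ a : ℝ, Measurable fun z : ℝ × ℝ ↦ (z.1 - a) ^ 2 + z.2 ^ 2 := fun a ↦ by fun_prop
    exact (measurableSet_le (h _) measurable_const).inter (measurableSet_lt measurable_const (h _))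
  let R : Set (ℝ × ℝ) := {z | (0 < z.1 ∧ z.1 < g) ∧ z.2 ^ 2 < r ^ 2 - (v * z.1 / 2) ^ 2}
  have hR : MeasurableSet R := by
    have h1 : Measurable fun z : ℝ × ℝ ↦ z.2 ^ 2 := by fun_prop
    have h2 : Measurable fun z : ℝ × ℝ ↦ r ^ 2 - (v * z.1 / 2) ^ 2 := by fun_prop
    exact ((measurableSet_lt measurable_const measurable_fst).inter
      (measurableSet_lt measurable_fst measurable_const)).inter (measurableSet_lt h1 h2)
  have hslice : ∀ y : ℝ, volume ((fun z : ℝ ↦ (z, y)) ⁻¹' R) =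
      ENNReal.ofReal (min g (2 * √(r ^ 2 - y ^ 2) / v)) := fun y ↦ by
    have : (fun z : ℝ ↦ (z, y)) ⁻¹' R = Ioo 0 (min g (2 * √(r ^ 2 - y ^ 2) / v)) := by
      ext z
      simp only [R, mem_preimage, mem_ofPred_eq, mem_Ioo, lt_min_iff, and_assoc]
      refine and_congr_right fun hz ↦ and_congr_right fun _ ↦ ?_
      rw [lt_div_iff₀ hv, ← div_lt_iff₀' two_pos, Real.lt_sqrt (by positivity), mul_comm z v]
      constructor <;> intro h <;> linarith
    rw [this, Real.volume_Ioo, sub_zero]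
  have hslice' : ∀ z : ℝ, volume (Prod.mk z ⁻¹' R) = (Ioo 0 g).indicator
      (fun z ↦ ENNReal.ofReal (2 * r) * ENNReal.ofReal (serviceTail r v z)) z := fun z ↦ by
    by_cases hz : z ∈ Ioo 0 g
    · have : Prod.mk z ⁻¹' R = Ioo (-√(r ^ 2 - (v * z / 2) ^ 2)) √(r ^ 2 - (v * z / 2) ^ 2) := by
        ext y
        simp only [R, mem_preimage, mem_ofPred_eq, Real.sq_lt, mem_Ioo]
        exact ⟨fun h ↦ h.2, fun h ↦ ⟨hz, h⟩⟩
      have h2 : √(r ^ 2 - (v * z / 2) ^ 2) = r * serviceTail r v z := by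
        have : r ^ 2 - (v * z / 2) ^ 2 = r ^ 2 * (1 - (v * z / (2 * r)) ^ 2) := by field_simp
        rw [this, Real.sqrt_mul (by positivity), Real.sqrt_sq hr.le, serviceTail]
      rw [indicator_of_mem hz, this, Real.volume_Ioo, h2, ← ENNReal.ofReal_mul (by positivity)]
      congr 1; ring
    · have : Prod.mk z ⁻¹' R = ∅ := by
        ext y; exact ⟨fun h ↦ hz h.1, fun h ↦ h.elim⟩
      rw [indicator_of_notMem hz, this, measure_empty]
  have hvolR : volume R = ENNReal.ofReal (2 * r * ∫ z in 0..g, serviceTail r v z) := by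
    rw [Measure.volume_eq_prod, Measure.prod_apply hR]
    simp_rw [hslice']
    rw [lintegral_indicator measurableSet_Ioo, lintegral_const_mul' _ _ ENNReal.ofReal_ne_top,
      setLIntegral_congr Ioo_ae_eq_Ioc, lintegral_serviceTail r v hg,
      ← ENNReal.ofReal_mul (by positivity)]
  have hCR : volume C = ENNReal.ofReal v * volume R := by
    rw [Measure.volume_eq_prod, Measure.prod_apply_symm hC, Measure.prod_apply_symm hR,
      ← lintegral_const_mul' _ _ ENNReal.ofReal_ne_top]
    refine lintegral_congr fun y ↦ ?_
    rw [hslice, ← ENNReal.ofReal_mul hv.le, mul_min_of_nonneg _ _ hv.le, mul_div_cancel₀ _ hv.ne',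
      mul_comm v g]
    exact volume_slice_crescent (by positivity) y
  have hpre : disc r v e (s + g) \ disc r v e s = T ⁻¹' C := by
    ext x
    rw [Set.mem_sdiff, hdisc, hdisc, not_le, add_mul]
    rfl
  rw [hpre, hT.measure_preimage hC.nullMeasurableSet, hCR, hvolR, ← ENNReal.ofReal_mul hv.le]
  congr 1; ring

theorem volume_real_disc {r : ℝ} (hr : 0 ≤ r) (v : ℝ) (e : Plane) (t : ℝ) :
    volume.real (disc r v e t) = Real.pi * r ^ 2 := by
  rw [Measure.real, disc, EuclideanSpace.volume_closedBall_fin_two, ENNReal.toReal_mul,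
    ENNReal.toReal_pow, ENNReal.toReal_ofReal hr, ENNReal.toReal_ofReal Real.pi_nonneg, mul_comm]

theorem volume_real_crescent {r v : ℝ} (hr : 0 < r) (hv : 0 < v) {e : Plane} (he : ‖e‖ = 1) (s : ℝ)
    {g : ℝ} (hg : 0 ≤ g) : volume.real (disc r v e (s + g) \ disc r v e s) =
      2 * r * v * ∫ z in 0..g, serviceTail r v z := by
  have := intervalIntegral.integral_nonneg hg (μ := volume) fun z _ ↦ serviceTail_nonneg r v z
  rw [Measure.real, volume_crescent hr hv he s hg, ENNReal.toReal_ofReal (by positivity)]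

/-- After a displacement of `4 r` the two discs are disjoint and the crescent is a full disc, while
the integral no longer grows beyond `2 r / v`. -/
theorem volume_real_disc_eq_integral {r v : ℝ} (hr : 0 < r) (hv : 0 < v) {e : Plane}
    (he : ‖e‖ = 1) (t : ℝ) :
    volume.real (disc r v e t) = 2 * r * v * ∫ z in 0..2 * r / v, serviceTail r v z := by
  have hD : 0 < 2 * r / v := by positivity
  have hle : 2 * r / v ≤ 4 * r / v := by gcongr; norm_num
  rw [← integral_serviceTail_of_le hr hv hle, ← volume_real_crescent hr hv he 0 (hD.le.trans hle),
    volume_real_disc hr.le, ← volume_real_disc hr.le v e (0 + 4 * r / v), Disjoint.sdiff_eq_left]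
  rw [Set.disjoint_left]
  intro x h1 h2
  rw [disc, Metric.mem_closedBall] at h1 h2
  have h3 := dist_triangle_left (position v e (0 + 4 * r / v)) (position v e 0) x
  have h4 : dist (position v e (0 + 4 * r / v)) (position v e 0) = 4 * r := by
    rw [dist_eq_norm, position, position, ← sub_smul, norm_smul, he]
    have : (0 + 4 * r / v) * v - 0 * v = 4 * r := by field_simp; ring
    rw [this, Real.norm_eq_abs, abs_of_pos (by positivity), mul_one]
  linarith

end

end SNRCrossing

namespace SNRCrossing

noncomputable section

variable {Ω : Type*} [MeasurableSpace Ω] {P : Measure Ω} [IsProbabilityMeasure P]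
  {Φ : Ω → Set Plane} {lam : ℝ}

/-! ### The SNR level crossing process -/

namespace IsPoissonProcess

omit [IsProbabilityMeasure P] in
-- Local finiteness is needed, because `ncard` is `0` on infinite sets.
theorem void_ae_eq (hΦ : IsPoissonProcess P Φ lam) {A : Set Plane} (hb : Bornology.IsBounded A) :
    {ω | Φ ω ∩ A = ∅} =ᵐ[P] (fun ω ↦ (Φ ω ∩ A).ncard) ⁻¹' {0} := by
  filter_upwards [hΦ.locallyFinite] with ω hω
  refine eq_iff_iff.2 ?_
  change Φ ω ∩ A = ∅ ↔ (Φ ω ∩ A).ncard = 0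
  rw [Set.ncard_eq_zero (hω A hb)]

omit [IsProbabilityMeasure P] in
theorem nullMeasurableSet_void (hΦ : IsPoissonProcess P Φ lam) {A : Set Plane}
    (hA : MeasurableSet A) (hb : Bornology.IsBounded A) :
    NullMeasurableSet {ω | Φ ω ∩ A = ∅} P :=
  ((hΦ.law_count A hA hb).aemeasurable.nullMeasurable (measurableSet_singleton 0)).congr
    (hΦ.void_ae_eq hb).symm

omit [IsProbabilityMeasure P] in
theorem measure_void (hΦ : IsPoissonProcess P Φ lam) (hlam : 0 < lam) {A : Set Plane}
    (hA : MeasurableSet A) (hb : Bornology.IsBounded A) :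
    P {ω | Φ ω ∩ A = ∅} = ENNReal.ofReal (Real.exp (-(lam * volume.real A))) := by
  have hlaw := hΦ.law_count A hA hb
  rw [measure_congr (hΦ.void_ae_eq hb), ← Measure.map_apply_of_aemeasurable hlaw.aemeasurable
    (measurableSet_singleton 0), hlaw.map_eq, poissonMeasure_singleton, Real.coe_toNNReal]
  · simp
  · positivity

/-- The bounded pieces of a null set are void with probability `exp 0 = 1`. -/
theorem ae_void (hΦ : IsPoissonProcess P Φ lam) (hlam : 0 < lam) {A : Set Plane}
    (hA : MeasurableSet A) (h0 : volume A = 0) : ∀ᵐ ω ∂P, ∀ x ∈ Φ ω, x ∉ A := by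
  have h : ∀ᵐ ω ∂P, ∀ n : ℕ, Φ ω ∩ (A ∩ Metric.closedBall 0 n) = ∅ := ae_all_iff.2 fun n ↦ by
    have hm : MeasurableSet (A ∩ Metric.closedBall (0 : Plane) n) :=
      hA.inter measurableSet_closedBall
    have hb : Bornology.IsBounded (A ∩ Metric.closedBall (0 : Plane) n) :=
      Metric.isBounded_closedBall.subset inter_subset_right
    have h1 := hΦ.measure_void hlam hm hb
    rw [Measure.real, measure_mono_null inter_subset_left h0] at h1
    refine (mem_ae_iff_prob_eq_one₀ (hΦ.nullMeasurableSet_void hm hb)).2 ?_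
    simpa using h1
  filter_upwards [h] with ω hω x hx hxA
  obtain ⟨n, hn⟩ := exists_nat_ge ‖x‖
  have : x ∈ Φ ω ∩ (A ∩ Metric.closedBall 0 n) := ⟨hx, hxA, by simpa using hn⟩
  rw [hω n] at this
  exact this

/-- Each node covers the user during a closed time interval or never. The interval is a single point
only if the node lies on one of the two lines at distance `r` from the path, a null set; and only
finitely many nodes matter in bounded time. -/
theorem ae_locallyAlternating (hΦ : IsPoissonProcess P Φ lam) (hlam : 0 < lam) {r v : ℝ}
    (hr : 0 < r) (hv : 0 < v) {e : Plane} (he : ‖e‖ = 1) :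
    ∀ᵐ ω ∂P, LocallyAlternating {t | (Φ ω ∩ disc r v e t).Nonempty} := by
  obtain ⟨T, hT, hTx⟩ := exists_coordinates he
  have hdisc : ∀ t x, x ∈ disc r v e t ↔ ((T x).1 - t * v) ^ 2 + (T x).2 ^ 2 ≤ r ^ 2 := fun t x ↦ by
    rw [← (hTx x).2, disc, Metric.mem_closedBall, dist_eq_norm, position,
      sq_le_sq₀ (norm_nonneg _) hr.le]
  have hline : MeasurableSet ((univ : Set ℝ) ×ˢ ({r, -r} : Set ℝ)) :=
    MeasurableSet.univ.prod (by measurability)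
  have hline0 : volume ((univ : Set ℝ) ×ˢ ({r, -r} : Set ℝ)) = 0 := by
    rw [Measure.volume_eq_prod, Measure.prod_prod,
      (Set.Finite.measure_zero (Set.toFinite ({r, -r} : Set ℝ)) volume), mul_zero]
  have htan := hΦ.ae_void hlam (hT.measurable hline)
    (by rw [hT.measure_preimage hline.nullMeasurableSet, hline0])
  filter_upwards [htan, hΦ.locallyFinite] with ω h1 h2
  refine LocallyAlternating.of_forall_lt fun N ↦
    ⟨⋃ x ∈ Φ ω ∩ Metric.closedBall 0 (r + N * v), {t | x ∈ disc r v e t},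
      LocallyAlternating.biUnion (h2 _ Metric.isBounded_closedBall) fun x hx ↦ ?_, fun t ht0 htN ↦ ?_⟩
  · simp only [hdisc]
    have hne := h1 x hx.1
    simp only [mem_preimage, Set.mem_prod, mem_univ, true_and, mem_insert_iff, mem_singleton_iff,
      ← sq_eq_sq_iff_eq_or_eq_neg] at hne
    rcases lt_or_gt_of_ne hne with hlt | hgt
    · have hpos : 0 < √(r ^ 2 - (T x).2 ^ 2) := Real.sqrt_pos.2 (by linarith)
      convert LocallyAlternating.Icc (a := ((T x).1 - √(r ^ 2 - (T x).2 ^ 2)) / v)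
        (b := ((T x).1 + √(r ^ 2 - (T x).2 ^ 2)) / v) (by gcongr; linarith) using 1
      ext t
      rw [mem_ofPred_eq, ← le_sub_iff_add_le, Real.sq_le (by linarith), Set.mem_Icc, div_le_iff₀ hv,
        le_div_iff₀ hv]
      constructor <;> rintro ⟨h3, h4⟩ <;> constructor <;> linarith
    · convert LocallyAlternating.empty using 1
      ext t
      simp only [mem_ofPred_eq, mem_empty_iff_false, iff_false, not_le]
      nlinarith [sq_nonneg ((T x).1 - t * v)]
  · simp only [mem_ofPred_eq, mem_iUnion, exists_prop]
    refine ⟨fun ⟨x, hx, hd⟩ ↦ ⟨x, ⟨hx, ?_⟩, hd⟩, fun ⟨x, hx, hd⟩ ↦ ⟨x, hx.1, hd⟩⟩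
    rw [disc, Metric.mem_closedBall] at hd
    rw [mem_closedBall_zero_iff]
    have h3 : ‖position v e t‖ = t * v := by
      rw [position, norm_smul, he, mul_one, Real.norm_eq_abs, abs_of_nonneg (by positivity)]
    have h4 := norm_le_norm_add_norm_sub' x (position v e t)
    rw [← dist_eq_norm] at h4
    nlinarith

end IsPoissonProcess

variable {p w β v γ : ℝ} {e : Plane}

section

variable (hΦ : IsPoissonProcess P Φ lam) (hlam : 0 < lam) (hp : 0 < p) (hw : 0 < w) (hβ : 0 < β)
  (hv : 0 < v) (hγ : 0 < γ) (he : ‖e‖ = 1)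

include hΦ hp hw hβ hγ

omit [IsProbabilityMeasure P] in
theorem ae_mem_coveredTimes_iff : ∀ᵐ ω ∂P, ∀ t, t ∈ coveredTimes Φ p w β v γ e ω ↔
    (Φ ω ∩ disc (coverageRadius p w β γ) v e t).Nonempty := by
  filter_upwards [hΦ.locallyFinite] with ω hω t
  exact mem_coveredTimes_iff hp hw hβ hγ hω e t

omit [IsProbabilityMeasure P] in
theorem off_coveredTimes_ae_eq (F : Finset ℝ) :
    {ω | ∀ t ∈ F, t ∉ coveredTimes Φ p w β v γ e ω} =ᵐ[P]
      {ω | Φ ω ∩ ⋃ t ∈ F, disc (coverageRadius p w β γ) v e t = ∅} := by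
  filter_upwards [ae_mem_coveredTimes_iff (v := v) (e := e) hΦ hp hw hβ hγ] with ω hω
  refine eq_iff_iff.2 ?_
  change (∀ t ∈ F, t ∉ coveredTimes Φ p w β v γ e ω) ↔
    Φ ω ∩ ⋃ t ∈ F, disc (coverageRadius p w β γ) v e t = ∅
  simp only [hω, not_nonempty_iff_eq_empty, inter_iUnion, iUnion_eq_empty]

omit [IsProbabilityMeasure P] hΦ hp hw hβ hγ in
theorem measurableSet_biUnion_disc (r : ℝ) (F : Finset ℝ) :
    MeasurableSet (⋃ t ∈ F, disc r v e t) :=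
  F.measurableSet_biUnion fun _ _ ↦ measurableSet_disc _ _ _ _

omit [IsProbabilityMeasure P] hΦ hp hw hβ hγ in
theorem isBounded_biUnion_disc (r : ℝ) (F : Finset ℝ) :
    Bornology.IsBounded (⋃ t ∈ F, disc r v e t) :=
  (Bornology.isBounded_biUnion_finset F).2 fun _ _ ↦ isBounded_disc _ _ _ _

omit [IsProbabilityMeasure P] in
theorem nullMeasurableSet_coveredTimes (t : ℝ) :
    NullMeasurableSet {ω | t ∈ coveredTimes Φ p w β v γ e ω} P := by
  have h := (hΦ.nullMeasurableSet_void (measurableSet_biUnion_disc (v := v) (e := e) (coverageRadius p w β γ) {t})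
    (isBounded_biUnion_disc _ {t})).congr (off_coveredTimes_ae_eq hΦ hp hw hβ hγ {t}).symm
  have h2 := h.compl
  simp only [Finset.mem_singleton, forall_eq] at h2
  convert h2 using 1
  ext ω; simp

include hlam

omit [IsProbabilityMeasure P] in
theorem measure_off_coveredTimes (F : Finset ℝ) :
    P {ω | ∀ t ∈ F, t ∉ coveredTimes Φ p w β v γ e ω} = ENNReal.ofReal
      (Real.exp (-(lam * volume.real (⋃ t ∈ F, disc (coverageRadius p w β γ) v e t)))) := by
  rw [measure_congr (off_coveredTimes_ae_eq hΦ hp hw hβ hγ F),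
    hΦ.measure_void hlam (measurableSet_biUnion_disc _ F) (isBounded_biUnion_disc _ F)]

include hv he

/-- The set of covered times starts afresh from every time off. -/
theorem isRegenerativeSet_coveredTimes :
    IsRegenerativeSet P (coveredTimes Φ p w β v γ e) (offProb (coverageRadius p w β γ) v lam)
      (2 * coverageRadius p w β γ / v) := by
  have hr := coverageRadius_pos (β := β) hp hw hγ
  have hoff := measure_off_coveredTimes (v := v) (e := e) hΦ hlam hp hw hβ hγ
  have hiff := ae_mem_coveredTimes_iff (v := v) (e := e) hΦ hp hw hβ hγ
  set r := coverageRadius p w β γ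
  have hD : 0 < 2 * r / v := by positivity
  have hone : ∀ t, P {ω | t ∉ coveredTimes Φ p w β v γ e ω} =
      ENNReal.ofReal (Real.exp (-(lam * volume.real (disc r v e t)))) := fun t ↦ by
    simpa using hoff {t}
  refine ⟨fun t _ ↦ nullMeasurableSet_coveredTimes hΦ hp hw hβ hγ t, ?_, fun F s g hF _ hg ↦ ?_, ?_, hD,
    fun t _ ↦ ?_, fun t ht ↦ offProb_eq_of_le hr hv ht, offProb_lt_one hr hv hlam, ?_⟩
  · rw [hone]
    simpa using Real.exp_pos _
  · rw [hoff, hoff, offProb_of_nonneg hg, ← ENNReal.ofReal_mul (Real.exp_nonneg _), ← Real.exp_add]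
    set A := ⋃ t ∈ insert s F, disc r v e t with hA
    have hU : ⋃ t ∈ insert (s + g) (insert s F), disc r v e t = A ∪ disc r v e (s + g) := by
      rw [Finset.set_biUnion_insert, union_comm]
    -- Every earlier disc meets the new one inside the disc at time `s`, so only the crescent is
    -- new.
    have hdiff : disc r v e (s + g) \ A = disc r v e (s + g) \ disc r v e s := by
      refine subset_antisymm (sdiff_subset_sdiff_right ?_) fun x hx ↦ ⟨hx.1, fun hxA ↦ hx.2 ?_⟩
      · rw [hA, Finset.set_biUnion_insert]; exact subset_union_left
      · simp only [hA, mem_iUnion, exists_prop] at hxA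
        obtain ⟨t, ht, hxt⟩ := hxA
        refine disc_inter_subset r v e ?_ (by linarith) ⟨hxt, hx.1⟩
        rcases Finset.mem_insert.1 ht with rfl | ht
        exacts [le_rfl, (hF t ht).2]
    have hfin : volume A ≠ ⊤ := (isBounded_biUnion_disc r (insert s F)).measure_lt_top.ne
    rw [hU, ← union_sdiff_self, hdiff, measureReal_union (by rw [← hdiff]; exact disjoint_sdiff_right)
      ((measurableSet_disc _ _ _ _).diff (measurableSet_disc _ _ _ _)) hfin
      ((isBounded_disc r v e _).subset sdiff_subset).measure_lt_top.ne,
      volume_real_crescent hr hv he s hg]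
    congr 2
    ring
  · filter_upwards [hΦ.ae_locallyAlternating hlam hr hv he, hiff] with ω h1 h2
    convert h1 using 1
    ext t
    exact h2 t
  · rw [hone, offProb_of_nonneg hD.le, volume_real_disc_eq_integral hr hv he]
    congr 3
    ring
  · exact Real.exp_pos _

omit hv he in
theorem measureReal_levelCrossing (t : ℝ) : P.real {ω | levelCrossing Φ p w β v γ e t ω = 1} =
    1 - Real.exp (-(lam * Real.pi * coverageRadius p w β γ ^ 2)) := by
  have h := measure_off_coveredTimes (v := v) (e := e) hΦ hlam hp hw hβ hγ {t}
  have hm := nullMeasurableSet_coveredTimes (v := v) (e := e) hΦ hp hw hβ hγ t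
  simp only [Finset.mem_singleton, forall_eq, iUnion_iUnion_eq_left,
    volume_real_disc (coverageRadius_pos hp hw hγ).le] at h
  have h2 : P.real {ω | t ∈ coveredTimes Φ p w β v γ e ω}ᶜ =
      Real.exp (-(lam * (Real.pi * coverageRadius p w β γ ^ 2))) := by
    rw [Measure.real, show {ω | t ∈ coveredTimes Φ p w β v γ e ω}ᶜ =
      {ω | t ∉ coveredTimes Φ p w β v γ e ω} from rfl, h, ENNReal.toReal_ofReal (Real.exp_nonneg _)]
  rw [mul_assoc lam Real.pi, ← h2, probReal_compl_eq_one_sub₀ hm]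
  simp [coveredTimes]

omit hv he in
-- Off probabilities determine the finite-dimensional laws, and a time shift translates the union of
-- discs, whose area is unchanged.
theorem isStationaryProcess_levelCrossing :
    IsStationaryProcess P (levelCrossing Φ p w β v γ e) := by
  classical
  intro k t h _ _
  have hex : ∀ t : ℝ, ∃ E, MeasurableSet E ∧
      E =ᵐ[P] {ω | t ∈ coveredTimes Φ p w β v γ e ω} := fun t ↦ by
    obtain ⟨E, -, h1, h2⟩ :=
      (nullMeasurableSet_coveredTimes (v := v) (e := e) hΦ hp hw hβ hγ t).exists_measurable_superset_ae_eq
    exact ⟨E, h1, h2⟩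
  choose E hE hES using hex
  let X : (Fin k → ℝ) → Ω → Fin k → Bool := fun t ω i ↦ decide (ω ∈ E (t i))
  have hX : ∀ t, Measurable (X t) := fun t ↦ measurable_pi_lambda _ fun i ↦ by
    refine measurable_to_bool ?_
    convert hE (t i) using 1
    ext; simp [X]
  let N : (Fin k → Bool) → Fin k → ℕ := fun x i ↦ if x i then 1 else 0
  have hN : ∀ t : Fin k → ℝ, (fun ω ↦ N (X t ω)) =ᵐ[P]
      fun ω i ↦ levelCrossing Φ p w β v γ e (t i) ω := fun t ↦ by
    filter_upwards [ae_all_iff.2 fun i ↦ (hES (t i)).mem_iff] with ω hω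
    funext i
    have h1 := hω i
    rw [coveredTimes, mem_ofPred_eq] at h1
    simp only [N, X, decide_eq_true_eq, h1]
    unfold levelCrossing
    split_ifs <;> simp_all
  have hmap : ∀ t : Fin k → ℝ, ∀ F : Finset (Fin k), P.map (X t) {x | ∀ i ∈ F, x i = false} =
      ENNReal.ofReal (Real.exp (-(lam * volume.real
        (⋃ s ∈ F.image t, disc (coverageRadius p w β γ) v e s)))) := fun t F ↦ by
    rw [Measure.map_apply (hX t) (Set.toFinite _).measurableSet,
      ← measure_off_coveredTimes hΦ hlam hp hw hβ hγ]
    refine measure_congr ?_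
    filter_upwards [ae_all_iff.2 fun i ↦ (hES (t i)).mem_iff] with ω hω
    refine eq_iff_iff.2 ?_
    change (∀ i ∈ F, X t ω i = false) ↔ ∀ s ∈ F.image t, s ∉ coveredTimes Φ p w β v γ e ω
    have : ∀ i, ω ∈ E (t i) ↔ t i ∈ coveredTimes Φ p w β v γ e ω := hω
    simp [X, this]
  have hlaw : P.map (X fun i ↦ t i + h) = P.map (X t) := by
    have : IsProbabilityMeasure (P.map (X fun i ↦ t i + h)) :=
      Measure.isProbabilityMeasure_map (hX _).aemeasurable
    refine ext_of_off fun F ↦ ?_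
    rw [hmap, hmap]
    congr 4
    rw [Measure.real, Measure.real, ← measure_preimage_add volume (position v e h)]
    congr 2
    ext x
    simp only [mem_preimage, mem_iUnion, Finset.mem_image, exists_prop, exists_exists_and_eq_and,
      disc, Metric.mem_closedBall, position, add_mul, add_smul]
    refine exists_congr fun i ↦ and_congr_right fun _ ↦ ?_
    rw [add_comm ((t i * v) • e), dist_add_left]
  have hid : IdentDistrib (X fun i ↦ t i + h) (X t) P P :=
    ⟨(hX _).aemeasurable, (hX _).aemeasurable, hlaw⟩
  have hNm : Measurable N := measurable_of_countable N
  exact ((IdentDistrib.of_ae_eq ((hNm.comp (hX _)).aemeasurable) (hN _)).symm.trans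
    (hid.comp hNm)).trans (IdentDistrib.of_ae_eq ((hNm.comp (hX _)).aemeasurable) (hN _))

end

end

end SNRCrossing

namespace SNRCrossing

noncomputable section

/-! ### Renewal equations -/

/-- The memoryless property of the exponential law. -/
theorem setLIntegral_Ici_expMeasure (a : ℝ) {c : ℝ} (hc : 0 ≤ c)
    {f : ℝ → ENNReal} (hf : Measurable f) : ∫⁻ x in Ici c, f x ∂expMeasure a =
      ENNReal.ofReal (Real.exp (-(a * c))) * ∫⁻ x, f (c + x) ∂expMeasure a := by
  have hpdf : Measurable (exponentialPDF a) := (measurable_exponentialPDFReal a).ennreal_ofReal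
  change ∫⁻ x in Ici c, f x ∂volume.withDensity (exponentialPDF a) =
    _ * ∫⁻ x, f (c + x) ∂volume.withDensity (exponentialPDF a)
  rw [restrict_withDensity measurableSet_Ici, lintegral_withDensity_eq_lintegral_mul _ hpdf hf,
    lintegral_withDensity_eq_lintegral_mul _ hpdf
      (show Measurable fun x ↦ f (c + x) from hf.comp (measurable_const_add c)),
    ← lintegral_indicator measurableSet_Ici, ← lintegral_add_left_eq_self _ c,
    ← lintegral_const_mul' _ _ ENNReal.ofReal_ne_top]
  refine lintegral_congr fun x ↦ ?_
  rcases lt_or_ge x 0 with hx | hx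
  · rw [indicator_of_notMem (by simpa using hx), Pi.mul_apply, exponentialPDF_of_neg hx, zero_mul,
      mul_zero]
  · rw [indicator_of_mem (by simpa using hx), Pi.mul_apply, Pi.mul_apply,
      exponentialPDF_of_nonneg hx, exponentialPDF_of_nonneg (by linarith), ← mul_assoc,
      ← ENNReal.ofReal_mul (Real.exp_nonneg _)]
    congr 2
    rw [mul_add, neg_add, Real.exp_add]
    ring

theorem ae_expMeasure_pos {a : ℝ} (ha : 0 < a) : ∀ᵐ x ∂expMeasure a, 0 < x := by
  have h : ∀ᵐ x ∂expMeasure a, x ∉ Iic 0 := measure_eq_zero_iff_ae_notMem.1 (expMeasure_Iic_zero ha)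
  exact h.mono fun x hx ↦ not_le.1 hx

theorem expMeasure_Iio_lt_one {a : ℝ} (ha : 0 < a) {t : ℝ} (ht : 0 ≤ t) : expMeasure a (Iio t) < 1 := by
  have := isProbabilityMeasure_expMeasure ha
  refine (measure_mono Iio_subset_Iic_self).trans_lt ?_
  rw [← compl_Ioi, prob_compl_eq_one_sub measurableSet_Ioi, expMeasure_Ioi ha ht]
  refine ENNReal.sub_lt_self ENNReal.one_ne_top one_ne_zero ?_
  simpa using Real.exp_pos _

/-- Comparison of two solutions of a renewal equation with the same boundary terms. -/
theorem le_of_renewal {a : ℝ} (ha : 0 < a) {t : ℝ} (ht : 0 ≤ t) {φ u w b : ℝ → ENNReal}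
    (hφ : ∀ s, φ s ≤ 1) (hφm : Measurable φ) (hwm : Measurable w)
    (hu1 : ∀ s, u s ≤ 1)
    (hu : ∀ s, 0 ≤ s → s ≤ t → u s = (∫⁻ x in Iio (t - s), φ (s + x) * u (s + x) ∂expMeasure a) + b s)
    (hw : ∀ s, 0 ≤ s → s ≤ t → w s = (∫⁻ x in Iio (t - s), φ (s + x) * w (s + x) ∂expMeasure a) + b s)
    {s : ℝ} (hs0 : 0 ≤ s) (hst : s ≤ t) : u s ≤ w s := by
  have := isProbabilityMeasure_expMeasure ha
  -- The largest excess of `u` over `w`, with truncated subtraction. The boundary terms cancel, so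
  -- `m ≤ m ℙ(X < t)` for an exponential `X`; as that probability is below `1` and `m` is finite, `m
  -- = 0`.
  set m := ⨆ s ∈ Set.Icc 0 t, (u s - w s) with hm
  have hle : ∀ s ∈ Set.Icc 0 t, u s - w s ≤ m := fun s hs ↦
    le_iSup₂ (f := fun s (_ : s ∈ Set.Icc 0 t) ↦ u s - w s) s hs
  have hm1 : m ≤ 1 := iSup₂_le fun s _ ↦ tsub_le_self.trans (hu1 s)
  have hb : ∀ s, 0 ≤ s → s ≤ t → b s ≠ ⊤ := fun s h0 ht ↦
    ne_top_of_le_ne_top ENNReal.one_ne_top ((le_add_self.trans_eq (hu s h0 ht).symm).trans (hu1 s))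
  have key : m ≤ m * expMeasure a (Iio t) := by
    refine iSup₂_le fun s hs ↦ ?_
    have hf : Measurable fun x ↦ φ (s + x) * w (s + x) :=
      (hφm.comp (measurable_const_add s)).mul (hwm.comp (measurable_const_add s))
    calc u s - w s
        = (∫⁻ x in Iio (t - s), φ (s + x) * u (s + x) ∂expMeasure a) -
          ∫⁻ x in Iio (t - s), φ (s + x) * w (s + x) ∂expMeasure a := by
          conv_lhs => rw [hu s hs.1 hs.2, hw s hs.1 hs.2]
          exact ENNReal.add_sub_add_eq_sub_right (hb s hs.1 hs.2)
      _ ≤ ∫⁻ x in Iio (t - s), φ (s + x) * u (s + x) - φ (s + x) * w (s + x) ∂expMeasure a :=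
          lintegral_sub_le _ _ hf
      _ ≤ ∫⁻ x in Iio (t - s), m ∂expMeasure a := by
          refine lintegral_mono_ae ?_
          filter_upwards [ae_restrict_mem measurableSet_Iio,
            ae_restrict_of_ae (ae_expMeasure_pos ha)] with x hx hx0
          have h1 : s + x ∈ Set.Icc 0 t := ⟨by linarith [hs.1], by linarith [mem_Iio.1 hx]⟩
          rw [← ENNReal.mul_sub fun _ _ ↦ (hφ _).trans_lt ENNReal.one_lt_top |>.ne]
          exact (mul_le_of_le_one_left' (hφ _)).trans (hle _ h1)
      _ ≤ m * expMeasure a (Iio t) := by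
          rw [lintegral_const, Measure.restrict_apply_univ]
          gcongr
          linarith [hs.1]
  have hm0 : m = 0 := by
    by_contra hne
    refine absurd key (not_le.2 ?_)
    conv_rhs => rw [← mul_one m]
    exact (ENNReal.mul_lt_mul_iff_right hne (hm1.trans_lt ENNReal.one_lt_top).ne).2
      (expMeasure_Iio_lt_one ha ht)
  exact tsub_eq_zero_iff_le.1 (le_antisymm ((hle s ⟨hs0, hst⟩).trans_eq hm0) zero_le)

/-- Two solutions of a renewal equation whose boundary terms are determined by their values at `t`
are proportional. -/
theorem mul_eq_mul_of_renewal {a : ℝ} (ha : 0 < a) {t : ℝ} (ht : 0 ≤ t) {φ u w c : ℝ → ENNReal}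
    (hφ : ∀ s, φ s ≤ 1) (hφm : Measurable φ) (hum : Measurable u) (hwm : Measurable w)
    (hu1 : ∀ s, u s ≤ 1) (hw1 : ∀ s, w s ≤ 1)
    (hu : ∀ s, 0 ≤ s → s ≤ t →
      u s = (∫⁻ x in Iio (t - s), φ (s + x) * u (s + x) ∂expMeasure a) + c s * u t)
    (hw : ∀ s, 0 ≤ s → s ≤ t →
      w s = (∫⁻ x in Iio (t - s), φ (s + x) * w (s + x) ∂expMeasure a) + c s * w t) :
    u 0 * w t = w 0 * u t := by
  -- Cross-multiplication: `u · w t` and `w · u t` solve the equation with the same boundary term,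
  -- so the comparison applies in both directions.
  have scale : ∀ {f : ℝ → ENNReal} {k : ENNReal}, k ≤ 1 → (∀ s, 0 ≤ s → s ≤ t →
      f s = (∫⁻ x in Iio (t - s), φ (s + x) * f (s + x) ∂expMeasure a) + c s * f t) →
      ∀ s, 0 ≤ s → s ≤ t → f s * k =
        (∫⁻ x in Iio (t - s), φ (s + x) * (f (s + x) * k) ∂expMeasure a) + c s * (f t * k) := by
    intro f k hk hf s h0 hs
    simp_rw [← mul_assoc]
    rw [lintegral_mul_const' _ _ (hk.trans_lt ENNReal.one_lt_top).ne, ← add_mul, ← hf s h0 hs]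
  have hu' := scale (hw1 t) hu
  have hw' := scale (hu1 t) hw
  simp_rw [mul_comm (w t) (u t)] at hw'
  exact le_antisymm
    (le_of_renewal ha ht hφ hφm (hwm.mul_const _) (fun s ↦ mul_le_one' (hu1 s) (hw1 t))
      hu' hw' le_rfl ht)
    (le_of_renewal ha ht hφ hφm (hum.mul_const _) (fun s ↦ mul_le_one' (hw1 s) (hu1 t))
      hw' hu' le_rfl ht)

/-! ### The canonical queue -/

/-- The arrival times of a sequence of inter-arrival and service times. -/
def arrival (z : ℕ → ℝ × ℝ) (n : ℕ) : ℝ := ∑ i ∈ Finset.range (n + 1), (z i).1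

/-- The times at which the queue with given inter-arrival and service times is busy. -/
def busySet (z : ℕ → ℝ × ℝ) : Set ℝ := {t | ∃ n, arrival z n ≤ t ∧ t < arrival z n + (z n).2}

theorem busyTimes_eq {Ω : Type*} (X W : ℕ → Ω → ℝ) (ω : Ω) :
    busyTimes X W ω = busySet fun n ↦ (X n ω, W n ω) := by
  ext t
  simp only [busyTimes, numCustomers, mem_ofPred_eq, Ne, encard_eq_zero, ← nonempty_iff_ne_empty]
  rfl

theorem arrival_succ (z : ℕ → ℝ × ℝ) (n : ℕ) :
    arrival z (n + 1) = (z 0).1 + arrival (fun i ↦ z (i + 1)) n := by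
  rw [arrival, Finset.sum_range_succ', add_comm, arrival]

theorem measurable_arrival (n : ℕ) : Measurable fun z ↦ arrival z n :=
  Finset.measurable_sum _ fun i _ ↦ (measurable_pi_apply i).fst

/-- The service times that a customer who arrives at time `u` can have if none of the times in `F`
is busy. -/
def idleService (F : Finset ℝ) (u : ℝ) : Set ℝ := {w | ∀ f ∈ F, ¬(u ≤ f ∧ f < u + w)}

/-- The start times and queues such that no time in `F` is busy. -/
def idleOn (F : Finset ℝ) : Set (ℝ × (ℕ → ℝ × ℝ)) :=
  {y | ∀ n, (y.2 n).2 ∈ idleService F (y.1 + arrival y.2 n)}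

theorem measurableSet_idleService (F : Finset ℝ) :
    MeasurableSet {y : ℝ × ℝ | y.2 ∈ idleService F y.1} := by
  have : {y : ℝ × ℝ | y.2 ∈ idleService F y.1} =
      ⋂ f ∈ F, {y : ℝ × ℝ | y.1 ≤ f ∧ f < y.1 + y.2}ᶜ := by
    ext y; simp [idleService]
  rw [this]
  exact F.measurableSet_biInter fun f _ ↦ ((measurableSet_le measurable_fst measurable_const).inter
    (measurableSet_lt measurable_const (measurable_fst.add measurable_snd))).compl

theorem measurableSet_idleOn (F : Finset ℝ) : MeasurableSet (idleOn F) := by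
  have : idleOn F = ⋂ n : ℕ, (fun y : ℝ × (ℕ → ℝ × ℝ) ↦ (y.1 + arrival y.2 n, (y.2 n).2)) ⁻¹'
      {y : ℝ × ℝ | y.2 ∈ idleService F y.1} := by
    ext y; simp [idleOn]
  rw [this]
  refine MeasurableSet.iInter fun n ↦ ?_
  refine Measurable.prodMk (measurable_fst.add ((measurable_arrival n).comp measurable_snd)) ?_
    (measurableSet_idleService F)
  exact ((measurable_pi_apply n).comp measurable_snd).snd

/-- The customers after the first form a queue that starts empty at the first arrival. -/
theorem mem_idleOn_iff {F : Finset ℝ} {s : ℝ} {z : ℕ → ℝ × ℝ} : (s, z) ∈ idleOn F ↔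
    (z 0).2 ∈ idleService F (s + (z 0).1) ∧ (s + (z 0).1, fun n ↦ z (n + 1)) ∈ idleOn F := by
  simp only [idleOn, mem_ofPred_eq]
  constructor
  · refine fun h ↦ ⟨by simpa [arrival] using h 0, fun n ↦ ?_⟩
    have := h (n + 1)
    rwa [arrival_succ, ← add_assoc] at this
  · rintro ⟨h0, h⟩ (_ | n)
    · simpa [arrival] using h0
    · rw [arrival_succ, ← add_assoc]; exact h n

theorem forall_notMem_busySet_iff {F : Finset ℝ} {z : ℕ → ℝ × ℝ} :
    (∀ t ∈ F, t ∉ busySet z) ↔ (0, z) ∈ idleOn F := by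
  simp only [busySet, idleOn, idleService, mem_ofPred_eq, not_exists, zero_add]
  exact ⟨fun h n t ht ↦ h t ht n, fun h t ht n ↦ h n t ht⟩

/-- The law of the inter-arrival and service times. -/
def queueLaw (a : ℝ) (σ : Measure ℝ) : Measure (ℕ → ℝ × ℝ) :=
  Measure.infinitePi fun _ ↦ (expMeasure a).prod σ

/-- The probability that no time in `F` is busy, if the queue starts empty at time `s`. -/
def idleProb (a : ℝ) (σ : Measure ℝ) (F : Finset ℝ) (s : ℝ) : ENNReal :=
  queueLaw a σ (Prod.mk s ⁻¹' idleOn F)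

section

variable {a : ℝ} (ha : 0 < a) {σ : Measure ℝ} [IsProbabilityMeasure σ]

include ha

theorem isProbabilityMeasure_queueLaw : IsProbabilityMeasure (queueLaw a σ) := by
  have := isProbabilityMeasure_expMeasure ha
  unfold queueLaw
  infer_instance

theorem measurable_idleProb (F : Finset ℝ) : Measurable (idleProb a σ F) := by
  have := isProbabilityMeasure_queueLaw ha (σ := σ)
  exact measurable_measure_prodMk_left (measurableSet_idleOn F)

omit ha in
theorem measurable_measure_idleService (F : Finset ℝ) : Measurable fun u ↦ σ (idleService F u) :=
  measurable_measure_prodMk_left (measurableSet_idleService F)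

/-- Conditioning on the first customer: its own service must avoid `F`, and independently so must
the queue formed by the others. -/
theorem idleProb_eq_lintegral (F : Finset ℝ) (s : ℝ) : idleProb a σ F s =
    ∫⁻ x, σ (idleService F (s + x)) * idleProb a σ F (s + x) ∂expMeasure a := by
  have := isProbabilityMeasure_expMeasure ha
  have := isProbabilityMeasure_queueLaw ha (σ := σ)
  let B : Set ((ℝ × ℝ) × (ℕ → ℝ × ℝ)) := {q | q.1.2 ∈ idleService F (s + q.1.1)} ∩
    {q | (s + q.1.1, q.2) ∈ idleOn F}
  have hm1 : MeasurableSet {p : ℝ × ℝ | p.2 ∈ idleService F (s + p.1)} :=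
    ((measurable_const.add measurable_fst).prodMk measurable_snd) (measurableSet_idleService F)
  have hB : MeasurableSet B := (measurable_fst hm1).inter
    (((measurable_const.add (measurable_fst.comp measurable_fst)).prodMk measurable_snd)
      (measurableSet_idleOn F))
  have hcons : Measurable fun z : ℕ → ℝ × ℝ ↦ (z 0, fun n ↦ z (n + 1)) :=
    (measurable_pi_apply 0).prodMk (measurable_pi_lambda _ fun n ↦ measurable_pi_apply (n + 1))
  have h1 : Prod.mk s ⁻¹' idleOn F = (fun z : ℕ → ℝ × ℝ ↦ (z 0, fun n ↦ z (n + 1))) ⁻¹' B := by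
    ext z; exact mem_idleOn_iff
  have h2 : ∀ p : ℝ × ℝ, queueLaw a σ (Prod.mk p ⁻¹' B) =
      {p : ℝ × ℝ | p.2 ∈ idleService F (s + p.1)}.indicator (fun p ↦ idleProb a σ F (s + p.1)) p := by
    intro p
    by_cases hp : p.2 ∈ idleService F (s + p.1)
    · rw [indicator_of_mem (by exact hp)]
      have : Prod.mk p ⁻¹' B = Prod.mk (s + p.1) ⁻¹' idleOn F := by
        ext z; exact ⟨fun h ↦ h.2, fun h ↦ ⟨hp, h⟩⟩
      rw [this, idleProb]
    · rw [indicator_of_notMem (by exact hp)]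
      have : Prod.mk p ⁻¹' B = ∅ := by
        ext z; exact ⟨fun h ↦ hp h.1, fun h ↦ h.elim⟩
      rw [this, measure_empty]
  have hG : Measurable fun p : ℝ × ℝ ↦ idleProb a σ F (s + p.1) :=
    (measurable_idleProb ha F).comp (measurable_const.add measurable_fst)
  rw [idleProb, h1, ← Measure.map_apply hcons hB, queueLaw, map_cons_infinitePi]
  change ((expMeasure a).prod σ).prod (queueLaw a σ) B = _
  rw [Measure.prod_apply hB]
  simp_rw [h2]
  rw [lintegral_prod _ (hG.indicator hm1).aemeasurable]
  refine lintegral_congr fun x ↦ ?_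
  have h3 : ∀ w, {p : ℝ × ℝ | p.2 ∈ idleService F (s + p.1)}.indicator
      (fun p ↦ idleProb a σ F (s + p.1)) (x, w) =
        (idleService F (s + x)).indicator (fun _ ↦ idleProb a σ F (s + x)) w := fun w ↦ rfl
  have h4 : MeasurableSet (idleService F (s + x)) :=
    measurable_prodMk_left (measurableSet_idleService F)
  simp_rw [h3]
  rw [lintegral_indicator_const h4, mul_comm]

/-- If nobody arrives before `t`, the queue restarts empty at `t` by the memoryless property. -/
theorem idleProb_renewal (F : Finset ℝ) {s t : ℝ} (hst : s ≤ t) : idleProb a σ F s =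
    (∫⁻ x in Iio (t - s), σ (idleService F (s + x)) * idleProb a σ F (s + x) ∂expMeasure a) +
      ENNReal.ofReal (Real.exp (-(a * (t - s)))) * idleProb a σ F t := by
  have hm : Measurable fun x ↦ σ (idleService F (s + x)) * idleProb a σ F (s + x) :=
    ((measurable_measure_idleService F).comp (measurable_const_add s)).mul
      ((measurable_idleProb ha F).comp (measurable_const_add s))
  rw [idleProb_eq_lintegral ha F t, idleProb_eq_lintegral ha F s,
    ← lintegral_add_compl _ (measurableSet_Iio (a := t - s)), compl_Iio,
    setLIntegral_Ici_expMeasure a (sub_nonneg.2 hst) hm]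
  congr 3
  funext x
  rw [show s + (t - s + x) = t + x by ring]

theorem ae_queueLaw_pos : ∀ᵐ z ∂queueLaw a σ, ∀ n, 0 < (z n).1 := by
  have := isProbabilityMeasure_expMeasure ha
  refine ae_all_iff.2 fun n ↦ ?_
  have h : ∀ᵐ p ∂(expMeasure a).prod σ, 0 < p.1 :=
    Measure.quasiMeasurePreserving_fst.ae (ae_expMeasure_pos ha)
  exact (measurePreserving_eval_infinitePi (fun _ : ℕ ↦ (expMeasure a).prod σ) n
    ).quasiMeasurePreserving.ae h

omit [IsProbabilityMeasure σ] ha in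
theorem arrival_pos {z : ℕ → ℝ × ℝ} (hz : ∀ n, 0 < (z n).1) (n : ℕ) : 0 < arrival z n :=
  Finset.sum_pos (fun i _ ↦ hz i) (by simp)

/-- Only the times after `s` matter for a queue that starts empty at time `s`. -/
theorem idleProb_filter (F : Finset ℝ) (s : ℝ) :
    idleProb a σ F s = idleProb a σ (F.filter (s < ·)) s := by
  refine measure_congr ?_
  filter_upwards [ae_queueLaw_pos ha] with z hz
  refine eq_iff_iff.2 ⟨fun h n f hf ↦ h n f (Finset.mem_filter.1 hf).1, fun h n f hf hb ↦ ?_⟩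
  have h1 := arrival_pos hz n
  have h2 : s + arrival z n ≤ f := hb.1
  exact h n f (Finset.mem_filter.2 ⟨hf, by linarith⟩) hb

theorem idleProb_empty (s : ℝ) : idleProb a σ ∅ s = 1 := by
  have := isProbabilityMeasure_queueLaw ha (σ := σ)
  have : Prod.mk s ⁻¹' idleOn ∅ = univ := by ext; simp [idleOn, idleService]
  rw [idleProb, this, measure_univ]

omit [IsProbabilityMeasure σ] ha in
theorem idleProb_singleton_add (s g : ℝ) : idleProb a σ {s + g} s = idleProb a σ {g} 0 := by
  rw [idleProb, idleProb]
  congr 1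
  ext z
  simp only [idleOn, idleService, mem_preimage, mem_ofPred_eq, Finset.mem_singleton, forall_eq,
    zero_add, add_assoc, add_le_add_iff_left, add_lt_add_iff_left]

theorem idleProb_le_one (F : Finset ℝ) (s : ℝ) : idleProb a σ F s ≤ 1 := by
  have := isProbabilityMeasure_queueLaw ha (σ := σ)
  exact prob_le_one

/-- As functions of the start time, the idle probabilities with and without `s + g` solve the same
renewal equation up to `s`: a customer who arrives before `s` and is gone at `s` is also gone at `s
+ g`. So they are proportional, and the ratio is read off at start time `s`, where no earlier time
matters. -/
theorem idleProb_insert (F : Finset ℝ) {s g : ℝ} (hF : ∀ f ∈ F, f ≤ s) (hs : 0 ≤ s) (hg : 0 ≤ g) :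
    idleProb a σ (insert (s + g) (insert s F)) 0 =
      idleProb a σ (insert s F) 0 * idleProb a σ {g} 0 := by
  have hA : idleProb a σ (insert s F) s = 1 := by
    rw [idleProb_filter ha, Finset.filter_eq_empty_iff.2 ?_, idleProb_empty ha]
    intro f hf
    rcases Finset.mem_insert.1 hf with rfl | hf
    exacts [lt_irrefl _, not_lt.2 (hF f hf)]
  have hA' : idleProb a σ (insert (s + g) (insert s F)) s = idleProb a σ {g} 0 := by
    rw [← idleProb_singleton_add s g, idleProb_filter ha, idleProb_filter ha {s + g}]
    congr 1
    ext f
    simp only [Finset.mem_filter, Finset.mem_insert, Finset.mem_singleton]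
    refine ⟨fun ⟨h, h'⟩ ↦ ⟨?_, h'⟩, fun ⟨h, h'⟩ ↦ ⟨.inl h, h'⟩⟩
    rcases h with h | rfl | h
    exacts [h, absurd h' (lt_irrefl _), absurd h' (not_lt.2 (hF f h))]
  have hφ : ∀ u, u < s → idleService (insert (s + g) (insert s F)) u =
      idleService (insert s F) u := fun u hu ↦ by
    ext w
    simp only [idleService, mem_ofPred_eq]
    refine ⟨fun h f hf ↦ h f (Finset.mem_insert_of_mem hf), fun h f hf ↦ ?_⟩
    rcases Finset.mem_insert.1 hf with rfl | hf
    · intro h'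
      exact h s (Finset.mem_insert_self _ _) ⟨hu.le, by linarith [h'.2]⟩
    · exact h f hf
  have h := mul_eq_mul_of_renewal ha hs (φ := fun u ↦ σ (idleService (insert s F) u))
    (u := idleProb a σ (insert s F)) (w := idleProb a σ (insert (s + g) (insert s F)))
    (c := fun u ↦ ENNReal.ofReal (Real.exp (-(a * (s - u))))) (fun _ ↦ prob_le_one)
    (measurable_measure_idleService _) (measurable_idleProb ha _) (measurable_idleProb ha _)
    (idleProb_le_one ha _) (idleProb_le_one ha _)
    (fun u _ hu ↦ idleProb_renewal ha _ hu) fun u _ hu ↦ by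
      conv_lhs => rw [idleProb_renewal ha _ hu]
      congr 1
      refine setLIntegral_congr_fun measurableSet_Iio fun x hx ↦ ?_
      rw [mem_Iio] at hx
      rw [hφ _ (by linarith)]
  rw [hA, hA', mul_one] at h
  exact h.symm

end

end

end SNRCrossing

namespace SNRCrossing

noncomputable section

/-! ### The queue with chord-length service times -/

theorem serviceTail_le_one (r v z : ℝ) : serviceTail r v z ≤ 1 :=
  Real.sqrt_le_one.2 (by nlinarith [sq_nonneg (v * z / (2 * r))])

theorem serviceLaw_Iic {r v : ℝ} (hr : 0 < r) (hv : 0 < v) {z : ℝ} (hz : 0 ≤ z) :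
    serviceLaw r v (Iic z) = ENNReal.ofReal (1 - serviceTail r v z) := by
  have := isProbabilityMeasure_serviceLaw hr hv
  rw [← compl_Ioi, prob_compl_eq_one_sub measurableSet_Ioi, serviceLaw_Ioi hr hv hz,
    ENNReal.ofReal_sub _ (serviceTail_nonneg _ _ _), ENNReal.ofReal_one]

section

variable {r v lam : ℝ} (hr : 0 < r) (hv : 0 < v) (hlam : 0 < lam)

/-- For `x ≤ c` the function is `-e^{-ax} offProb (c - x)` with `a = 2 r v λ`, the antiderivative
used in `integral_offProb`. -/
theorem hasDerivAt_offProb_mul_exp (r v lam c x : ℝ) :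
    HasDerivAt (fun x ↦ -Real.exp (-(2 * r * v * lam * ((∫ z in 0..c - x, serviceTail r v z) + x))))
      (2 * r * v * lam * (1 - serviceTail r v (c - x)) *
        Real.exp (-(2 * r * v * lam * ((∫ z in 0..c - x, serviceTail r v z) + x)))) x := by
  have h := continuous_serviceTail r v
  have h1 := intervalIntegral.integral_hasDerivAt_right (h.intervalIntegrable 0 (c - x))
    (h.stronglyMeasurableAtFilter _ _) h.continuousAt
  have h2 : HasDerivAt (fun x ↦ c - x) (-1) x := by
    simpa using (hasDerivAt_id x).const_sub c
  have h3 := ((((h1.comp x h2).add (hasDerivAt_id x)).const_mul (2 * r * v * lam)).neg.exp).neg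
  refine h3.congr_deriv ?_
  simp only [Function.comp_apply, id, Pi.add_apply, Pi.neg_apply]
  ring

theorem integral_offProb {c : ℝ} (hc : 0 ≤ c) :
    ∫ x in 0..c, 2 * r * v * lam * Real.exp (-(2 * r * v * lam * x)) *
      ((1 - serviceTail r v (c - x)) * offProb r v lam (c - x)) =
        offProb r v lam c - Real.exp (-(2 * r * v * lam * c)) := by
  have h := continuous_serviceTail r v
  have hcont : Continuous fun x ↦ 2 * r * v * lam * Real.exp (-(2 * r * v * lam * x)) *
      ((1 - serviceTail r v (c - x)) * offProb r v lam (c - x)) := by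
    have h1 : Continuous fun x ↦ serviceTail r v (c - x) := h.comp (continuous_sub_left c)
    have h2 : Continuous fun x ↦ offProb r v lam (c - x) :=
      (continuous_offProb r v lam).comp (continuous_sub_left c)
    fun_prop
  rw [intervalIntegral.integral_eq_sub_of_hasDerivAt (f := fun x ↦
    -Real.exp (-(2 * r * v * lam * ((∫ z in 0..c - x, serviceTail r v z) + x)))) ?_
    (hcont.intervalIntegrable 0 c)]
  · simp only [sub_self, intervalIntegral.integral_same, zero_add, sub_zero, add_zero]
    rw [offProb_of_nonneg hc]
    ring
  · intro x hx
    rw [uIcc_of_le hc] at hx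
    refine (hasDerivAt_offProb_mul_exp r v lam c x).congr_deriv ?_
    rw [offProb_of_nonneg (sub_nonneg.2 hx.2), mul_add, neg_add, Real.exp_add]
    ring

include hr hv hlam

/-- The renewal equation of the event of being idle at `g`: a first customer at `s + x < g` must be
served within `g - s - x`. -/
theorem offProb_renewal {g s : ℝ} (hs : s ≤ g) : ENNReal.ofReal (offProb r v lam (g - s)) =
    (∫⁻ x in Iio (g - s), serviceLaw r v (idleService {g} (s + x)) *
      ENNReal.ofReal (offProb r v lam (g - (s + x))) ∂expMeasure (2 * r * v * lam)) +
      ENNReal.ofReal (Real.exp (-(2 * r * v * lam * (g - s)))) := by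
  have := isProbabilityMeasure_serviceLaw hr hv
  set a := 2 * r * v * lam with ha
  have ha0 : 0 < a := by positivity
  set c := g - s with hc
  have hc0 : 0 ≤ c := sub_nonneg.2 hs
  have hpdf : Measurable (exponentialPDF a) := (measurable_exponentialPDFReal a).ennreal_ofReal
  have hm : Measurable fun x ↦ serviceLaw r v (idleService {g} (s + x)) *
      ENNReal.ofReal (offProb r v lam (g - (s + x))) :=
    ((measurable_measure_idleService _).comp (measurable_const_add s)).mul
      ((continuous_offProb r v lam).comp (by fun_prop : Continuous fun x ↦ g - (s + x))
        ).measurable.ennreal_ofReal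
  have hnn : ∀ x, 0 ≤ a * Real.exp (-(a * x)) *
      ((1 - serviceTail r v (c - x)) * offProb r v lam (c - x)) := fun x ↦
    mul_nonneg (by positivity) (mul_nonneg (sub_nonneg.2 (serviceTail_le_one _ _ _))
      (Real.exp_nonneg _))
  have hcont : Continuous fun x ↦ a * Real.exp (-(a * x)) *
      ((1 - serviceTail r v (c - x)) * offProb r v lam (c - x)) := by
    have h1 : Continuous fun x ↦ serviceTail r v (c - x) :=
      (continuous_serviceTail r v).comp (continuous_sub_left c)
    have h2 : Continuous fun x ↦ offProb r v lam (c - x) :=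
      (continuous_offProb r v lam).comp (continuous_sub_left c)
    fun_prop
  have key : (∫⁻ x in Iio c, serviceLaw r v (idleService {g} (s + x)) *
      ENNReal.ofReal (offProb r v lam (g - (s + x))) ∂expMeasure a) =
        ENNReal.ofReal (offProb r v lam c - Real.exp (-(a * c))) := by
    rw [← integral_offProb hc0, intervalIntegral.integral_of_le hc0,
      ofReal_integral_eq_lintegral_ofReal hcont.integrableOn_Ioc (.of_forall hnn)]
    change ∫⁻ x in Iio c, _ ∂volume.withDensity (exponentialPDF a) = _
    rw [restrict_withDensity measurableSet_Iio, lintegral_withDensity_eq_lintegral_mul _ hpdf hm,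
      setLIntegral_congr Ico_ae_eq_Ioc.symm, ← lintegral_indicator measurableSet_Iio,
      ← lintegral_indicator measurableSet_Ico]
    refine lintegral_congr fun x ↦ ?_
    by_cases hx : x ∈ Ico 0 c
    · rw [indicator_of_mem hx, indicator_of_mem (show x ∈ Iio c from hx.2), Pi.mul_apply,
        exponentialPDF_of_nonneg hx.1]
      have h1 : idleService {g} (s + x) = Iic (c - x) := by
        ext w
        simp only [idleService, Finset.mem_singleton, forall_eq, mem_ofPred_eq, mem_Iic, not_and,
          not_lt]
        have := hx.2
        exact ⟨fun h ↦ by linarith [h (by linarith)], fun h _ ↦ by linarith⟩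
      have h2 : g - (s + x) = c - x := by rw [hc]; ring
      rw [h1, h2, serviceLaw_Iic hr hv (by linarith [hx.2]), ← ENNReal.ofReal_mul
        (sub_nonneg.2 (serviceTail_le_one _ _ _)), ← ENNReal.ofReal_mul (by positivity)]
    · rw [indicator_of_notMem hx]
      by_cases hx' : x ∈ Iio c
      · have hx0 : x < 0 := by
          by_contra! h; exact hx ⟨h, hx'⟩
        rw [indicator_of_mem hx', Pi.mul_apply, exponentialPDF_of_neg hx0, zero_mul]
      · rw [indicator_of_notMem hx']
  have hle : Real.exp (-(a * c)) ≤ offProb r v lam c := by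
    have := intervalIntegral.integral_nonneg hc0 (μ := volume) fun x _ ↦ hnn x
    rw [integral_offProb hc0] at this
    linarith
  rw [key, ← ENNReal.ofReal_add (sub_nonneg.2 hle) (Real.exp_nonneg _), sub_add_cancel]

/-- The idle probability and `offProb (g - ·)` solve the same renewal equation in the start time,
and both equal `1` at start time `g`. -/
theorem idleProb_singleton {g : ℝ} (hg : 0 ≤ g) :
    idleProb (2 * r * v * lam) (serviceLaw r v) {g} 0 = ENNReal.ofReal (offProb r v lam g) := by
  have := isProbabilityMeasure_serviceLaw hr hv
  have ha : 0 < 2 * r * v * lam := by positivity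
  have hone : idleProb (2 * r * v * lam) (serviceLaw r v) {g} g = 1 := by
    rw [idleProb_filter ha, Finset.filter_eq_empty_iff.2 (by simp), idleProb_empty ha]
  have h := mul_eq_mul_of_renewal ha hg (φ := fun u ↦ serviceLaw r v (idleService {g} u))
    (u := idleProb (2 * r * v * lam) (serviceLaw r v) {g})
    (w := fun s ↦ ENNReal.ofReal (offProb r v lam (g - s)))
    (c := fun u ↦ ENNReal.ofReal (Real.exp (-(2 * r * v * lam * (g - u))))) (fun _ ↦ prob_le_one)
    (measurable_measure_idleService _) (measurable_idleProb ha _)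
    ((continuous_offProb r v lam).comp (continuous_sub_left g)).measurable.ennreal_ofReal
    (idleProb_le_one ha _) (fun _ ↦ by simpa using offProb_le_one hr hv hlam _)
    (fun u _ hu ↦ idleProb_renewal ha _ hu) fun u _ hu ↦ by
      rw [sub_self, offProb_zero, ENNReal.ofReal_one, mul_one]
      exact offProb_renewal hr hv hlam hu
  simpa [hone, offProb_zero] using h

omit hr hv hlam in
-- By the second Borel–Cantelli lemma infinitely many inter-arrival times exceed `1`.
theorem ae_arrival_unbounded {a : ℝ} (ha : 0 < a) {σ : Measure ℝ} [IsProbabilityMeasure σ] :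
    ∀ᵐ z ∂queueLaw a σ, ∀ k : ℕ, ∃ n, (k : ℝ) < arrival z n := by
  have := isProbabilityMeasure_expMeasure ha
  have := isProbabilityMeasure_queueLaw ha (σ := σ)
  let E : Set (ℝ × ℝ) := {p | 1 < p.1}
  have hE : MeasurableSet E := measurableSet_lt measurable_const measurable_fst
  have hEn : ∀ n : ℕ, MeasurableSet {z : ℕ → ℝ × ℝ | z n ∈ E} := fun n ↦ measurable_pi_apply n hE
  have hcap : ∀ F : Finset ℕ, queueLaw a σ (⋂ n ∈ F, {z : ℕ → ℝ × ℝ | z n ∈ E}) =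
      ∏ n ∈ F, (expMeasure a).prod σ E := fun F ↦ by
    rw [← Measure.infinitePi_pi (fun _ : ℕ ↦ (expMeasure a).prod σ) fun _ _ ↦ hE]
    congr 1
    ext z; simp [Set.mem_pi]
  have hone : ∀ n : ℕ, queueLaw a σ {z | z n ∈ E} = (expMeasure a).prod σ E := fun n ↦ by
    simpa using hcap {n}
  have hpos : (expMeasure a).prod σ E ≠ 0 := by
    have : E = Ioi 1 ×ˢ univ := by ext p; simp [E]
    rw [this, Measure.prod_prod, measure_univ, mul_one, expMeasure_Ioi ha zero_le_one]
    simpa using Real.exp_pos _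
  have hlim := measure_limsup_eq_one hEn ((iIndepSet_iff_meas_biInter hEn).2 fun F ↦
    (hcap F).trans (Finset.prod_congr rfl fun n _ ↦ (hone n).symm))
    ((tsum_congr hone).trans (ENNReal.tsum_const_eq_top_of_ne_zero hpos))
  have hlim' : ∀ᵐ z ∂queueLaw a σ, z ∈ limsup (fun n ↦ {z : ℕ → ℝ × ℝ | z n ∈ E}) atTop :=
    (mem_ae_iff_prob_eq_one (MeasurableSet.measurableSet_limsup hEn)).2 hlim
  filter_upwards [hlim', ae_queueLaw_pos ha] with z h1 h2 k
  rw [Filter.mem_limsup_iff_frequently_mem, Filter.frequently_atTop] at h1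
  induction k with
  | zero => exact ⟨0, by simpa using arrival_pos h2 0⟩
  | succ k ih =>
    obtain ⟨n, hn⟩ := ih
    obtain ⟨m, hm, hmE⟩ := h1 (n + 1)
    refine ⟨m, ?_⟩
    have h3 : 1 < (z m).1 := hmE
    have h4 : arrival z n ≤ ∑ i ∈ Finset.range m, (z i).1 :=
      Finset.sum_le_sum_of_subset_of_nonneg (Finset.range_mono hm) fun i _ _ ↦ (h2 i).le
    rw [arrival, Finset.sum_range_succ]
    push_cast
    linarith

/-- The set of busy times of the queue starts afresh from every idle time. -/
theorem isRegenerativeSet_busySet : IsRegenerativeSet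
    (queueLaw (2 * r * v * lam) (serviceLaw r v)) busySet (offProb r v lam) (2 * r / v) := by
  have hσ := isProbabilityMeasure_serviceLaw hr hv
  have ha : 0 < 2 * r * v * lam := by positivity
  have hE := isProbabilityMeasure_expMeasure ha
  have hP := isProbabilityMeasure_queueLaw ha (σ := serviceLaw r v)
  have hD : 0 < 2 * r / v := by positivity
  have hoff : ∀ F : Finset ℝ, queueLaw (2 * r * v * lam) (serviceLaw r v)
      {z | ∀ t ∈ F, t ∉ busySet z} = idleProb (2 * r * v * lam) (serviceLaw r v) F 0 := fun F ↦ by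
    rw [idleProb]
    congr 1
    ext z; exact forall_notMem_busySet_iff
  have hone : ∀ t, 0 ≤ t → queueLaw (2 * r * v * lam) (serviceLaw r v) {z | t ∉ busySet z} =
      ENNReal.ofReal (offProb r v lam t) := fun t ht ↦ by
    simpa [idleProb_singleton hr hv hlam ht] using hoff {t}
  refine ⟨fun t _ ↦ ?_, ?_, fun F s g hF hs hg ↦ ?_, ?_, hD, fun t ht ↦ ?_,
    fun t ht ↦ offProb_eq_of_le hr hv ht, offProb_lt_one hr hv hlam, Real.exp_pos _⟩
  · have h : MeasurableSet {z | t ∉ busySet z} := by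
      have : {z | t ∉ busySet z} = Prod.mk 0 ⁻¹' idleOn {t} := by
        ext z
        rw [mem_preimage, ← forall_notMem_busySet_iff]
        simp
      rw [this]
      exact measurable_prodMk_left (measurableSet_idleOn _)
    convert h.compl.nullMeasurableSet using 1
    ext z; simp
  · rw [hone 0 le_rfl, offProb_zero]
    simp
  · rw [hoff, hoff, idleProb_insert ha F (fun f hf ↦ (hF f hf).2) hs hg,
      idleProb_singleton hr hv hlam hg]
  · have hw : ∀ᵐ z ∂queueLaw (2 * r * v * lam) (serviceLaw r v), ∀ n, 0 < (z n).2 := by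
      refine ae_all_iff.2 fun n ↦ ?_
      have h : ∀ᵐ p ∂(expMeasure (2 * r * v * lam)).prod (serviceLaw r v), 0 < p.2 :=
        Measure.quasiMeasurePreserving_snd.ae ((ae_serviceLaw hr hv).mono fun _ h ↦ h.1)
      exact (measurePreserving_eval_infinitePi
        (fun _ : ℕ ↦ (expMeasure (2 * r * v * lam)).prod (serviceLaw r v)) n
        ).quasiMeasurePreserving.ae h
    filter_upwards [ae_arrival_unbounded ha, ae_queueLaw_pos ha, hw] with z h1 h2 h3
    refine LocallyAlternating.of_forall_lt fun T ↦ ?_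
    obtain ⟨k, hk⟩ := exists_nat_ge T
    obtain ⟨m, hm⟩ := h1 k
    refine ⟨⋃ n ∈ {n : ℕ | n < m}, Ico (arrival z n) (arrival z n + (z n).2),
      LocallyAlternating.biUnion (Set.finite_lt_nat m) fun n _ ↦
        LocallyAlternating.Ico (lt_add_of_pos_right _ (h3 n)), fun t _ htT ↦ ?_⟩
    simp only [busySet, mem_ofPred_eq, mem_iUnion, mem_Ico, exists_prop]
    refine ⟨fun ⟨n, hn⟩ ↦ ⟨n, ?_, hn⟩, fun ⟨n, _, hn⟩ ↦ ⟨n, hn⟩⟩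
    by_contra! hmn
    have h4 : arrival z m ≤ arrival z n :=
      Finset.sum_le_sum_of_subset_of_nonneg (Finset.range_mono (by omega)) fun i _ _ ↦ (h2 i).le
    linarith [hn.1]
  · rw [hone t (hD.le.trans ht), offProb_eq_of_le hr hv ht]

end

/-- The inter-arrival and service times of an M/GI/∞ queue are i.i.d. pairs of independent
components. -/
theorem IsMGInfQueue.hasLaw {Ω : Type*} [MeasurableSpace Ω] {Q : Measure Ω}
    [IsProbabilityMeasure Q] {a : ℝ} (ha : 0 < a) {σ : Measure ℝ} [IsProbabilityMeasure σ]
    {X W : ℕ → Ω → ℝ} (h : IsMGInfQueue Q a σ X W) :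
    HasLaw (fun ω n ↦ (X n ω, W n ω)) (queueLaw a σ) Q := by
  have := isProbabilityMeasure_expMeasure ha
  have := isProbabilityMeasure_queueLaw ha (σ := σ)
  let ν : ℕ ⊕ ℕ → Measure ℝ := Sum.elim (fun _ ↦ expMeasure a) fun _ ↦ σ
  have hν : ∀ i, IsProbabilityMeasure (ν i) := by
    rintro (i | i)
    exacts [isProbabilityMeasure_expMeasure ha, inferInstanceAs (IsProbabilityMeasure σ)]
  have hlaw : ∀ i, HasLaw (fun ω ↦ Sum.elim X W i ω) (ν i) Q := by
    rintro (i | i)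
    exacts [h.law_arrival i, h.law_service i]
  have h1 : HasLaw (fun ω i ↦ Sum.elim X W i ω) (Measure.infinitePi ν) Q :=
    h.indep.hasLaw_infinitePi hlaw (aemeasurable_pi_iff.2 fun i ↦ (hlaw i).aemeasurable)
  -- Independence over `ℕ ⊕ ℕ` gives a product of real laws, while `queueLaw` is a product of laws
  -- of pairs. As `split` maps `queueLaw` to the former and `join` inverts it, the two agree.
  let split : (ℕ → ℝ × ℝ) → ℕ ⊕ ℕ → ℝ := fun z i ↦ Sum.elim (fun n ↦ (z n).1) (fun n ↦ (z n).2) i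
  let join : (ℕ ⊕ ℕ → ℝ) → ℕ → ℝ × ℝ := fun y n ↦ (y (.inl n), y (.inr n))
  have hsplit : Measurable split := measurable_pi_lambda _ fun i ↦ by
    rcases i with n | n
    exacts [(measurable_pi_apply n).fst, (measurable_pi_apply n).snd]
  have hjoin : Measurable join := by fun_prop
  let idx : ℕ ⊕ ℕ → ℕ × Bool := Sum.elim (fun n ↦ (n, true)) fun n ↦ (n, false)
  have hidx : idx.Injective := by
    rintro (m | m) (n | n) hmn <;> simp_all [idx]
  have hind : iIndepFun (fun i z ↦ split z i) (queueLaw a σ) := by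
    convert (iIndepFun_components_infinitePi (μ := expMeasure a) (ν := σ)).precomp hidx using 2 with i
    · rcases i with n | n <;> rfl
    · rfl
  have hn : ∀ n : ℕ, (queueLaw a σ).map (fun z ↦ z n) = (expMeasure a).prod σ := fun n ↦
    Measure.infinitePi_map_eval _ n
  have h2 : HasLaw split (Measure.infinitePi ν) (queueLaw a σ) := by
    refine hind.hasLaw_infinitePi (fun i ↦ ⟨(measurable_pi_apply i).comp hsplit |>.aemeasurable, ?_⟩)
      hsplit.aemeasurable
    rcases i with n | n
    · change (queueLaw a σ).map (Prod.fst ∘ fun z ↦ z n) = expMeasure a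
      rw [← Measure.map_map measurable_fst (measurable_pi_apply n), hn]
      simp
    · change (queueLaw a σ).map (Prod.snd ∘ fun z ↦ z n) = σ
      rw [← Measure.map_map measurable_snd (measurable_pi_apply n), hn]
      simp
  refine HasLaw.comp (Y := join) ⟨hjoin.aemeasurable, ?_⟩ h1
  rw [← h2.map_eq, Measure.map_map hjoin hsplit]
  exact Measure.map_id

end

end SNRCrossing

/-! ### The theorem -/

theorem mainTheorem1 {Ω : Type*} [MeasurableSpace Ω] (P : Measure Ω) [IsProbabilityMeasure P]
    (Φ : Ω → Set Plane) (lam : ℝ) (hlam : 0 < lam) (hΦ : IsPoissonProcess P Φ lam)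
    (p w β v : ℝ) (hp : 0 < p) (hw : 0 < w) (hβ : 2 < β) (hv : 0 < v)
    (e : Plane) (he : ‖e‖ = 1) (γ : ℝ) (hγ : 0 < γ)
    (r : ℝ) (hr : r = coverageRadius p w β γ)
    (S : Ω → Set ℝ) (hS : S = coveredTimes Φ p w β v γ e) :
    -- the level crossing process is an alternating renewal process
    IsAlternatingRenewal P S ∧
    -- on and off periods are distributed as busy and idle periods of the queue
    (∀ (Ω' : Type*) [MeasurableSpace Ω'] (Q : Measure Ω') [IsProbabilityMeasure Q]
      (X W : ℕ → Ω' → ℝ), IsMGInfQueue Q (2 * r * v * lam) (serviceLaw r v) X W →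
      IsAlternatingRenewal Q (busyTimes X W) ∧
      ∀ n m, IdentDistrib (fun ω ↦ onPeriod (S ω) n) (fun ω ↦ onPeriod (busyTimes X W ω) m) P Q ∧
        IdentDistrib (fun ω ↦ offPeriod (S ω) n) (fun ω ↦ offPeriod (busyTimes X W ω) m) P Q) ∧
    -- off periods are exponential
    (∀ n, HasLaw (fun ω ↦ offPeriod (S ω) n) (expMeasure (2 * lam * v * r)) P) ∧
    -- the forward recurrence time of the on period is a geometric sum
    (∀ (Ω' : Type*) [MeasurableSpace Ω'] (Q : Measure Ω') [IsProbabilityMeasure Q]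
      (M : Ω' → ℕ) (U : ℕ → Ω' → ℝ),
      IsBusySummands Q (2 * r * v * lam) (serviceLaw r v) M U →
      ∀ n, HasLaw (fun ω ↦ ∑ i ∈ Finset.range (M ω), U i ω)
        (forwardRecurrence (P.map (fun ω ↦ onPeriod (S ω) n))) Q) ∧
    -- the process is stationary, and is on with the stated probability
    IsStationaryProcess P (levelCrossing Φ p w β v γ e) ∧
    ∀ t : ℝ, 0 ≤ t → P.real {ω | levelCrossing Φ p w β v γ e t ω = 1} =
      1 - Real.exp (-(lam * Real.pi * r ^ 2)) := by
  have hβ0 : 0 < β := by linarith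
  have hr0 : 0 < r := hr ▸ coverageRadius_pos hp hw hγ
  have ha : 0 < 2 * r * v * lam := by positivity
  have hσ := isProbabilityMeasure_serviceLaw hr0 hv
  have hE := isProbabilityMeasure_expMeasure ha
  have hreg : IsRegenerativeSet P S (offProb r v lam) (2 * r / v) := by
    rw [hr, hS]
    exact isRegenerativeSet_coveredTimes hΦ hlam hp hw hβ0 hv hγ he
  have hrate := hasRate_offProb hr0 hv hlam
  obtain ⟨κ, hκP, hκ, hlaw⟩ := hreg.exists_hasLaw hrate
  have hκ0 := hκ.isProbabilityMeasure_startOff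
  have hcyc : Measurable fun x ↦ (cycle x 0).1 :=
    ((measurable_pi_apply 0).comp measurable_cycle).fst
  have hF : IsProbabilityMeasure ((startOff κ).map fun x ↦ (cycle x 0).1) :=
    Measure.isProbabilityMeasure_map hcyc.aemeasurable
  obtain ⟨hren, hon, hoff⟩ := isAlternatingRenewal_of_hasLaw hreg.ae_alternates hlaw
  refine ⟨hren, fun Ω' _ Q _ X W hQ ↦ ?_, fun n ↦ ?_, fun Ω' _ Q _ M U hU n ↦ ?_, ?_, fun t _ ↦ ?_⟩
  · have hqP := isProbabilityMeasure_queueLaw ha (σ := serviceLaw r v)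
    have hq := isRegenerativeSet_busySet hr0 hv hlam
    have hZ := hQ.hasLaw ha
    obtain ⟨κ', hκP', hκ', hlaw'⟩ := hq.exists_hasLaw hrate
    -- Network and queue regenerate with the same `offProb`, so their paths started off have the
    -- same law, and with it the same law of the on period.
    rw [hκ'.startOff_unique hκ] at hlaw'
    have hbusy : (fun ω n ↦ (onPeriod (busyTimes X W ω) n, offPeriod (busyTimes X W ω) n)) =
        fun ω ↦ (fun z n ↦ (onPeriod (busySet z) n, offPeriod (busySet z) n))
          fun n ↦ (X n ω, W n ω) := by
      funext ω n; rw [busyTimes_eq]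
    have hlawQ : HasLaw (fun ω n ↦ (onPeriod (busyTimes X W ω) n, offPeriod (busyTimes X W ω) n))
        (Measure.infinitePi fun _ ↦ ((startOff κ).map fun x ↦ (cycle x 0).1).prod
          (expMeasure (2 * r * v * lam))) Q := by
      rw [hbusy]
      exact hlaw'.comp hZ
    have haltQ : ∀ᵐ ω ∂Q, Alternates (busyTimes X W ω) := by
      have h := hq.ae_alternates
      rw [← hZ.map_eq] at h
      filter_upwards [ae_of_ae_map hZ.aemeasurable h] with ω hω
      rw [busyTimes_eq]
      exact hω
    obtain ⟨hrenQ, honQ, hoffQ⟩ := isAlternatingRenewal_of_hasLaw haltQ hlawQ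
    exact ⟨hrenQ, fun n m ↦ ⟨(hon n).identDistrib (honQ m), (hoff n).identDistrib (hoffQ m)⟩⟩
  · rw [show 2 * lam * v * r = 2 * r * v * lam by ring]
    exact hoff n
  · rw [(hon n).map_eq]
    have hν := busyProb_serviceLaw hr0 hv lam
    have hon0 : ((startOff κ).map fun x ↦ (cycle x 0).1) (Iio 0) = 0 := by
      rw [← (hon 0).map_eq, Measure.map_apply_of_aemeasurable (hon 0).aemeasurable measurableSet_Iio]
      refine measure_eq_zero_iff_ae_notMem.2 ?_
      filter_upwards [hreg.ae_alternates] with ω hω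
      exact not_lt.2 (sub_nonneg.2 (hω.up_lt_down 0).le)
    -- Here `1 - ν` is the value of `offProb` at `2 r / v`, its minimum, so `(1 - offProb u) / ν` is
    -- a distribution function in `u ≥ 0`.
    refine hasLaw_geometric_sum ha (ν := busyProb (2 * r * v * lam) (serviceLaw r v))
      (H := offProb r v lam) ?_ ?_ (fun t _ ↦ ?_) (offProb_le_one hr0 hv hlam)
      (offProb_zero r v lam) hon0 (fun θ J hθ hJ hJ' ↦ ?_) hU.measurable_M hU.law_M hU.measurable_U
      (fun n u hu ↦ ?_) hU.indep_U hU.indep_M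
    · rw [hν]; linarith [offProb_lt_one hr0 hv hlam]
    · rw [hν]; linarith [Real.exp_pos (-(2 * r * v * lam *
        ∫ z in 0..max (2 * r / v) 0, serviceTail r v z)),
        show offProb r v lam (2 * r / v) = Real.exp (-(2 * r * v * lam *
          ∫ z in 0..max (2 * r / v) 0, serviceTail r v z)) from rfl]
    · rw [hν, sub_sub_cancel]; exact le_offProb hr0 hv hlam t
    · exact hκ.lintegral_laplaceKernel_tail hrate
        (ENNReal.continuous_ofReal.comp (continuous_offProb r v lam)) (fun q ↦ rfl) hθ hJ hJ'
    · rw [hU.law_U n u hu, load_mul_forwardRecurrence hr0 hv _ hu, offProb_of_nonneg hu]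
  · exact isStationaryProcess_levelCrossing hΦ hlam hp hw hβ0 hγ
  · rw [hr]
    exact measureReal_levelCrossing hΦ hlam hp hw hβ0 hγ t
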